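/- Let $0\le p<n$ be integers and $R>0$. Let $G_{p,n}$ be the Grassmannian of $p$-dimensional linear subspaces of $\mathbb R^n$, let $G(p,n)=\{(\sigma,x):\sigma\in G_{p,n},\ x\in\sigma^\perp\}$ be the manifold of affine $p$-planes ($(\sigma,x)$ stands for the plane $\sigma+x$, whose distance from the origin is $\|x\|$), and let $F_{p,n}=\{(\sigma,\omega)\in G_{p,n}\times S^{n-1}:\omega\perp\sigma\}$. The motion group $M(n)=O(n)\ltimes\mathbb R^n$ acts on $G(p,n)$ and $O(n)$ acts on $F_{p,n}$; elements of the Lie algebras $\mathfrak m(n)$ and $\mathfrak{so}(n)$ act on smooth functions by $(Y\cdot f)(z)=\frac{d}{dt}f(\exp(-tY)\cdot z)\big|_{t=0}$. Define the following spaces of complex-valued functions: * $\mathcal S(G(p,n))$: all $f\in C^\infty(G(p,n))$ with $\sup_{(\sigma,x)}\|x\|^N|(Y_1\cdots Y_m\cdot f)(\sigma,x)|<\infty$ for all $N,m\ge0$ and $Y_1,\dots,Y_m\in\mathfrak m(n)$; * $\mathcal S(F_{p,n}\times\mathbb R)$: all $F\in C^\infty(F_{p,n}\times\mathbb R)$ with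 $\sup_{(\sigma,\omega;r)}|r|^N|\partial_r^j(X_1\cdots X_m\cdot F)(\sigma,\omega;r)|<\infty$ for all $N,j,m\ge0$ and $X_1,\dots,X_m\in\mathfrak{so}(n)$; * $\mathcal D(\bar\beta_p^R)$: all $f\in C^\infty(G(p,n))$ supported in the set $\bar\beta_p^R$ of $p$-planes at distance $\le R$ from the origin. The partial Fourier transform of $f\in\mathcal S(G(p,n))$ is $\mathcal F_pf(\sigma,y)=\int_{\sigma^\perp}f(\sigma,x)e^{-i\langle y,x\rangle}\,dx$, and in polar coordinates it is regarded as the function $(\sigma,\omega;\lambda)\mapsto\mathcal F_pf(\sigma,\lambda\omega)$ on $F_{p,n}\times\mathbb R$. For a function $\widetilde F$ on $F_{p,n}\times\mathbb R$ consider the conditions: (i) For each $(\sigma,\omega)\in F_{p,n}$ the function $\lambda\mapsto\widetilde F(\sigma,\omega;\lambda)$ extends to an entire function on $\mathbb C$, and for every integer $N\ge0$ $$\sup_{(\sigma,\omega;\lambda)\in F_{p,n}\times\mathbb C}\left|(1+|\lambda|)^N\,\widetilde F(\sigma,\omega;\lambda)\,e^{-R|\operatorname{Im}\lambda|}\right|<\infty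 .$$ (ii) For each integer $k\ge0$, each $\sigma\in G_{p,n}$ and each homogeneous harmonic polynomial $h_\sigma$ of degree $k$ on $\sigma^\perp$, the function $$\lambda\mapsto\lambda^{-k}\int_{S_\sigma}\widetilde F(\sigma,\omega;\lambda)\,h_\sigma(\omega)\,d\omega$$ is even and entire (after removing the singularity at $0$), where $S_\sigma$ is the unit sphere of $\sigma^\perp$ and $d\omega$ its surface measure. **Theorem.** (a) In polar coordinates, $f\mapsto\mathcal F_pf$ maps $\mathcal D(\bar\beta_p^R)$ onto the space of all functions $\widetilde F\in\mathcal S(F_{p,n}\times\mathbb R)$ that satisfy (i) and (ii). (b) A function $f\in\mathcal S(G(p,n))$ belongs to $\mathcal D(\bar\beta_p^R)$ if and only if $\widetilde F(\sigma,\omega;\lambda)=\mathcal F_pf(\sigma,\lambda\omega)$ is in $C^\infty(F_{p,n}\times\mathbb R)$ and satisfies (i) and (ii). -/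

import Mathlib

open scoped ContDiff InnerProductSpace Laplacian
open MeasureTheory

noncomputable section

/-- Smooth functions on a submanifold `M` of a Euclidean (normed) space `V`, given as the image of
an injection `ι : X → V`: `f` is smooth iff near every point of `M` it is the restriction of a
smooth function on `V`. -/
def SmoothOnImage {X V : Type*} [NormedAddCommGroup V] [NormedSpace ℝ V]
    (ι : X → V) (f : X → ℂ) : Prop :=
  ∀ a : X, ∃ U : Set V, IsOpen U ∧ ι a ∈ U ∧
    ∃ g : V → ℂ, ContDiff ℝ ∞ g ∧ ∀ b : X, ι b ∈ U → f b = g (ι b)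

/-- The affine Grassmannian `G(p,n)`: the `p`-plane `σ + x` is given by its direction `σ`, a
`p`-dimensional linear subspace of `ℝⁿ`, and its foot `x ∈ σᗮ`, the point of the plane that is
closest to the origin. -/
@[ext] structure AffGr (p n : ℕ) where
  dir : Submodule ℝ (EuclideanSpace ℝ (Fin n))
  finrank_dir : Module.finrank ℝ dir = p
  foot : EuclideanSpace ℝ (Fin n)
  foot_mem : foot ∈ dirᗮ

/-- The flag manifold `F_{p,n}` of pairs `(σ, ω)`, where `σ` is a `p`-dimensional linear subspace
of `ℝⁿ` and `ω` is a unit vector orthogonal to `σ`. -/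
@[ext] structure FlagMfd (p n : ℕ) where
  dir : Submodule ℝ (EuclideanSpace ℝ (Fin n))
  finrank_dir : Module.finrank ℝ dir = p
  vec : EuclideanSpace ℝ (Fin n)
  norm_vec : ‖vec‖ = 1
  vec_mem : vec ∈ dirᗮ

/-- `G(p,n)` as a submanifold of `End(ℝⁿ) × ℝⁿ`: a subspace is represented by the orthogonal
projection onto it. -/
def AffGr.embed {p n : ℕ} (l : AffGr p n) :
    (EuclideanSpace ℝ (Fin n) →L[ℝ] EuclideanSpace ℝ (Fin n)) × EuclideanSpace ℝ (Fin n) :=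
  (l.dir.starProjection, l.foot)

/-- `F_{p,n} × ℝ` as a submanifold of `End(ℝⁿ) × ℝⁿ × ℝ`. -/
def FlagMfd.embed {p n : ℕ} (a : FlagMfd p n × ℝ) :
    (EuclideanSpace ℝ (Fin n) →L[ℝ] EuclideanSpace ℝ (Fin n)) × EuclideanSpace ℝ (Fin n) × ℝ :=
  (a.1.dir.starProjection, a.1.vec, a.2)

/-- `f ∈ C^∞(G(p,n))`. -/
def AffGr.IsSmooth {p n : ℕ} (f : AffGr p n → ℂ) : Prop :=
  SmoothOnImage AffGr.embed f

/-- `F ∈ C^∞(F_{p,n} × ℝ)`. -/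
def FlagMfd.IsSmooth {p n : ℕ} (F : FlagMfd p n × ℝ → ℂ) : Prop :=
  SmoothOnImage FlagMfd.embed F

/-- The Lie algebra `so(n)`: the skew-adjoint endomorphisms of `ℝⁿ`. -/
abbrev SoAlg (n : ℕ) : Type :=
  skewAdjoint (EuclideanSpace ℝ (Fin n) →L[ℝ] EuclideanSpace ℝ (Fin n))

theorem exp_smul_mem_unitary {n : ℕ} (X : SoAlg n) (t : ℝ) :
    NormedSpace.exp (t • (X : EuclideanSpace ℝ (Fin n) →L[ℝ] EuclideanSpace ℝ (Fin n))) ∈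
      unitary (EuclideanSpace ℝ (Fin n) →L[ℝ] EuclideanSpace ℝ (Fin n)) := by
  let _ : NormedAlgebra ℚ (EuclideanSpace ℝ (Fin n) →L[ℝ] EuclideanSpace ℝ (Fin n)) :=
    NormedAlgebra.restrictScalars ℚ ℝ _
  exact NormedSpace.exp_mem_unitary_of_mem_skewAdjoint (skewAdjoint.smul_mem t X.2)

/-- The one-parameter group `t ↦ exp(tX)` of rotations of `ℝⁿ` generated by `X ∈ so(n)`. -/
def expRot {n : ℕ} (X : SoAlg n) (t : ℝ) :
    EuclideanSpace ℝ (Fin n) ≃ₗᵢ[ℝ] EuclideanSpace ℝ (Fin n) :=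
  Unitary.linearIsometryEquiv
    ⟨NormedSpace.exp (t • (X : EuclideanSpace ℝ (Fin n) →L[ℝ] EuclideanSpace ℝ (Fin n))),
      exp_smul_mem_unitary X t⟩

theorem finrank_map_isometry {n : ℕ}
    (u : EuclideanSpace ℝ (Fin n) ≃ₗᵢ[ℝ] EuclideanSpace ℝ (Fin n))
    (s : Submodule ℝ (EuclideanSpace ℝ (Fin n))) :
    Module.finrank ℝ (s.map (u.toLinearEquiv : _ →ₗ[ℝ] EuclideanSpace ℝ (Fin n)))
      = Module.finrank ℝ s :=
  LinearEquiv.finrank_map_eq u.toLinearEquiv s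

theorem mem_orthogonal_map_isometry {n : ℕ}
    (u : EuclideanSpace ℝ (Fin n) ≃ₗᵢ[ℝ] EuclideanSpace ℝ (Fin n))
    (s : Submodule ℝ (EuclideanSpace ℝ (Fin n))) {x : EuclideanSpace ℝ (Fin n)} (hx : x ∈ sᗮ) :
    u x ∈ (s.map (u.toLinearEquiv : _ →ₗ[ℝ] EuclideanSpace ℝ (Fin n)))ᗮ := by
  rw [Submodule.mem_orthogonal] at hx ⊢
  rintro _ ⟨y, hy, rfl⟩
  simpa using hx y hy

/-- The image of the `p`-plane `σ + x` under the orthogonal transformation `u`. -/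
def AffGr.rotate {p n : ℕ} (u : EuclideanSpace ℝ (Fin n) ≃ₗᵢ[ℝ] EuclideanSpace ℝ (Fin n))
    (l : AffGr p n) : AffGr p n where
  dir := l.dir.map (u.toLinearEquiv : _ →ₗ[ℝ] EuclideanSpace ℝ (Fin n))
  finrank_dir := (finrank_map_isometry u l.dir).trans l.finrank_dir
  foot := u l.foot
  foot_mem := mem_orthogonal_map_isometry u l.dir l.foot_mem

/-- The image of the `p`-plane `σ + x` under the translation by `v`. -/
def AffGr.translate {p n : ℕ} (v : EuclideanSpace ℝ (Fin n)) (l : AffGr p n) : AffGr p n where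
  dir := l.dir
  finrank_dir := l.finrank_dir
  foot := l.foot + l.dirᗮ.starProjection v
  foot_mem := l.dirᗮ.add_mem l.foot_mem (Submodule.starProjection_apply_mem _ _)

/-- The image of the flag `(σ, ω)` under the orthogonal transformation `u`. -/
def FlagMfd.rotate {p n : ℕ} (u : EuclideanSpace ℝ (Fin n) ≃ₗᵢ[ℝ] EuclideanSpace ℝ (Fin n))
    (a : FlagMfd p n) : FlagMfd p n where
  dir := a.dir.map (u.toLinearEquiv : _ →ₗ[ℝ] EuclideanSpace ℝ (Fin n))
  finrank_dir := (finrank_map_isometry u a.dir).trans a.finrank_dir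
  vec := u a.vec
  norm_vec := (u.norm_map a.vec).trans a.norm_vec
  vec_mem := mem_orthogonal_map_isometry u a.dir a.vec_mem

/-- The action of `X ∈ so(n)` or of `v ∈ ℝⁿ` (infinitesimal translation) on functions on
`G(p,n)`: `(Y · f)(ℓ) = d/dt f(exp(-tY) · ℓ)` at `t = 0`. Together these span the action of the
Lie algebra `so(n) ⋉ ℝⁿ` of the Euclidean motion group. -/
def AffGr.lieDeriv {p n : ℕ} (Y : SoAlg n ⊕ EuclideanSpace ℝ (Fin n)) (f : AffGr p n → ℂ) :
    AffGr p n → ℂ :=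
  match Y with
  | Sum.inl X => fun l => deriv (fun t : ℝ => f (l.rotate (expRot X (-t)))) 0
  | Sum.inr v => fun l => deriv (fun t : ℝ => f (l.translate ((-t) • v))) 0

/-- The action of `X ∈ so(n)` on functions on `F_{p,n} × ℝ` through the first variable. -/
def FlagMfd.lieDeriv {p n : ℕ} (X : SoAlg n) (F : FlagMfd p n × ℝ → ℂ) :
    FlagMfd p n × ℝ → ℂ :=
  fun a => deriv (fun t : ℝ => F (a.1.rotate (expRot X (-t)), a.2)) 0

/-- The Schwartz space `𝓢(G(p,n))`. -/
def AffGr.IsSchwartz {p n : ℕ} (f : AffGr p n → ℂ) : Prop :=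
  AffGr.IsSmooth f ∧
    ∀ (N : ℕ) (Ys : List (SoAlg n ⊕ EuclideanSpace ℝ (Fin n))), ∃ C : ℝ, ∀ l : AffGr p n,
      ‖l.foot‖ ^ N * ‖Ys.foldr AffGr.lieDeriv f l‖ ≤ C

/-- The Schwartz space `𝓢(F_{p,n} × ℝ)`: all derivatives `(d/dr)^j X₁ ⋯ X_m F` with `X_i ∈ so(n)`
decrease rapidly as `|r| → ∞`, uniformly on the compact manifold `F_{p,n}`. -/
def FlagMfd.IsSchwartz {p n : ℕ} (F : FlagMfd p n × ℝ → ℂ) : Prop :=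
  FlagMfd.IsSmooth F ∧
    ∀ (N j : ℕ) (Xs : List (SoAlg n)), ∃ C : ℝ, ∀ (a : FlagMfd p n) (r : ℝ),
      |r| ^ N * ‖iteratedDeriv j (fun s : ℝ => Xs.foldr FlagMfd.lieDeriv F (a, s)) r‖ ≤ C

/-- `𝓓(β̄_p^R)`: the smooth functions on `G(p,n)` that are supported in the set of `p`-planes at
distance `≤ R` from the origin. -/
def AffGr.testFunctions (p n : ℕ) (R : ℝ) : Set (AffGr p n → ℂ) :=
  {f | AffGr.IsSmooth f ∧ ∀ l : AffGr p n, R < ‖l.foot‖ → f l = 0}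

/-- The partial Fourier transform `𝓕_p f (σ, y) = ∫_{σᗮ} f(σ, x) e^{-i⟨y, x⟩} dx`. -/
def partialFourier {p n : ℕ} (f : AffGr p n → ℂ) (l : AffGr p n) : ℂ :=
  ∫ x : l.dirᗮ, f ⟨l.dir, l.finrank_dir, x, x.2⟩ *
    Complex.exp (-Complex.I * ((⟪l.foot, (x : EuclideanSpace ℝ (Fin n))⟫_ℝ : ℝ) : ℂ))

/-- The map `F_{p,n} × ℝ → G(p,n)`, `(σ, ω; r) ↦ (σ, rω)`. -/
def FlagMfd.toAffGr {p n : ℕ} (a : FlagMfd p n × ℝ) : AffGr p n where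
  dir := a.1.dir
  finrank_dir := a.1.finrank_dir
  foot := a.2 • a.1.vec
  foot_mem := a.1.dirᗮ.smul_mem a.2 a.1.vec_mem

/-- The partial Fourier transform in polar coordinates, `(σ, ω; r) ↦ 𝓕_p f (σ, rω)`. -/
def polarFourier {p n : ℕ} (f : AffGr p n → ℂ) : FlagMfd p n × ℝ → ℂ :=
  fun a => partialFourier f (FlagMfd.toAffGr a)

/-- `h` is a homogeneous harmonic polynomial of degree `k` on the Euclidean space `V`. -/
def IsHarmonicPoly {V : Type*} [NormedAddCommGroup V] [InnerProductSpace ℝ V]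
    [FiniteDimensional ℝ V] (k : ℕ) (h : V → ℂ) : Prop :=
  (∃ M : V [×k]→L[ℝ] ℂ, ∀ x, h x = M (fun _ => x)) ∧ ∀ x, Δ h x = 0

/-- A unit vector of `σᗮ` gives a flag with first component `σ`. -/
def FlagMfd.ofSphere {p n : ℕ} (s : Submodule ℝ (EuclideanSpace ℝ (Fin n)))
    (hs : Module.finrank ℝ s = p) (w : Metric.sphere (0 : sᗮ) 1) : FlagMfd p n where
  dir := s
  finrank_dir := hs
  vec := ((w : sᗮ) : EuclideanSpace ℝ (Fin n))
  norm_vec := mem_sphere_zero_iff_norm.mp w.2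
  vec_mem := (w : sᗮ).2

/-- The Paley–Wiener conditions of type `R` on `F : F_{p,n} × ℝ → ℂ`. The function `Φ (σ, ω)` is
the (unique) entire extension of `r ↦ F(σ, ω; r)`. The first three clauses say that the extension
exists and satisfies the uniform exponential estimates. The last one says that, for every `σ` and
every homogeneous harmonic polynomial `h` of degree `k` on `σᗮ`, the function
`z ↦ z^{-k} ∫_{S_σ} F(σ, ω; z) h(ω) dω` is even and entire, that is, extends from `z ≠ 0` to an
even entire function `g`; `dω` is the surface measure of the unit sphere `S_σ` of `σᗮ`. -/
def PaleyWiener {p n : ℕ} (R : ℝ) (F : FlagMfd p n × ℝ → ℂ) : Prop :=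
  ∃ Φ : FlagMfd p n → ℂ → ℂ,
    (∀ a, Differentiable ℂ (Φ a)) ∧
    (∀ (a : FlagMfd p n) (r : ℝ), Φ a (r : ℂ) = F (a, r)) ∧
    (∀ N : ℕ, ∃ C : ℝ, ∀ (a : FlagMfd p n) (z : ℂ),
      (1 + ‖z‖) ^ N * ‖Φ a z‖ * Real.exp (-R * |z.im|) ≤ C) ∧
    (∀ (k : ℕ) (s : Submodule ℝ (EuclideanSpace ℝ (Fin n))) (hs : Module.finrank ℝ s = p)
      (h : sᗮ → ℂ), IsHarmonicPoly k h →
      ∃ g : ℂ → ℂ, Differentiable ℂ g ∧ (∀ z, g (-z) = g z) ∧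
        ∀ z : ℂ, z ≠ 0 → g z = (z ^ k)⁻¹ *
          ∫ w : Metric.sphere (0 : sᗮ) 1, Φ (FlagMfd.ofSphere s hs w) z * h w
            ∂(volume : Measure sᗮ).toSphere)

end

/-!
# Paley–Wiener theorem for the partial Fourier transform on affine Grassmannians

On each fibre `σᗮ` the partial Fourier transform is the Euclidean one, so the content is twofold: to
recognize the support condition on the fibres from the conditions (i) and (ii) in polar coordinates,
and to control smoothness and decay as `σ` varies over the Grassmannian.

*From functions to transforms.* For a test function `f` of support radius `R`, the transform in
polar coordinates is a superposition `∫ u(σ, ω, y) e^{-iz⟨ω, y⟩} dy` of plane waves over `y ∈ σᗮ`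
with a smooth amplitude of bounded support (`flagWave`). This class of functions is closed under
rotations (`lieDeriv_flagWave`), under `∂_r` (`hasDerivAt_flagWave`) and, by integration by parts in
the direction `ω`, under multiplication by `z` (`mul_flagWave`). As such superpositions are bounded
by `C e^{R |Im z|}`, the transform is a Schwartz function and satisfies (i). A harmonic polynomial
of degree `k` is orthogonal on the sphere to all polynomials of lower degree; hence the integral in
(ii) vanishes to order `k` at `0`, and it has the parity of `k`
(`exists_entire_harmonic_component`).

*Supports.* Let `φ` be a function on `σᗮ`, of dimension `d`, whose harmonic components of degree `k`
have the form `rᵏ G(r)` with `G` even, entire and of exponential type `R`. Its Fourier transform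
vanishes outside the ball of radius `R` (`waveInt_eq_zero_of_harmonic_components`). For a radial `φ`
this is a shift of contour (`waveInt_radial_eq_zero`). In general, the harmonic component of degree
`k` of the transform is, up to a constant and a power of `r`, the transform of the radial function
`G` in dimension `d + 2k` (Bochner's relation). Instead of Bessel functions, both sides are tested
against Gaussians: the transform of a harmonic polynomial times a Gaussian is again of this form
(`integral_harmonic_mul_gaussWave`), and Gaussian integrals determine a continuous function of `r`
(`eq_zero_of_forall_integral_gauss_eq_zero`). Finally the harmonic polynomials are total on the
sphere, since the Laplacian is adjoint to multiplication by `|x|²` for the Fischer inner product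
(`exists_harmonic_add_normSq_mul`, `eq_zero_of_forall_harmonic_integral_eq_zero`). Condition (ii)
also yields `F(σ, -ω; -r) = F(σ, ω; r)` (`PaleyWiener.neg_neg`), so `F` descends from `F_{p,n} × ℝ`
to the complement of the zero vector in each fibre.

*Smoothness of the inverse transform.* Near the origin of `σᗮ` polar coordinates are singular, so
one cannot simply argue that the inverse transform of a smooth function is smooth. But the integral
over `σᗮ` can be pulled back to a fixed fibre by a smooth local section `U` of `O(n) → Gr(p, n)`
(`exists_local_section`). Its derivatives in `σ` are then expressed by the action of `so(n)` on `F`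
(`hasFDerivAt_section`), which the Schwartz condition controls, and those in `x` multiply the
integrand by coordinates; the resulting family of integrands is closed under differentiation
(`contDiffOn_integral_of_family`, `isSmooth_inverse`). Fourier inversion on each fibre then gives
both the surjectivity in (a) (`exists_testFunction_of_paleyWiener`) and the criterion in (b)
(`mem_testFunctions_of_paleyWiener`).
-/

noncomputable section

/-! ### Harmonic polynomials -/

/-- The Laplacian `∑ ∂ᵢ²` as an operator on polynomials. -/
def lapPoly {d : ℕ} (P : MvPolynomial (Fin d) ℂ) : MvPolynomial (Fin d) ℂ :=
  ∑ i, MvPolynomial.pderiv i (MvPolynomial.pderiv i P)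

/-- The polynomial `|x|² = ∑ xᵢ²`. -/
def normSqPoly (d : ℕ) : MvPolynomial (Fin d) ℂ := ∑ i, MvPolynomial.X i * MvPolynomial.X i

/-- The Fischer inner product `∑ₘ m! Pₘ conj(Qₘ)`, for which multiplication by `xᵢ` is adjoint
to `∂ᵢ`. -/
def fischer {d : ℕ} (P Q : MvPolynomial (Fin d) ℂ) : ℂ :=
  ∑ m ∈ P.support, (∏ i, ((m i).factorial : ℂ)) * P.coeff m * (starRingEnd ℂ) (Q.coeff m)

theorem fischer_eq_sum {d : ℕ} (P Q : MvPolynomial (Fin d) ℂ) (s : Finset (Fin d →₀ ℕ))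
    (hs : P.support ⊆ s) :
    fischer P Q =
      ∑ m ∈ s, (∏ i, ((m i).factorial : ℂ)) * P.coeff m * (starRingEnd ℂ) (Q.coeff m) := by
  refine Finset.sum_subset hs fun m _ hm => ?_
  rw [MvPolynomial.notMem_support_iff.mp hm]
  simp

theorem fischer_add_left {d : ℕ} (P P' Q : MvPolynomial (Fin d) ℂ) :
    fischer (P + P') Q = fischer P Q + fischer P' Q := by
  classical
  rw [fischer_eq_sum _ Q (P.support ∪ P'.support) MvPolynomial.support_add,
    fischer_eq_sum P Q _ Finset.subset_union_left,
    fischer_eq_sum P' Q _ Finset.subset_union_right, ← Finset.sum_add_distrib]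
  refine Finset.sum_congr rfl fun m _ => ?_
  rw [MvPolynomial.coeff_add]
  ring

theorem fischer_sum_left {d : ℕ} {ι : Type*} (s : Finset ι) (P : ι → MvPolynomial (Fin d) ℂ)
    (Q : MvPolynomial (Fin d) ℂ) :
    fischer (∑ i ∈ s, P i) Q = ∑ i ∈ s, fischer (P i) Q := by
  classical
  induction s using Finset.induction_on with
  | empty => simp [fischer]
  | insert a s ha ih => rw [Finset.sum_insert ha, Finset.sum_insert ha, fischer_add_left, ih]

theorem fischer_sum_right {d : ℕ} {ι : Type*} (s : Finset ι) (P : MvPolynomial (Fin d) ℂ)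
    (Q : ι → MvPolynomial (Fin d) ℂ) :
    fischer P (∑ i ∈ s, Q i) = ∑ i ∈ s, fischer P (Q i) := by
  simp only [fischer, MvPolynomial.coeff_sum, map_sum, Finset.mul_sum]
  rw [Finset.sum_comm]

/-- Multiplication by `xᵢ` is adjoint to `∂ᵢ` for the Fischer inner product. -/
theorem fischer_mul_X {d : ℕ} (P Q : MvPolynomial (Fin d) ℂ) (i : Fin d) :
    fischer (P * MvPolynomial.X i) Q = fischer P (MvPolynomial.pderiv i Q) := by
  classical
  unfold fischer
  rw [MvPolynomial.support_mul_X, Finset.sum_map]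
  refine Finset.sum_congr rfl fun m _ => ?_
  have h1 : (∏ j, (((m + Finsupp.single i 1 : Fin d →₀ ℕ) j).factorial : ℂ))
      = (∏ j, ((m j).factorial : ℂ)) * ((m i : ℂ) + 1) := by
    rw [← Finset.mul_prod_erase _ _ (Finset.mem_univ i),
      ← Finset.mul_prod_erase Finset.univ (fun j => ((m j).factorial : ℂ)) (Finset.mem_univ i)]
    have : ∏ j ∈ Finset.univ.erase i, (((m + Finsupp.single i 1 : Fin d →₀ ℕ) j).factorial : ℂ)
        = ∏ j ∈ Finset.univ.erase i, ((m j).factorial : ℂ) := by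
      refine Finset.prod_congr rfl fun j hj => ?_
      have hji : i ≠ j := (Finset.ne_of_mem_erase hj).symm
      simp [hji]
    rw [this]
    simp [Nat.factorial_succ]
    ring
  simp only [addRightEmbedding_apply]
  rw [h1, MvPolynomial.coeff_mul_X, MvPolynomial.coeff_pderiv]
  simp
  ring

/-- The Fischer inner product is positive definite. -/
theorem eq_zero_of_fischer_self {d : ℕ} (P : MvPolynomial (Fin d) ℂ) (h : fischer P P = 0) :
    P = 0 := by
  have h1 : fischer P P
      = ((∑ m ∈ P.support, (∏ i, ((m i).factorial : ℝ)) * ‖P.coeff m‖ ^ 2 : ℝ) : ℂ) := by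
    unfold fischer
    push_cast
    refine Finset.sum_congr rfl fun m _ => ?_
    rw [mul_assoc, Complex.mul_conj, Complex.normSq_eq_norm_sq]
    push_cast
    rfl
  rw [h1, Complex.ofReal_eq_zero] at h
  by_contra hP
  obtain ⟨m, hm⟩ := MvPolynomial.support_nonempty.mpr hP
  have hm' := (Finset.sum_eq_zero_iff_of_nonneg (fun m _ => by positivity)).mp h m hm
  have : P.coeff m ≠ 0 := MvPolynomial.mem_support_iff.mp hm
  have hf : (0 : ℝ) < ∏ i, ((m i).factorial : ℝ) :=
    Finset.prod_pos fun i _ => by exact_mod_cast Nat.factorial_pos _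
  have : 0 < (∏ i, ((m i).factorial : ℝ)) * ‖P.coeff m‖ ^ 2 := by positivity
  linarith

theorem fischer_normSqPoly_mul {d : ℕ} (P Q : MvPolynomial (Fin d) ℂ) :
    fischer (normSqPoly d * P) Q = fischer P (lapPoly Q) := by
  have : normSqPoly d * P = ∑ i, P * MvPolynomial.X i * MvPolynomial.X i := by
    rw [normSqPoly, Finset.sum_mul]
    exact Finset.sum_congr rfl fun i _ => by ring
  rw [this, fischer_sum_left, lapPoly, fischer_sum_right]
  refine Finset.sum_congr rfl fun i _ => ?_
  rw [fischer_mul_X, fischer_mul_X]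

theorem isHomogeneous_normSqPoly (d : ℕ) : (normSqPoly d).IsHomogeneous 2 :=
  MvPolynomial.IsHomogeneous.sum _ _ _ fun i _ =>
    (MvPolynomial.isHomogeneous_X ℂ i).mul (MvPolynomial.isHomogeneous_X ℂ i)

theorem normSqPoly_ne_zero {d : ℕ} (hd : 0 < d) : normSqPoly d ≠ 0 := by
  intro h
  have := congrArg (MvPolynomial.eval (fun _ => (1 : ℂ))) h
  simp [normSqPoly, hd.ne'] at this

theorem isHomogeneous_lapPoly {d j : ℕ} {P : MvPolynomial (Fin d) ℂ}
    (hP : P.IsHomogeneous (j + 2)) : (lapPoly P).IsHomogeneous j :=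
  MvPolynomial.IsHomogeneous.sum _ _ _ fun i _ => by
    simpa using (hP.pderiv (i := i)).pderiv (i := i)

theorem lapPoly_add {d : ℕ} (P Q : MvPolynomial (Fin d) ℂ) :
    lapPoly (P + Q) = lapPoly P + lapPoly Q := by
  simp [lapPoly, Finset.sum_add_distrib]

theorem lapPoly_sub {d : ℕ} (P Q : MvPolynomial (Fin d) ℂ) :
    lapPoly (P - Q) = lapPoly P - lapPoly Q := by
  simp [lapPoly, Finset.sum_sub_distrib]

theorem lapPoly_smul {d : ℕ} (c : ℂ) (P : MvPolynomial (Fin d) ℂ) :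
    lapPoly (c • P) = c • lapPoly P := by
  simp [lapPoly, Finset.smul_sum]

theorem lapPoly_eq_zero_of_lt {d j : ℕ} {P : MvPolynomial (Fin d) ℂ}
    (hP : P.IsHomogeneous j) (hj : j < 2) : lapPoly P = 0 := by
  refine Finset.sum_eq_zero fun i _ => ?_
  have h : (MvPolynomial.pderiv i P).totalDegree = 0 := by
    have := (hP.pderiv (i := i)).totalDegree_le
    omega
  rw [MvPolynomial.totalDegree_eq_zero_iff_eq_C.mp h, MvPolynomial.pderiv_C]

/-- `Δ (|x|² ·)` is injective on homogeneous polynomials of a given degree because it is positive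
definite for the Fischer inner product; hence it is onto, and every homogeneous polynomial is
harmonic up to a multiple of `|x|²`. -/
theorem exists_harmonic_add_normSq_mul {d j : ℕ} (hd : 0 < d) {P : MvPolynomial (Fin d) ℂ}
    (hP : P.IsHomogeneous (j + 2)) :
    ∃ Q : MvPolynomial (Fin d) ℂ, Q.IsHomogeneous j ∧ lapPoly (P - normSqPoly d * Q) = 0 := by
  let S := MvPolynomial.homogeneousSubmodule (Fin d) ℂ j
  have : Module.Finite ℂ S :=
    Module.Finite.iff_fg.mpr (MvPolynomial.homogeneousSubmodule_fg (Fin d) ℂ j)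
  let T : S →ₗ[ℂ] S :=
    { toFun := fun Q => ⟨lapPoly (normSqPoly d * Q.1), by
        refine isHomogeneous_lapPoly ?_
        rw [add_comm]
        exact (isHomogeneous_normSqPoly d).mul Q.2⟩
      map_add' := fun Q Q' => Subtype.ext <| by
        simp [mul_add, lapPoly_add]
      map_smul' := fun c Q => Subtype.ext <| by
        simp [lapPoly_smul] }
  have hinj : Function.Injective T := by
    rw [← LinearMap.ker_eq_bot, LinearMap.ker_eq_bot']
    intro Q hQ
    have h0 : lapPoly (normSqPoly d * Q.1) = 0 := congrArg Subtype.val hQ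
    have h1 : fischer (normSqPoly d * Q.1) (normSqPoly d * Q.1) = 0 := by
      rw [fischer_normSqPoly_mul, h0]
      simp [fischer]
    have h2 := eq_zero_of_fischer_self _ h1
    rcases mul_eq_zero.mp h2 with h3 | h3
    · exact absurd h3 (normSqPoly_ne_zero hd)
    · exact Subtype.ext h3
  obtain ⟨Q, hQ⟩ := (LinearMap.injective_iff_surjective.mp hinj)
    ⟨lapPoly P, isHomogeneous_lapPoly hP⟩
  refine ⟨Q.1, Q.2, ?_⟩
  rw [lapPoly_sub, sub_eq_zero]
  exact (congrArg Subtype.val hQ).symm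

section PolyFun

variable {V : Type*} [NormedAddCommGroup V] [InnerProductSpace ℝ V] {d : ℕ}

/-- The function on `V` given by a polynomial in the coordinates of an orthonormal basis. -/
def polyFun (b : OrthonormalBasis (Fin d) ℝ V) (P : MvPolynomial (Fin d) ℂ) (x : V) : ℂ :=
  MvPolynomial.eval (fun i => ((⟪b i, x⟫_ℝ : ℝ) : ℂ)) P

variable (b : OrthonormalBasis (Fin d) ℝ V)

@[simp] theorem polyFun_add (P Q : MvPolynomial (Fin d) ℂ) (x : V) :
    polyFun b (P + Q) x = polyFun b P x + polyFun b Q x := by simp [polyFun]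

@[simp] theorem polyFun_sub (P Q : MvPolynomial (Fin d) ℂ) (x : V) :
    polyFun b (P - Q) x = polyFun b P x - polyFun b Q x := by simp [polyFun]

@[simp] theorem polyFun_mul (P Q : MvPolynomial (Fin d) ℂ) (x : V) :
    polyFun b (P * Q) x = polyFun b P x * polyFun b Q x := by simp [polyFun]

@[simp] theorem polyFun_sum {ι : Type*} (s : Finset ι) (P : ι → MvPolynomial (Fin d) ℂ) (x : V) :
    polyFun b (∑ i ∈ s, P i) x = ∑ i ∈ s, polyFun b (P i) x := by simp [polyFun]

@[simp] theorem polyFun_C (c : ℂ) (x : V) : polyFun b (MvPolynomial.C c) x = c := by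
  simp [polyFun]

@[simp] theorem polyFun_X (i : Fin d) (x : V) :
    polyFun b (MvPolynomial.X i) x = ((⟪b i, x⟫_ℝ : ℝ) : ℂ) := by simp [polyFun]

theorem polyFun_normSqPoly (x : V) : polyFun b (normSqPoly d) x = ((‖x‖ ^ 2 : ℝ) : ℂ) := by
  rw [← OrthonormalBasis.sum_sq_norm_inner_right b x]
  simp [normSqPoly, sq]

theorem polyFun_smul {k : ℕ} {P : MvPolynomial (Fin d) ℂ} (hP : P.IsHomogeneous k) (c : ℝ)
    (x : V) : polyFun b P (c • x) = (c : ℂ) ^ k * polyFun b P x := by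
  unfold polyFun
  have h2 : (fun i => ((⟪b i, c • x⟫_ℝ : ℝ) : ℂ)) = (c : ℂ) • fun i => ((⟪b i, x⟫_ℝ : ℝ) : ℂ) := by
    ext i
    simp [inner_smul_right]
  rw [h2, MvPolynomial.eval_eq, MvPolynomial.eval_eq, Finset.mul_sum]
  refine Finset.sum_congr rfl fun m hm => ?_
  have hk : ∑ i ∈ m.support, m i = k := by
    have := hP (MvPolynomial.mem_support_iff.mp hm)
    rw [← this, Finsupp.weight_apply]
    simp [Finsupp.sum]
  simp only [Pi.smul_apply, smul_eq_mul, mul_pow, Finset.prod_mul_distrib]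
  rw [Finset.prod_pow_eq_pow_sum, hk]
  ring

theorem hasFDerivAt_polyFun (P : MvPolynomial (Fin d) ℂ) (x : V) :
    HasFDerivAt (polyFun b P) (∑ i, polyFun b (MvPolynomial.pderiv i P) x •
      (Complex.ofRealCLM ∘L innerSL ℝ (b i))) x := by
  induction P using MvPolynomial.induction_on with
  | C c =>
    have : polyFun b (MvPolynomial.C c) = fun _ => c := by ext y; simp
    rw [this]
    convert hasFDerivAt_const c x using 1
    ext v
    simp [polyFun]
  | add P Q hP hQ =>
    have : polyFun b (P + Q) = fun y => polyFun b P y + polyFun b Q y := by ext y; simp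
    rw [this]
    convert! hP.add hQ using 1
    ext v
    simp [add_mul, Finset.sum_add_distrib]
  | mul_X P j hP =>
    have : polyFun b (P * MvPolynomial.X j)
        = fun y => polyFun b P y * ((⟪b j, y⟫_ℝ : ℝ) : ℂ) := by ext y; simp
    rw [this]
    have h2 : HasFDerivAt (fun y : V => ((⟪b j, y⟫_ℝ : ℝ) : ℂ))
        (Complex.ofRealCLM ∘L innerSL ℝ (b j)) x :=
      (Complex.ofRealCLM ∘L innerSL ℝ (b j)).hasFDerivAt
    convert! hP.mul h2 using 1
    ext v
    simp only [_root_.sum_apply, _root_.add_apply,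
      _root_.smul_apply, smul_eq_mul, Derivation.leibniz, polyFun_add, polyFun_mul,
      polyFun_X, add_mul, Finset.sum_add_distrib, Finset.mul_sum, MvPolynomial.pderiv_X]
    congr 1
    · rw [Finset.sum_eq_single j]
      · simp [polyFun]
      · intro i _ hij
        simp [hij.symm, polyFun]
      · simp
    · exact Finset.sum_congr rfl fun i _ => by ring

theorem fderiv_polyFun_apply (P : MvPolynomial (Fin d) ℂ) (x : V) (i : Fin d) :
    fderiv ℝ (polyFun b P) x (b i) = polyFun b (MvPolynomial.pderiv i P) x := by
  rw [(hasFDerivAt_polyFun b P x).fderiv, _root_.sum_apply, Finset.sum_eq_single i]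
  · simp
  · intro j _ hj
    simp [orthonormal_iff_ite.mp b.orthonormal, hj]
  · simp

theorem contDiff_polyFun (P : MvPolynomial (Fin d) ℂ) : ContDiff ℝ ∞ (polyFun b P) := by
  induction P using MvPolynomial.induction_on with
  | C c =>
    have : polyFun b (MvPolynomial.C c) = fun _ => c := by ext y; simp
    rw [this]
    exact contDiff_const
  | add P Q hP hQ =>
    have : polyFun b (P + Q) = fun y => polyFun b P y + polyFun b Q y := by ext y; simp
    rw [this]
    exact hP.add hQ
  | mul_X P j hP =>
    have : polyFun b (P * MvPolynomial.X j)
        = fun y => polyFun b P y * ((⟪b j, y⟫_ℝ : ℝ) : ℂ) := by ext y; simp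
    rw [this]
    exact hP.mul (Complex.ofRealCLM ∘L innerSL ℝ (b j)).contDiff

theorem laplacian_polyFun [FiniteDimensional ℝ V] (P : MvPolynomial (Fin d) ℂ) (x : V) :
    Δ (polyFun b P) x = polyFun b (lapPoly P) x := by
  rw [InnerProductSpace.laplacian_eq_iteratedFDeriv_orthonormalBasis _ b]
  simp only [lapPoly, polyFun_sum]
  refine Finset.sum_congr rfl fun j _ => ?_
  rw [iteratedFDeriv_two_apply]
  simp only [Matrix.cons_val_zero, Matrix.cons_val_one]
  have h1 : fderiv ℝ (polyFun b P) = fun y => ∑ i, polyFun b (MvPolynomial.pderiv i P) y •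
      (Complex.ofRealCLM ∘L innerSL ℝ (b i)) :=
    funext fun y => (hasFDerivAt_polyFun b P y).fderiv
  have h2 : DifferentiableAt ℝ (fderiv ℝ (polyFun b P)) x :=
    (((contDiff_polyFun b P).fderiv_right (m := 1) (by norm_cast)).differentiable one_ne_zero) x
  rw [← fderiv_polyFun_apply b (MvPolynomial.pderiv j P) x j]
  have h3 : (fun y => fderiv ℝ (polyFun b P) y (b j)) = polyFun b (MvPolynomial.pderiv j P) :=
    funext fun y => fderiv_polyFun_apply b P y j
  rw [← h3, fderiv_clm_apply h2 (differentiableAt_const _)]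
  simp

/-- A homogeneous polynomial of degree `k` is the restriction of a `k`-linear form to the diagonal,
which is the form in which `IsHarmonicPoly` asks for it. -/
theorem exists_multilinear_polyFun {k : ℕ} {P : MvPolynomial (Fin d) ℂ} (hP : P.IsHomogeneous k) :
    ∃ M : V [×k]→L[ℝ] ℂ, ∀ x, polyFun b P x = M (fun _ => x) := by
  induction k generalizing P with
  | zero =>
    refine ⟨ContinuousMultilinearMap.constOfIsEmpty ℝ _ (polyFun b P 0), fun x => ?_⟩
    have : P = MvPolynomial.C (P.coeff 0) :=
      MvPolynomial.totalDegree_eq_zero_iff_eq_C.mp (Nat.le_zero.mp hP.totalDegree_le)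
    rw [this]
    simp
  | succ k ih =>
    -- Euler's identity writes `P` as a combination of products `xᵢ ∂ᵢP`
    choose M hM using fun i => ih (by simpa using hP.pderiv (i := i))
    refine ⟨((k + 1 : ℂ)⁻¹) • ∑ i, ((innerSL ℝ (b i)).smulRight (M i)).uncurryLeft, fun x => ?_⟩
    have h1 := congrArg (fun Q => polyFun b Q x) hP.sum_X_mul_pderiv
    have h2 : polyFun b ((k + 1) • P) x = (k + 1 : ℂ) * polyFun b P x := by
      simp [polyFun]
    have h3 : (k + 1 : ℂ) ≠ 0 := by exact_mod_cast k.succ_ne_zero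
    rw [h2] at h1
    rw [show polyFun b P x = (k + 1 : ℂ)⁻¹ * ((k + 1 : ℂ) * polyFun b P x) by field_simp, ← h1]
    simp [hM, Fin.tail_def]

theorem isHarmonicPoly_polyFun [FiniteDimensional ℝ V] {k : ℕ} {P : MvPolynomial (Fin d) ℂ}
    (hP : P.IsHomogeneous k) (hl : lapPoly P = 0) : IsHarmonicPoly k (polyFun b P) :=
  ⟨exists_multilinear_polyFun b hP, fun x => by rw [laplacian_polyFun, hl]; simp [polyFun]⟩

theorem eq_zero_of_polyFun_eq_zero {P : MvPolynomial (Fin d) ℂ} (h : ∀ x, polyFun b P x = 0) :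
    P = 0 := by
  refine MvPolynomial.funext_set (fun _ => Set.range ((↑) : ℝ → ℂ))
    (fun _ => Set.infinite_range_of_injective Complex.ofReal_injective) fun x hx => ?_
  choose y hy using fun i => hx i (Set.mem_univ i)
  have := h (∑ i, y i • b i)
  rw [map_zero, ← this]
  unfold polyFun
  congr 2
  funext i
  simp [← hy i, inner_sum, inner_smul_right, orthonormal_iff_ite.mp b.orthonormal]

/-- Conversely to `isHarmonicPoly_polyFun`, every harmonic polynomial function comes from a
polynomial in the coordinates, obtained by expanding the multilinear form in the basis. -/
theorem IsHarmonicPoly.exists_polyFun [FiniteDimensional ℝ V] {k : ℕ} {h : V → ℂ}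
    (hh : IsHarmonicPoly k h) :
    ∃ P : MvPolynomial (Fin d) ℂ, P.IsHomogeneous k ∧ lapPoly P = 0 ∧ h = polyFun b P := by
  obtain ⟨⟨M, hM⟩, hl⟩ := hh
  let P : MvPolynomial (Fin d) ℂ := ∑ s : Fin k → Fin d,
    MvPolynomial.C (M fun j => b (s j)) * ∏ j, MvPolynomial.X (s j)
  have hP : P.IsHomogeneous k := MvPolynomial.IsHomogeneous.sum _ _ _ fun s _ => by
    simpa using (MvPolynomial.isHomogeneous_C (Fin d) (M fun j => b (s j))).mul
      (MvPolynomial.IsHomogeneous.prod Finset.univ (fun j => MvPolynomial.X (R := ℂ) (s j))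
        (fun _ => 1) fun j _ => MvPolynomial.isHomogeneous_X ℂ (s j))
  have hhP : h = polyFun b P := by
    ext x
    have hx : (fun _ : Fin k => x) = fun _ => ∑ i, ⟪b i, x⟫_ℝ • b i := by
      ext1 j
      exact (b.sum_repr' x).symm
    have := M.toMultilinearMap.map_sum (fun _ i => ⟪b i, x⟫_ℝ • b i)
    rw [hM, hx]
    refine this.trans ?_
    simp only [P, polyFun_sum, polyFun_mul, polyFun_C]
    refine Finset.sum_congr rfl fun s _ => ?_
    have h1 := M.toMultilinearMap.map_smul_univ (fun j => ⟪b (s j), x⟫_ℝ) (fun j => b (s j))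
    refine h1.trans ?_
    simp [polyFun, mul_comm]
  refine ⟨P, hP, eq_zero_of_polyFun_eq_zero b fun x => ?_, hhP⟩
  rw [← laplacian_polyFun, ← hhP, hl]

theorem polyFun_nsmul (k : ℕ) (P : MvPolynomial (Fin d) ℂ) (x : V) :
    polyFun b (k • P) x = k * polyFun b P x := by
  simp [polyFun]

theorem polyFun_one (x : V) : polyFun b 1 x = 1 := by simp [polyFun]

theorem continuous_polyFun (P : MvPolynomial (Fin d) ℂ) : Continuous (polyFun b P) :=
  (contDiff_polyFun b P).continuous

/-- The restrictions to the unit sphere of homogeneous harmonic polynomials are total: by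
`exists_harmonic_add_normSq_mul` they span all polynomials on the sphere, and those are dense by
the Stone–Weierstrass theorem. -/
theorem eq_zero_of_forall_harmonic_integral_eq_zero [FiniteDimensional ℝ V] [MeasurableSpace V]
    [BorelSpace V] (b : OrthonormalBasis (Fin d) ℝ V) (hd : 0 < d)
    (a : Metric.sphere (0 : V) 1 → ℂ) (ha : Continuous a)
    (h : ∀ (k : ℕ) (P : MvPolynomial (Fin d) ℂ), P.IsHomogeneous k → lapPoly P = 0 →
      ∫ w, a w * polyFun b P w ∂(volume : Measure V).toSphere = 0) (w : Metric.sphere (0 : V) 1) :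
    a w = 0 := by
  set μ := (volume : Measure V).toSphere
  have hint : ∀ g : Metric.sphere (0 : V) 1 → ℂ, Continuous g → Integrable g μ := fun g hg =>
    hg.integrable_of_hasCompactSupport (HasCompactSupport.of_compactSpace g)
  have hpc : ∀ P, Continuous fun w : Metric.sphere (0 : V) 1 => polyFun b P w := fun P =>
    (continuous_polyFun b P).comp continuous_subtype_val
  have hap : ∀ P, Integrable (fun w : Metric.sphere (0 : V) 1 => a w * polyFun b P w) μ :=
    fun P => hint _ (ha.mul (hpc P))
  -- on the sphere `P = (P - |x|² Q) + Q`, with a harmonic first term and `Q` of lower degree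
  have hhom : ∀ (k : ℕ) (P : MvPolynomial (Fin d) ℂ), P.IsHomogeneous k →
      ∫ w, a w * polyFun b P w ∂μ = 0 := by
    intro k
    induction k using Nat.strong_induction_on with
    | _ k ih =>
      intro P hP
      rcases lt_or_ge k 2 with hk | hk
      · exact h k P hP (lapPoly_eq_zero_of_lt hP hk)
      · obtain ⟨j, rfl⟩ := Nat.exists_eq_add_of_le' hk
        obtain ⟨Q, hQ, hPQ⟩ := exists_harmonic_add_normSq_mul hd hP
        have h1 := h (j + 2) (P - normSqPoly d * Q) (by
          refine hP.sub ?_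
          rw [add_comm]
          exact (isHomogeneous_normSqPoly d).mul hQ) hPQ
        have h2 := ih j (by omega) Q hQ
        have h3 : (fun w : Metric.sphere (0 : V) 1 => a w * polyFun b P w)
            = fun w => a w * polyFun b (P - normSqPoly d * Q) w + a w * polyFun b Q w := by
          ext w
          have : ‖(w : V)‖ = 1 := mem_sphere_zero_iff_norm.mp w.2
          simp only [polyFun_sub, polyFun_mul, polyFun_normSqPoly, this]
          push_cast
          ring
        rw [h3, integral_add (hap _) (hap _), h1, h2, add_zero]
  have hall : ∀ P : MvPolynomial (Fin d) ℂ, ∫ w, a w * polyFun b P w ∂μ = 0 := by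
    intro P
    rw [← MvPolynomial.sum_homogeneousComponent P]
    simp only [polyFun_sum, Finset.mul_sum]
    rw [integral_finsetSum _ fun i _ => hap _]
    exact Finset.sum_eq_zero fun i _ =>
      hhom i _ (MvPolynomial.homogeneousComponent_isHomogeneous i P)
  let co : Fin d → C(Metric.sphere (0 : V) 1, ℝ) := fun i =>
    ⟨fun w => ⟪b i, (w : V)⟫_ℝ, by fun_prop⟩
  -- real polynomials are dense in the real continuous functions on the sphere
  let A : Subalgebra ℝ C(Metric.sphere (0 : V) 1, ℝ) := Algebra.adjoin ℝ (Set.range co)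
  have hA : ∀ u ∈ A, ∃ P, ∀ w, ((u w : ℝ) : ℂ) = polyFun b P w := by
    intro u hu
    induction hu using Algebra.adjoin_induction with
    | mem u hu =>
      obtain ⟨i, rfl⟩ := hu
      exact ⟨MvPolynomial.X i, fun w => by simp [co]⟩
    | algebraMap r => exact ⟨MvPolynomial.C r, fun w => by simp⟩
    | add u v _ _ hu hv =>
      obtain ⟨P, hP⟩ := hu
      obtain ⟨Q, hQ⟩ := hv
      exact ⟨P + Q, fun w => by simp [hP, hQ]⟩
    | mul u v _ _ hu hv =>
      obtain ⟨P, hP⟩ := hu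
      obtain ⟨Q, hQ⟩ := hv
      exact ⟨P * Q, fun w => by simp [hP, hQ]⟩
  have hsep : A.SeparatesPoints := by
    intro x y hxy
    by_contra! hcon
    refine hxy (Subtype.ext (b.repr.injective ?_))
    ext i
    have := hcon _ ⟨co i, Algebra.subset_adjoin ⟨i, rfl⟩, rfl⟩
    simpa [co, OrthonormalBasis.repr_apply_apply] using this
  have htop := ContinuousMap.subalgebra_topologicalClosure_eq_top_of_separatesPoints A hsep
  have hclosed : IsClosed {u : C(Metric.sphere (0 : V) 1, ℝ) | ∫ w, a w * (u w : ℂ) ∂μ = 0} := by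
    have hc : Continuous fun u : C(Metric.sphere (0 : V) 1, ℝ) => ∫ w, a w * (u w : ℂ) ∂μ := by
      refine (LipschitzWith.of_dist_le_mul (K := ⟨∫ w, ‖a w‖ ∂μ, by positivity⟩)
        fun u v => ?_).continuous
      have hi : ∀ u : C(Metric.sphere (0 : V) 1, ℝ), Integrable (fun w => a w * (u w : ℂ)) μ :=
        fun u => hint _ (by fun_prop)
      rw [dist_eq_norm, ← integral_sub (hi u) (hi v)]
      refine (norm_integral_le_of_norm_le (((hint a ha).norm).mul_const (dist u v))
        (Filter.Eventually.of_forall fun w => ?_)).trans_eq ?_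
      · rw [← mul_sub, norm_mul, ← Complex.ofReal_sub, Complex.norm_real]
        gcongr
        exact (Real.dist_eq _ _).symm.trans_le (ContinuousMap.dist_apply_le_dist w)
      · rw [integral_mul_const]
        rfl
    exact isClosed_singleton.preimage hc
  have hreal : ∀ u : C(Metric.sphere (0 : V) 1, ℝ), ∫ w, a w * (u w : ℂ) ∂μ = 0 := by
    intro u
    have hu : u ∈ A.topologicalClosure := by rw [htop]; trivial
    refine closure_minimal (fun v hv => ?_) hclosed hu
    obtain ⟨P, hP⟩ := hA v hv
    simp only [Set.mem_ofPred_eq, hP]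
    exact hall P
  -- testing with the real and imaginary parts of `a` gives `∫ a conj(a) = 0`
  have h1 := hreal ⟨fun w => (a w).re, by fun_prop⟩
  have h2 := hreal ⟨fun w => (a w).im, by fun_prop⟩
  have h3 : ∫ w, ((‖a w‖ ^ 2 : ℝ) : ℂ) ∂μ = 0 := by
    have : (fun w => ((‖a w‖ ^ 2 : ℝ) : ℂ))
        = fun w => a w * ((a w).re : ℂ) - Complex.I * (a w * ((a w).im : ℂ)) := by
      ext w
      have hc : (starRingEnd ℂ) (a w) = ((a w).re : ℂ) - Complex.I * ((a w).im : ℂ) := by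
        apply Complex.ext <;> simp
      rw [← Complex.normSq_eq_norm_sq, ← Complex.mul_conj, hc]
      ring
    rw [this, integral_sub (hint _ (by fun_prop)) (hint _ (by fun_prop)),
      integral_const_mul]
    simp only [ContinuousMap.coe_mk] at h1 h2
    rw [h1, h2]
    simp
  rw [integral_complex_ofReal, Complex.ofReal_eq_zero] at h3
  have hc : Continuous fun w => ‖a w‖ ^ 2 := by fun_prop
  by_contra hw
  exact absurd h3 (hc.integral_pos_of_hasCompactSupport_nonneg_nonzero (μ := μ)
    (HasCompactSupport.of_compactSpace _) (fun w => by positivity)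
    (f_x := (by positivity : ‖a w‖ ^ 2 ≠ 0))).ne'

end PolyFun

/-! ### Polar coordinates and Gaussian integrals of harmonic polynomials -/

section Polar

variable {V : Type*} [NormedAddCommGroup V] [InnerProductSpace ℝ V] [FiniteDimensional ℝ V]
  [MeasurableSpace V] [BorelSpace V]

theorem integral_volumeIoiPow (n : ℕ) (g : ℝ → ℂ) :
    ∫ r : Set.Ioi (0 : ℝ), g r ∂(Measure.volumeIoiPow n)
      = ∫ r in Set.Ioi (0 : ℝ), (r : ℂ) ^ n * g r := by
  simp only [Measure.volumeIoiPow, ENNReal.ofReal]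
  rw [integral_withDensity_eq_integral_smul (by fun_prop),
    ← integral_subtype_comap measurableSet_Ioi fun r : ℝ => (r : ℂ) ^ n * g r]
  refine integral_congr_ae (Filter.Eventually.of_forall fun r => ?_)
  have hr : 0 < (r : ℝ) := r.2
  simp [NNReal.smul_def, Real.coe_toNNReal _ (pow_nonneg hr.le n)]

theorem integrable_volumeIoiPow_iff (n : ℕ) (g : ℝ → ℂ) :
    Integrable (fun r : Set.Ioi (0 : ℝ) => g r) (Measure.volumeIoiPow n)
      ↔ IntegrableOn (fun r : ℝ => (r : ℂ) ^ n * g r) (Set.Ioi 0) := by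
  simp only [Measure.volumeIoiPow, ENNReal.ofReal]
  rw [integrable_withDensity_iff_integrable_smul (by fun_prop),
    integrableOn_iff_comap_subtypeVal measurableSet_Ioi]
  refine integrable_congr (Filter.Eventually.of_forall fun r => ?_)
  have hr : 0 < (r : ℝ) := r.2
  simp [NNReal.smul_def, Real.coe_toNNReal _ (pow_nonneg hr.le n)]

theorem integrable_comp_polar {g : V → ℂ} (hg : Integrable g) :
    Integrable (fun q : Metric.sphere (0 : V) 1 × Set.Ioi (0 : ℝ) => g ((q.2 : ℝ) • (q.1 : V)))
      ((volume : Measure V).toSphere.prod (Measure.volumeIoiPow (Module.finrank ℝ V - 1))) := by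
  have h1 : Integrable (fun x : ({0}ᶜ : Set V) => g x) (Measure.comap Subtype.val volume) := by
    have := hg.integrableOn (s := ({0}ᶜ : Set V))
    rwa [integrableOn_iff_comap_subtypeVal (measurableSet_singleton _).compl] at this
  rw [← (volume : Measure V).measurePreserving_homeomorphUnitSphereProd.integrable_comp_emb
    (Homeomorph.measurableEmbedding _)]
  convert h1 using 2 with x
  have hx : ‖(x : V)‖ ≠ 0 := norm_ne_zero_iff.mpr x.2
  simp [smul_inv_smul₀ hx]

theorem integral_polar [Nontrivial V] {g : V → ℂ} (hg : Integrable g) :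
    ∫ x, g x = ∫ r in Set.Ioi (0 : ℝ), (r : ℂ) ^ (Module.finrank ℝ V - 1) *
      ∫ w : Metric.sphere (0 : V) 1, g (r • (w : V)) ∂(volume : Measure V).toSphere := by
  rw [← integral_volumeIoiPow (Module.finrank ℝ V - 1)
      (fun r => ∫ w : Metric.sphere (0 : V) 1, g (r • (w : V)) ∂(volume : Measure V).toSphere),
    ← integral_prod_symm _ (integrable_comp_polar hg),
    ← (volume : Measure V).measurePreserving_homeomorphUnitSphereProd.integral_comp
    (Homeomorph.measurableEmbedding _)]
  calc ∫ x, g x = ∫ x : ({0}ᶜ : Set V), g x ∂(Measure.comap Subtype.val volume) := by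
        rw [integral_subtype_comap (measurableSet_singleton _).compl fun x => g x,
          restrict_compl_singleton]
    _ = _ := by
        refine integral_congr_ae (Filter.Eventually.of_forall fun x => ?_)
        have hx : ‖(x : V)‖ ≠ 0 := norm_ne_zero_iff.mpr x.2
        simp [smul_inv_smul₀ hx]

theorem integrableOn_polar [Nontrivial V] {g : V → ℂ} (hg : Integrable g) :
    IntegrableOn (fun r : ℝ => (r : ℂ) ^ (Module.finrank ℝ V - 1) *
      ∫ w : Metric.sphere (0 : V) 1, g (r • (w : V)) ∂(volume : Measure V).toSphere)
      (Set.Ioi 0) := by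
  rw [← integrable_volumeIoiPow_iff (Module.finrank ℝ V - 1)
      (fun r => ∫ w : Metric.sphere (0 : V) 1, g (r • (w : V)) ∂(volume : Measure V).toSphere)]
  exact (integrable_comp_polar hg).integral_prod_right

end Polar

theorem one_add_pow_mul_exp_neg_sq_le {t : ℝ} (ht : 0 < t) (K : ℕ) {r : ℝ} (hr : 0 ≤ r) :
    (1 + r) ^ K * Real.exp (-t * r ^ 2) ≤ K.factorial * Real.exp (1 + 1 / (4 * t)) := by
  have h1 : (1 + r) ^ K ≤ K.factorial * Real.exp (1 + r) := by
    have := Real.pow_div_factorial_le_exp (1 + r) (by positivity) K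
    rwa [div_le_iff₀' (by positivity)] at this
  have h2 : 1 + r + -t * r ^ 2 ≤ 1 + 1 / (4 * t) := by
    have : 0 ≤ t * (r - 1 / (2 * t)) ^ 2 := by positivity
    have h3 : t * (r - 1 / (2 * t)) ^ 2 = t * r ^ 2 - r + 1 / (4 * t) := by
      field_simp
      ring
    linarith
  calc (1 + r) ^ K * Real.exp (-t * r ^ 2)
      ≤ K.factorial * Real.exp (1 + r) * Real.exp (-t * r ^ 2) := by gcongr
    _ = K.factorial * Real.exp (1 + r + -t * r ^ 2) := by rw [mul_assoc, ← Real.exp_add]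
    _ ≤ _ := by gcongr

section Gauss

variable {V : Type*} [NormedAddCommGroup V] [InnerProductSpace ℝ V] {d : ℕ}
  (b : OrthonormalBasis (Fin d) ℝ V)

theorem exists_norm_polyFun_le (P : MvPolynomial (Fin d) ℂ) :
    ∃ (C : ℝ) (K : ℕ), 0 ≤ C ∧ ∀ x, ‖polyFun b P x‖ ≤ C * (1 + ‖x‖) ^ K := by
  induction P using MvPolynomial.induction_on with
  | C c => exact ⟨‖c‖, 0, by positivity, fun x => by simp⟩
  | add P Q hP hQ =>
    obtain ⟨C, K, hC, h⟩ := hP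
    obtain ⟨C', K', hC', h'⟩ := hQ
    refine ⟨C + C', K + K', by positivity, fun x => ?_⟩
    have h1 : (1 : ℝ) ≤ 1 + ‖x‖ := by simp
    rw [polyFun_add, add_mul]
    refine (norm_add_le _ _).trans (add_le_add ((h x).trans ?_) ((h' x).trans ?_))
    · gcongr
      omega
    · gcongr
      omega
  | mul_X P j hP =>
    obtain ⟨C, K, hC, h⟩ := hP
    refine ⟨C, K + 1, hC, fun x => ?_⟩
    rw [polyFun_mul, norm_mul, polyFun_X, pow_succ, ← mul_assoc, Complex.norm_real]
    refine mul_le_mul (h x) ?_ (norm_nonneg _) (by positivity)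
    have := norm_inner_le_norm (𝕜 := ℝ) (b j) x
    rw [b.norm_eq_one, one_mul] at this
    linarith

/-- The Gaussian wave `exp (-c |x|² + i ⟨y, x⟩)`. -/
def gaussWave (c : ℂ) (y x : V) : ℂ :=
  Complex.exp (-c * (‖x‖ : ℂ) ^ 2 + Complex.I * ((⟪y, x⟫_ℝ : ℝ) : ℂ))

theorem norm_gaussWave (c : ℂ) (y x : V) :
    ‖gaussWave c y x‖ = Real.exp (-c.re * ‖x‖ ^ 2) := by
  rw [gaussWave, Complex.norm_exp]
  congr 1
  simp [← Complex.ofReal_pow]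

theorem continuous_gaussWave (c : ℂ) (y : V) : Continuous (gaussWave c y) := by
  unfold gaussWave
  fun_prop

theorem hasFDerivAt_gaussWave (c : ℂ) (y x : V) :
    HasFDerivAt (gaussWave c y) (gaussWave c y x •
      ((-(2 * c)) • (Complex.ofRealCLM ∘L innerSL ℝ x) +
        Complex.I • (Complex.ofRealCLM ∘L innerSL ℝ y))) x := by
  have h1 : HasFDerivAt (fun x : V => -c * (‖x‖ : ℂ) ^ 2 + Complex.I * ((⟪y, x⟫_ℝ : ℝ) : ℂ))
      ((-(2 * c)) • (Complex.ofRealCLM ∘L innerSL ℝ x) +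
        Complex.I • (Complex.ofRealCLM ∘L innerSL ℝ y)) x := by
    have h2 : HasFDerivAt (fun x : V => ((‖x‖ ^ 2 : ℝ) : ℂ))
        (Complex.ofRealCLM ∘L (2 • innerSL ℝ x)) x :=
      Complex.ofRealCLM.hasFDerivAt.comp x (hasStrictFDerivAt_norm_sq x).hasFDerivAt
    have h3 : HasFDerivAt (fun x : V => ((⟪y, x⟫_ℝ : ℝ) : ℂ))
        (Complex.ofRealCLM ∘L innerSL ℝ y) x := (Complex.ofRealCLM ∘L innerSL ℝ y).hasFDerivAt
    convert! (h2.const_mul (-c)).add (h3.const_mul Complex.I) using 1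
    · ext v
      simp
    · ext v
      simp
      ring
  exact h1.cexp

variable [FiniteDimensional ℝ V] [MeasurableSpace V] [BorelSpace V]

theorem integrable_polyFun_mul_gaussWave {c : ℂ} (hc : 0 < c.re) (y : V)
    (P : MvPolynomial (Fin d) ℂ) : Integrable fun x => polyFun b P x * gaussWave c y x := by
  obtain ⟨C, K, hC, hP⟩ := exists_norm_polyFun_le b P
  set n := Module.finrank ℝ V + 1
  have h1 : Integrable fun x : V => (1 + ‖x‖) ^ (-(n : ℝ)) :=
    integrable_one_add_norm (by simp [n])
  refine (h1.const_mul (C * ((K + n).factorial * Real.exp (1 + 1 / (4 * c.re))))).mono'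
    (((continuous_polyFun b P).mul (continuous_gaussWave c y)).aestronglyMeasurable)
    (Filter.Eventually.of_forall fun x => ?_)
  rw [norm_mul, norm_gaussWave, Real.rpow_neg (by positivity), Real.rpow_natCast, ← div_eq_mul_inv,
    le_div_iff₀ (by positivity)]
  have h2 := one_add_pow_mul_exp_neg_sq_le hc (K + n) (norm_nonneg x)
  calc ‖polyFun b P x‖ * Real.exp (-c.re * ‖x‖ ^ 2) * (1 + ‖x‖) ^ n
      ≤ C * (1 + ‖x‖) ^ K * Real.exp (-c.re * ‖x‖ ^ 2) * (1 + ‖x‖) ^ n := by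
        gcongr
        exact hP x
    _ = C * ((1 + ‖x‖) ^ (K + n) * Real.exp (-c.re * ‖x‖ ^ 2)) := by ring
    _ ≤ _ := by gcongr

/-- Integration by parts against a Gaussian. -/
theorem integral_X_mul_gaussWave {c : ℂ} (hc : 0 < c.re) (y : V) (i : Fin d)
    (P : MvPolynomial (Fin d) ℂ) :
    2 * c * ∫ x, polyFun b (MvPolynomial.X i * P) x * gaussWave c y x
      = (∫ x, polyFun b (MvPolynomial.pderiv i P) x * gaussWave c y x)
        + Complex.I * ((⟪y, b i⟫_ℝ : ℝ) : ℂ) * ∫ x, polyFun b P x * gaussWave c y x := by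
  have hI := integrable_polyFun_mul_gaussWave b hc y
  have hg : ∀ x, fderiv ℝ (gaussWave c y) x (b i)
      = -(2 * c) * (polyFun b (MvPolynomial.X i) x * gaussWave c y x)
        + Complex.I * ((⟪y, b i⟫_ℝ : ℝ) : ℂ) * gaussWave c y x := by
    intro x
    rw [(hasFDerivAt_gaussWave c y x).fderiv]
    simp [real_inner_comm]
    ring
  have hPg : (fun x => polyFun b P x * fderiv ℝ (gaussWave c y) x (b i))
      = fun x => -(2 * c) * (polyFun b (MvPolynomial.X i * P) x * gaussWave c y x)
        + Complex.I * ((⟪y, b i⟫_ℝ : ℝ) : ℂ) * (polyFun b P x * gaussWave c y x) := by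
    ext x
    rw [hg, polyFun_mul]
    ring
  have h := integral_mul_fderiv_eq_neg_fderiv_mul_of_integrable (μ := (volume : Measure V))
    (f := polyFun b P) (g := gaussWave c y) (v := b i)
    (by simpa only [fderiv_polyFun_apply] using hI (MvPolynomial.pderiv i P))
    (by rw [hPg]; exact ((hI _).const_mul _).add ((hI _).const_mul _))
    (hI P)
    (fun x _ => (hasFDerivAt_polyFun b P x).differentiableAt)
    (fun x _ => (hasFDerivAt_gaussWave c y x).differentiableAt)
  simp only [fderiv_polyFun_apply] at h
  rw [hPg, integral_add ((hI _).const_mul _) ((hI _).const_mul _), integral_const_mul,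
    integral_const_mul] at h
  linear_combination -h

theorem pderiv_pderiv_comm (i j : Fin d) (P : MvPolynomial (Fin d) ℂ) :
    MvPolynomial.pderiv i (MvPolynomial.pderiv j P)
      = MvPolynomial.pderiv j (MvPolynomial.pderiv i P) := by
  ext m
  simp only [MvPolynomial.coeff_pderiv, add_right_comm m]
  rcases eq_or_ne i j with rfl | hij
  · rfl
  · simp [hij, hij.symm]
    ring

theorem lapPoly_pderiv (i : Fin d) (P : MvPolynomial (Fin d) ℂ) :
    lapPoly (MvPolynomial.pderiv i P) = MvPolynomial.pderiv i (lapPoly P) := by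
  simp only [lapPoly, map_sum]
  refine Finset.sum_congr rfl fun j _ => ?_
  rw [pderiv_pderiv_comm j i P, pderiv_pderiv_comm j i]

/-- The Fourier transform of `h(x) exp (-c |x|²)`, for `h` harmonic and homogeneous of degree `k`,
is again `h` times a Gaussian: by Euler's identity `k h = ∑ xᵢ ∂ᵢh`, one integration by parts in
each term reduces the degree, the term with `∂ᵢ∂ᵢh` dropping out. -/
theorem integral_harmonic_mul_gaussWave {c : ℂ} (hc : 0 < c.re) (y : V) {k : ℕ}
    {P : MvPolynomial (Fin d) ℂ} (hP : P.IsHomogeneous k) (hl : lapPoly P = 0) :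
    ∫ x, polyFun b P x * gaussWave c y x
      = (Complex.I / (2 * c)) ^ k * polyFun b P y * ∫ x, gaussWave c y x := by
  have hc0 : c ≠ 0 := fun h => by simp [h] at hc
  have hI := integrable_polyFun_mul_gaussWave b hc y
  induction k generalizing P with
  | zero =>
    have : P = MvPolynomial.C (P.coeff 0) :=
      MvPolynomial.totalDegree_eq_zero_iff_eq_C.mp (Nat.le_zero.mp hP.totalDegree_le)
    rw [this]
    simp [integral_const_mul]
  | succ k ih =>
    have hd : ∀ i, ∫ x, polyFun b (MvPolynomial.pderiv i P) x * gaussWave c y x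
        = (Complex.I / (2 * c)) ^ k * polyFun b (MvPolynomial.pderiv i P) y *
          ∫ x, gaussWave c y x := fun i =>
      ih (by simpa using hP.pderiv (i := i)) (by rw [lapPoly_pderiv, hl, map_zero])
    have hk : (k + 1 : ℂ) ≠ 0 := by exact_mod_cast k.succ_ne_zero
    have h1 : (k + 1 : ℂ) * ∫ x, polyFun b P x * gaussWave c y x
        = ∑ i, ∫ x, polyFun b (MvPolynomial.X i * MvPolynomial.pderiv i P) x *
          gaussWave c y x := by
      rw [← integral_const_mul, ← integral_finsetSum _ fun i _ => hI _]
      refine integral_congr_ae (Filter.Eventually.of_forall fun x => ?_)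
      simp only
      rw [← Finset.sum_mul, ← polyFun_sum, hP.sum_X_mul_pderiv, polyFun_nsmul]
      push_cast
      ring
    have h2 : ∀ i, ∫ x, polyFun b (MvPolynomial.X i * MvPolynomial.pderiv i P) x *
          gaussWave c y x = (2 * c)⁻¹ * (∫ x, polyFun b (MvPolynomial.pderiv i
            (MvPolynomial.pderiv i P)) x * gaussWave c y x)
          + (Complex.I / (2 * c)) ^ (k + 1) * (∫ x, gaussWave c y x) *
            polyFun b (MvPolynomial.X i * MvPolynomial.pderiv i P) y := by
      intro i
      have := integral_X_mul_gaussWave b hc y i (MvPolynomial.pderiv i P)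
      rw [hd] at this
      rw [polyFun_mul, polyFun_X, real_inner_comm]
      have h2c : 2 * c ≠ 0 := by simpa using hc0
      apply mul_left_cancel₀ h2c
      rw [this, pow_succ]
      field_simp
    have h3 : ∑ i, ∫ x, polyFun b (MvPolynomial.pderiv i (MvPolynomial.pderiv i P)) x *
        gaussWave c y x = 0 := by
      rw [← integral_finsetSum _ fun i _ => hI _]
      simp only [← Finset.sum_mul, ← polyFun_sum]
      have : ∑ i, MvPolynomial.pderiv i (MvPolynomial.pderiv i P) = 0 := hl
      rw [this]
      simp [polyFun]
    apply mul_left_cancel₀ hk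
    rw [h1]
    simp only [h2]
    rw [Finset.sum_add_distrib, ← Finset.mul_sum, h3, ← Finset.mul_sum, ← polyFun_sum,
      hP.sum_X_mul_pderiv, polyFun_nsmul]
    push_cast
    ring

theorem integral_gaussWave {c : ℂ} (hc : 0 < c.re) (y : V) :
    ∫ x, gaussWave c y x = (Real.pi / c) ^ ((Module.finrank ℝ V : ℂ) / 2) *
      Complex.exp (-(‖y‖ : ℂ) ^ 2 / (4 * c)) := by
  have := GaussianFourier.integral_cexp_neg_mul_sq_norm_add hc Complex.I y
  simpa [gaussWave] using this

/-- A homogeneous harmonic polynomial is orthogonal, with respect to the Gaussian measure, to all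
homogeneous polynomials of smaller degree. Euler's identity and one integration by parts lower both
degrees by one. -/
theorem integral_harmonic_mul_gauss_eq_zero {k l : ℕ} {P Q : MvPolynomial (Fin d) ℂ}
    (hP : P.IsHomogeneous k) (hl : lapPoly P = 0) (hQ : Q.IsHomogeneous l) (hlk : l < k) :
    ∫ x : V, polyFun b (P * Q) x * gaussWave 1 0 x = 0 := by
  have hI := integrable_polyFun_mul_gaussWave b (c := 1) (by simp) (0 : V)
  have hX := integral_X_mul_gaussWave b (c := 1) (by simp) (0 : V)
  simp only [inner_zero_left, Complex.ofReal_zero, mul_zero, zero_mul, add_zero, mul_one] at hX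
  induction k generalizing P Q l with
  | zero => omega
  | succ k ih =>
    have hk : (k + 1 : ℂ) ≠ 0 := by exact_mod_cast k.succ_ne_zero
    have h1 : (k + 1 : ℂ) * ∫ x, polyFun b (P * Q) x * gaussWave 1 0 x
        = ∑ i, ∫ x, polyFun b (MvPolynomial.X i * (MvPolynomial.pderiv i P * Q)) x *
          gaussWave 1 0 x := by
      rw [← integral_const_mul, ← integral_finsetSum _ fun i _ => hI _]
      refine integral_congr_ae (Filter.Eventually.of_forall fun x => ?_)
      simp only
      rw [← Finset.sum_mul, ← polyFun_sum]
      simp only [← mul_assoc]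
      rw [← Finset.sum_mul, hP.sum_X_mul_pderiv, polyFun_mul, polyFun_mul, polyFun_nsmul]
      push_cast
      ring
    have h2 : ∀ i, 2 * ∫ x, polyFun b (MvPolynomial.X i * (MvPolynomial.pderiv i P * Q)) x *
          gaussWave 1 0 x = ∫ x, polyFun b (MvPolynomial.pderiv i
            (MvPolynomial.pderiv i P) * Q) x * gaussWave 1 0 x := by
      intro i
      have h4 : ∫ x : V, polyFun b (MvPolynomial.pderiv i P * MvPolynomial.pderiv i Q) x *
          gaussWave 1 0 x = 0 := by
        rcases Nat.eq_zero_or_pos l with rfl | hl0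
        · have : Q = MvPolynomial.C (Q.coeff 0) :=
            MvPolynomial.totalDegree_eq_zero_iff_eq_C.mp (Nat.le_zero.mp hQ.totalDegree_le)
          rw [this, MvPolynomial.pderiv_C]
          simp [polyFun]
        · exact ih (by simpa using hP.pderiv (i := i)) (by rw [lapPoly_pderiv, hl, map_zero])
            (hQ.pderiv (i := i)) (by omega)
      rw [hX, MvPolynomial.pderiv_mul]
      simp only [polyFun_add, add_mul]
      rw [integral_add (hI _) (hI _), h4, add_zero]
    have h3 : ∑ i, ∫ x, polyFun b (MvPolynomial.pderiv i (MvPolynomial.pderiv i P) * Q) x *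
        gaussWave 1 0 x = 0 := by
      rw [← integral_finsetSum _ fun i _ => hI _]
      simp only [← Finset.sum_mul, ← polyFun_sum]
      have : ∑ i, MvPolynomial.pderiv i (MvPolynomial.pderiv i P) = 0 := hl
      rw [this]
      simp [polyFun]
    have h5 : 2 * ((k + 1 : ℂ) * ∫ x, polyFun b (P * Q) x * gaussWave 1 0 x) = 0 := by
      rw [h1, Finset.mul_sum]
      simp only [h2]
      exact h3
    simpa [hk] using h5

/-- A homogeneous harmonic polynomial is orthogonal on the unit sphere to all homogeneous
polynomials of smaller degree. -/
theorem integral_sphere_harmonic_mul_eq_zero [Nontrivial V] {k l : ℕ}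
    {P Q : MvPolynomial (Fin d) ℂ}
    (hP : P.IsHomogeneous k) (hl : lapPoly P = 0) (hQ : Q.IsHomogeneous l) (hlk : l < k) :
    ∫ w : Metric.sphere (0 : V) 1, polyFun b P w * polyFun b Q w ∂(volume : Measure V).toSphere
      = 0 := by
  have h := integral_harmonic_mul_gauss_eq_zero b hP hl hQ hlk
  rw [integral_polar (integrable_polyFun_mul_gaussWave b (c := 1) (by simp) (0 : V) _)] at h
  set J := ∫ w : Metric.sphere (0 : V) 1, polyFun b P w * polyFun b Q w
    ∂(volume : Measure V).toSphere
  set m := Module.finrank ℝ V - 1 + k + l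
  have h1 : ∀ r ∈ Set.Ioi (0 : ℝ), (r : ℂ) ^ (Module.finrank ℝ V - 1) *
      ∫ w : Metric.sphere (0 : V) 1, polyFun b (P * Q) (r • (w : V)) *
        gaussWave 1 0 (r • (w : V)) ∂(volume : Measure V).toSphere
      = ((r ^ m * Real.exp (-1 * r ^ 2) : ℝ) : ℂ) * J := by
    intro r hr
    have hr0 : 0 < r := hr
    have h2 : ∀ w : Metric.sphere (0 : V) 1, polyFun b (P * Q) (r • (w : V)) *
        gaussWave 1 0 (r • (w : V))
        = ((r : ℂ) ^ (k + l) * Complex.exp (-1 * (r : ℂ) ^ 2)) *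
          (polyFun b P w * polyFun b Q w) := by
      intro w
      have hw : ‖(w : V)‖ = 1 := mem_sphere_zero_iff_norm.mp w.2
      rw [polyFun_smul b (hP.mul hQ), polyFun_mul, gaussWave, norm_smul, hw]
      simp [← Complex.ofReal_pow]
      ring
    simp only [h2]
    rw [integral_const_mul]
    push_cast
    simp only [m, pow_add]
    ring
  rw [setIntegral_congr_fun measurableSet_Ioi h1, integral_mul_const, mul_eq_zero] at h
  refine h.resolve_left fun h0 => ?_
  rw [integral_complex_ofReal, Complex.ofReal_eq_zero] at h0
  have hpos := integral_rpow_mul_exp_neg_mul_rpow (p := 2) (q := m) (b := 1) two_pos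
    (by linarith [m.cast_nonneg (α := ℝ)]) one_pos
  simp only [Real.rpow_natCast, Real.rpow_two] at hpos
  rw [hpos] at h0
  have hG : 0 < Real.Gamma (((m : ℝ) + 1) / 2) := Real.Gamma_pos_of_pos (by positivity)
  simp [hG.ne'] at h0

end Gauss

/-! ### The Paley–Wiener theorem for radial functions -/

/-- An even entire function is an entire function of `z²`. Since it is even, the choice of the
square root does not matter. -/
theorem exists_entire_comp_sq {G : ℂ → ℂ} (hG : Differentiable ℂ G) (he : ∀ z, G (-z) = G z) :
    Differentiable ℂ (fun w => G (w ^ (1 / 2 : ℂ))) ∧ ∀ z, G ((z ^ 2) ^ (1 / 2 : ℂ)) = G z := by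
  have hsq : ∀ w : ℂ, (w ^ (1 / 2 : ℂ)) ^ 2 = w := fun w => by
    rw [← Complex.cpow_nat_mul]
    simp
  have hGz : ∀ z, G ((z ^ 2) ^ (1 / 2 : ℂ)) = G z := fun z => by
    rcases sq_eq_sq_iff_eq_or_eq_neg.mp (hsq (z ^ 2)) with h | h
    · rw [h]
    · rw [h, he]
  have hcpow : ∀ w ∈ Complex.slitPlane, DifferentiableAt ℂ (fun w : ℂ => w ^ (1 / 2 : ℂ)) w :=
    fun w hw => (Complex.hasStrictDerivAt_cpow_const hw).hasDerivAt.differentiableAt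
  have hne : ∀ w : ℂ, w ≠ 0 → DifferentiableAt ℂ (fun w => G (w ^ (1 / 2 : ℂ))) w := by
    intro w hw
    by_cases hs : w ∈ Complex.slitPlane
    · exact (hG _).comp w (hcpow w hs)
    · -- on the branch cut, use the root `i √(-w)` instead
      have hs' : -w ∈ Complex.slitPlane := by
        rw [Complex.mem_slitPlane_iff] at hs ⊢
        push Not at hs
        refine Or.inl (lt_of_le_of_ne (by simpa using hs.1) fun h0 => hw ?_)
        apply Complex.ext
        · simpa using h0.symm
        · simpa using hs.2
      have h1 : (fun w => G (w ^ (1 / 2 : ℂ)))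
          = fun w => G (Complex.I * (-w) ^ (1 / 2 : ℂ)) := by
        ext v
        rw [← hGz (Complex.I * (-v) ^ (1 / 2 : ℂ)), mul_pow, hsq]
        simp
      rw [h1]
      have h2 : DifferentiableAt ℂ (fun w : ℂ => (-w) ^ (1 / 2 : ℂ)) w :=
        DifferentiableAt.comp w (hcpow (-w) hs') differentiableAt_id.neg
      exact (hG _).comp w (h2.const_mul Complex.I)
  refine ⟨fun w => ?_, hGz⟩
  rcases eq_or_ne w 0 with rfl | hw
  · refine (Complex.analyticAt_of_differentiable_on_punctured_nhds_of_continuousAt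
      (Filter.eventually_of_mem self_mem_nhdsWithin fun w hw => hne w hw) ?_).differentiableAt
    refine (hG.continuous.continuousAt).comp ?_
    exact Complex.continuousAt_cpow_const_of_re_pos (Or.inl le_rfl) (by norm_num)
  · exact hne w hw

/-- Shifting the contour of integration of an entire function from `ℝ` to `ℝ + iη`. -/
theorem integral_eq_integral_add_mul_I {K : ℂ → ℂ} (hK : Differentiable ℂ K) {η A : ℝ}
    (hη : 0 ≤ η) (hA : ∀ s u : ℝ, 0 ≤ u → u ≤ η → ‖K (s + u * Complex.I)‖ ≤ A / (1 + s ^ 2)) :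
    ∫ s : ℝ, K s = ∫ s : ℝ, K (s + η * Complex.I) := by
  have hint : ∀ u : ℝ, 0 ≤ u → u ≤ η → Integrable fun s : ℝ => K (s + u * Complex.I) := by
    intro u hu hu'
    refine (integrable_inv_one_add_sq.const_mul A).mono' ?_
      (Filter.Eventually.of_forall fun s => ?_)
    · exact (hK.continuous.comp (by fun_prop)).aestronglyMeasurable
    · simpa [div_eq_mul_inv] using hA s u hu hu'
  have h0 := hint 0 le_rfl hη
  simp only [Complex.ofReal_zero, zero_mul, add_zero] at h0
  have hlim : Filter.Tendsto (fun T : ℝ => A / (1 + T ^ 2) * |η - 0|) Filter.atTop (nhds 0) := by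
    have : Filter.Tendsto (fun T : ℝ => 1 + T ^ 2) Filter.atTop Filter.atTop :=
      Filter.tendsto_atTop_add_const_left _ _ (Filter.tendsto_pow_atTop two_ne_zero)
    simpa using ((tendsto_const_nhds (x := A)).div_atTop this).mul_const (|η - 0|)
  have hside : ∀ σ : ℝ, σ ^ 2 = 1 → Filter.Tendsto
      (fun T : ℝ => ∫ u in (0 : ℝ)..η, K ((σ * T : ℝ) + u * Complex.I)) Filter.atTop (nhds 0) := by
    intro σ hσ
    refine squeeze_zero_norm (fun T => ?_) hlim
    refine intervalIntegral.norm_integral_le_of_norm_le_const fun u hu => ?_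
    rw [Set.uIoc_of_le hη] at hu
    have := hA (σ * T) u hu.1.le hu.2
    rwa [mul_pow, hσ, one_mul] at this
  have hbot := intervalIntegral_tendsto_integral h0 Filter.tendsto_neg_atTop_atBot Filter.tendsto_id
  have htop := intervalIntegral_tendsto_integral (hint η hη le_rfl) Filter.tendsto_neg_atTop_atBot
    Filter.tendsto_id
  have hrect : ∀ T : ℝ, (∫ s in (-T)..T, K s) - (∫ s in (-T)..T, K (s + η * Complex.I))
      + Complex.I * (∫ u in (0 : ℝ)..η, K ((1 * T : ℝ) + u * Complex.I))
      - Complex.I * (∫ u in (0 : ℝ)..η, K (((-1) * T : ℝ) + u * Complex.I)) = 0 := by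
    intro T
    have := Complex.integral_boundary_rect_eq_zero_of_differentiableOn K (-T : ℂ)
      (T + η * Complex.I) hK.differentiableOn
    simpa using this
  have hall := ((hbot.sub htop).add ((hside 1 (by norm_num)).const_mul Complex.I)).sub
    ((hside (-1) (by norm_num)).const_mul Complex.I)
  have h4 := hall.congr' (Filter.Eventually.of_forall fun T => hrect T)
  have := tendsto_nhds_unique h4 tendsto_const_nhds
  simpa [sub_eq_zero] using this

/-- If `v² = (s + iu)² + ρ²` then `|Im v| ≤ |u|`. -/
theorem abs_im_le_of_sq_eq {v : ℂ} {s u ρ : ℝ} (h : v ^ 2 = (s + u * Complex.I) ^ 2 + (ρ : ℂ) ^ 2) :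
    |v.im| ≤ |u| := by
  have hre : v.re ^ 2 - v.im ^ 2 = s ^ 2 - u ^ 2 + ρ ^ 2 := by
    have := congrArg Complex.re h
    simpa [sq] using this
  have him : v.re * v.im = s * u := by
    have := congrArg Complex.im h
    simp [sq] at this
    linarith
  by_contra hcon
  push Not at hcon
  have h1 : u ^ 2 < v.im ^ 2 := sq_lt_sq.mpr hcon
  have h2 : s ^ 2 < v.re ^ 2 := by nlinarith [sq_nonneg ρ]
  have h3 : s ^ 2 * u ^ 2 < v.re ^ 2 * v.im ^ 2 :=
    mul_lt_mul'' h2 h1 (sq_nonneg _) (sq_nonneg _)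
  have h4 : s ^ 2 * u ^ 2 = v.re ^ 2 * v.im ^ 2 := by
    rw [← mul_pow, ← mul_pow, him]
  linarith

/-- The entire function satisfies the exponential estimates of type `R` with all powers. -/
def ExpType (R : ℝ) (G : ℂ → ℂ) : Prop :=
  ∀ N : ℕ, ∃ C : ℝ, ∀ z : ℂ, (1 + ‖z‖) ^ N * ‖G z‖ ≤ C * Real.exp (R * |z.im|)

/-- The estimate of `ExpType` on a tube around `ℝᵐ`, for the function `G (√(ζ·ζ))`. -/
theorem ExpType.norm_comp_sqrt_le {R : ℝ} (hR : 0 ≤ R) {G : ℂ → ℂ} (hG : ExpType R G) (N : ℕ) :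
    ∃ C : ℝ, 0 ≤ C ∧ ∀ s u ρ : ℝ,
      ‖G (((s + u * Complex.I) ^ 2 + (ρ : ℂ) ^ 2) ^ (1 / 2 : ℂ))‖ ≤
        C * (1 + u ^ 2) ^ N * Real.exp (R * |u|) * ((1 + (s ^ 2 + ρ ^ 2)) ^ N)⁻¹ := by
  obtain ⟨C, hC⟩ := hG (2 * N)
  have hC0 : 0 ≤ C := by
    have := hC 0
    simp at this
    exact (norm_nonneg _).trans this
  refine ⟨C, hC0, fun s u ρ => ?_⟩
  set w := (s + u * Complex.I) ^ 2 + (ρ : ℂ) ^ 2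
  set v := w ^ (1 / 2 : ℂ)
  have hv : v ^ 2 = w := by
    rw [← Complex.cpow_nat_mul]
    simp
  have h1 := hC v
  have hvu : |v.im| ≤ |u| := abs_im_le_of_sq_eq hv
  have h2 : C * Real.exp (R * |v.im|) ≤ C * Real.exp (R * |u|) := by gcongr
  have h3 : s ^ 2 + ρ ^ 2 ≤ ‖v‖ ^ 2 + u ^ 2 := by
    have : w.re = s ^ 2 - u ^ 2 + ρ ^ 2 := by simp [w, sq]
    have h4 := Complex.re_le_norm w
    rw [← hv, norm_pow, hv] at h4
    linarith
  have h5 : 1 + (s ^ 2 + ρ ^ 2) ≤ (1 + ‖v‖) ^ 2 * (1 + u ^ 2) := by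
    nlinarith [norm_nonneg v, mul_nonneg (norm_nonneg v) (sq_nonneg u), sq_nonneg (‖v‖ * u)]
  have h6 : (1 + (s ^ 2 + ρ ^ 2)) ^ N ≤ (1 + ‖v‖) ^ (2 * N) * (1 + u ^ 2) ^ N := by
    rw [pow_mul, ← mul_pow]
    gcongr
  rw [← div_eq_mul_inv, le_div_iff₀ (by positivity)]
  calc ‖G v‖ * (1 + (s ^ 2 + ρ ^ 2)) ^ N
      ≤ ‖G v‖ * ((1 + ‖v‖) ^ (2 * N) * (1 + u ^ 2) ^ N) := by gcongr
    _ = ((1 + ‖v‖) ^ (2 * N) * ‖G v‖) * (1 + u ^ 2) ^ N := by ring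
    _ ≤ (C * Real.exp (R * |u|)) * (1 + u ^ 2) ^ N :=
        mul_le_mul_of_nonneg_right (h1.trans h2) (by positivity)
    _ = _ := by ring

/-- The wave integral `x ↦ ∫ φ(ξ) exp (i ⟨x, ξ⟩) dξ`, the inverse Fourier transform up to a
constant. -/
def waveInt {V : Type*} [NormedAddCommGroup V] [InnerProductSpace ℝ V] [MeasurableSpace V]
    [BorelSpace V] [FiniteDimensional ℝ V] (φ : V → ℂ) (x : V) : ℂ :=
  ∫ ξ, φ ξ * Complex.exp (Complex.I * ((⟪x, ξ⟫_ℝ : ℝ) : ℂ))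

theorem integrable_inv_one_add_norm_sq_pow (E : Type*) [NormedAddCommGroup E]
    [InnerProductSpace ℝ E] [FiniteDimensional ℝ E] [MeasurableSpace E] [BorelSpace E] :
    Integrable fun x : E => ((1 + ‖x‖ ^ 2) ^ (Module.finrank ℝ E + 1))⁻¹ := by
  set n := Module.finrank ℝ E + 1
  have h1 : Integrable fun x : E => (1 + ‖x‖) ^ (-(n : ℝ)) :=
    integrable_one_add_norm (by simp [n])
  refine (h1.const_mul (2 ^ n)).mono' (by fun_prop) (Filter.Eventually.of_forall fun x => ?_)
  rw [Real.rpow_neg (by positivity), Real.rpow_natCast, Real.norm_of_nonneg (by positivity),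
    ← div_eq_mul_inv, inv_eq_one_div, div_le_div_iff₀ (by positivity) (by positivity), one_mul,
    ← mul_pow]
  gcongr
  nlinarith [sq_nonneg (‖x‖ - 1), norm_nonneg x]

theorem ExpType.integrable_comp_norm {R : ℝ} {G : ℂ → ℂ} (hG : ExpType R G)
    (hGd : Continuous G) (E : Type*) [NormedAddCommGroup E]
    [InnerProductSpace ℝ E] [FiniteDimensional ℝ E] [MeasurableSpace E] [BorelSpace E] :
    Integrable fun x : E => G ‖x‖ := by
  obtain ⟨C, hC⟩ := hG (2 * (Module.finrank ℝ E + 1))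
  refine ((integrable_inv_one_add_norm_sq_pow E).const_mul C).mono'
    ((hGd.comp (by fun_prop)).aestronglyMeasurable) (Filter.Eventually.of_forall fun x => ?_)
  have h := hC ‖x‖
  simp only [Complex.ofReal_im, abs_zero, mul_zero, Real.exp_zero, mul_one, Complex.norm_real,
    norm_norm] at h
  rw [← div_eq_mul_inv, le_div_iff₀ (by positivity), mul_comm]
  refine le_trans ?_ h
  rw [pow_mul]
  gcongr
  nlinarith [norm_nonneg x]

section Radial

variable (E : Type*) [NormedAddCommGroup E] [InnerProductSpace ℝ E] [FiniteDimensional ℝ E]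
    [MeasurableSpace E] [BorelSpace E]

/-- The radial Paley–Wiener theorem on the first coordinate axis. Shifting the contour in the first
frequency variable from `ℝ` to `ℝ + iη` bounds the wave integral at distance `r` by a polynomial in
`η` times `e^{-(r - R) η}`, which tends to `0` as `η → ∞`. -/
theorem waveInt_radial_axis_eq_zero {R : ℝ} (hR : 0 ≤ R) {G : ℂ → ℂ} (hGd : Differentiable ℂ G)
    (he : ∀ z, G (-z) = G z) (hG : ExpType R G) {r : ℝ} (hr : R < r) :
    waveInt (fun ξ : WithLp 2 (ℝ × E) => G ‖ξ‖) (WithLp.toLp 2 (r, (0 : E))) = 0 := by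
  obtain ⟨hgd, hg⟩ := exists_entire_comp_sq hGd he
  set N := Module.finrank ℝ (WithLp 2 (ℝ × E)) + 1 with hN
  obtain ⟨C, hC0, hC⟩ := hG.norm_comp_sqrt_le hR N
  obtain ⟨C₁, hC₁0, hC₁⟩ := hG.norm_comp_sqrt_le hR 1
  have hr0 : 0 < r := hR.trans_lt hr
  -- the integrand, continued analytically in the first coordinate
  let K : E → ℂ → ℂ := fun y z =>
    G ((z ^ 2 + (‖y‖ : ℂ) ^ 2) ^ (1 / 2 : ℂ)) * Complex.exp (Complex.I * (r * z))
  have hKd : ∀ y, Differentiable ℂ (K y) := fun y => by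
    have h1 : Differentiable ℂ fun z : ℂ => z ^ 2 + (‖y‖ : ℂ) ^ 2 := by fun_prop
    exact (hgd.comp h1).mul (by fun_prop)
  have hexp : ∀ s u : ℝ, ‖Complex.exp (Complex.I * (r * (s + u * Complex.I)))‖
      = Real.exp (-r * u) := fun s u => by
    rw [Complex.norm_exp]
    congr 1
    simp
  have hF : Integrable fun q : ℝ × E => G ‖(WithLp.toLp 2 q : WithLp 2 (ℝ × E))‖ *
      Complex.exp (Complex.I * ((⟪(WithLp.toLp 2 (r, (0 : E)) : WithLp 2 (ℝ × E)),
        WithLp.toLp 2 q⟫_ℝ : ℝ) : ℂ)) := by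
    have h1 : Integrable fun ξ : WithLp 2 (ℝ × E) => G ‖ξ‖ * Complex.exp (Complex.I *
        ((⟪(WithLp.toLp 2 (r, (0 : E)) : WithLp 2 (ℝ × E)), ξ⟫_ℝ : ℝ) : ℂ)) := by
      refine (hG.integrable_comp_norm hGd.continuous _).mul_bdd (c := 1)
        (by fun_prop) (Filter.Eventually.of_forall fun ξ => ?_)
      rw [mul_comm, Complex.norm_exp_ofReal_mul_I]
    exact ((WithLp.volume_preserving_toLp ℝ E).integrable_comp_emb
      (MeasurableEquiv.toLp 2 (ℝ × E)).measurableEmbedding).mpr h1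
  have hval : waveInt (fun ξ : WithLp 2 (ℝ × E) => G ‖ξ‖) (WithLp.toLp 2 (r, (0 : E)))
      = ∫ y : E, ∫ s : ℝ, K y s := by
    unfold waveInt
    rw [← (WithLp.volume_preserving_toLp ℝ E).integral_comp
      (MeasurableEquiv.toLp 2 (ℝ × E)).measurableEmbedding]
    refine (integral_prod_symm _ hF).trans ?_
    refine integral_congr_ae (Filter.Eventually.of_forall fun y => ?_)
    refine integral_congr_ae (Filter.Eventually.of_forall fun s => ?_)
    simp only [K]
    congr 1
    · rw [← hg ‖(WithLp.toLp 2 (s, y) : WithLp 2 (ℝ × E))‖]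
      congr 2
      have := WithLp.prod_norm_sq_eq_of_L2 (WithLp.toLp 2 (s, y) : WithLp 2 (ℝ × E))
      rw [← Complex.ofReal_pow, this]
      simp
    · simp [WithLp.prod_inner_apply, mul_comm]
  -- for the shift of the contour, the quadratic decay from the exponent `1` is enough
  have hshift : ∀ η : ℝ, 0 ≤ η → ∀ y : E, ∫ s : ℝ, K y s = ∫ s : ℝ, K y (s + η * Complex.I) := by
    intro η hη y
    refine integral_eq_integral_add_mul_I (hKd y) (A := C₁ * (1 + η ^ 2) * Real.exp (R * η)) hη
      fun s u hu hu' => ?_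
    have h1 := hC₁ s u ‖y‖
    simp only [pow_one, abs_of_nonneg hu] at h1
    simp only [K]
    rw [norm_mul, hexp]
    have h2 : Real.exp (-r * u) ≤ 1 := by
      rw [Real.exp_le_one_iff]
      nlinarith
    have h3 : (1 + (s ^ 2 + ‖y‖ ^ 2))⁻¹ ≤ (1 + s ^ 2)⁻¹ :=
      inv_anti₀ (by positivity) (by linarith [sq_nonneg ‖y‖])
    calc _ ≤ C₁ * (1 + u ^ 2) * Real.exp (R * u) * (1 + (s ^ 2 + ‖y‖ ^ 2))⁻¹ * 1 :=
          mul_le_mul h1 h2 (Real.exp_nonneg _) (by positivity)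
      _ ≤ C₁ * (1 + η ^ 2) * Real.exp (R * η) * (1 + s ^ 2)⁻¹ := by
          rw [mul_one]
          gcongr
      _ = _ := (div_eq_mul_inv _ _).symm
  set D : ℝ := ∫ y : E, ∫ s : ℝ, ((1 + (s ^ 2 + ‖y‖ ^ 2)) ^ N)⁻¹
  have hDint : Integrable fun q : ℝ × E => ((1 + (q.1 ^ 2 + ‖q.2‖ ^ 2)) ^ N)⁻¹ := by
    have := ((WithLp.volume_preserving_toLp ℝ E).integrable_comp_emb
      (MeasurableEquiv.toLp 2 (ℝ × E)).measurableEmbedding).mpr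
      (integrable_inv_one_add_norm_sq_pow (WithLp 2 (ℝ × E)))
    refine this.congr (Filter.Eventually.of_forall fun q => ?_)
    simp only [Function.comp_apply]
    rw [WithLp.prod_norm_sq_eq_of_L2]
    simp [hN]
  -- along the shifted contour the exponential factors combine to `e^{-(r - R) η}`
  have hbound : ∀ η : ℝ, 0 ≤ η →
      ‖waveInt (fun ξ : WithLp 2 (ℝ × E) => G ‖ξ‖) (WithLp.toLp 2 (r, (0 : E)))‖
        ≤ C * (1 + η ^ 2) ^ N * Real.exp (-(r - R) * η) * D := by
    intro η hη
    have hpt : ∀ (y : E) (s : ℝ), ‖K y (s + η * Complex.I)‖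
        ≤ C * (1 + η ^ 2) ^ N * Real.exp (-(r - R) * η) * ((1 + (s ^ 2 + ‖y‖ ^ 2)) ^ N)⁻¹ := by
      intro y s
      have h1 := hC s η ‖y‖
      rw [abs_of_nonneg hη] at h1
      simp only [K]
      rw [norm_mul, hexp]
      calc _ ≤ C * (1 + η ^ 2) ^ N * Real.exp (R * η) * ((1 + (s ^ 2 + ‖y‖ ^ 2)) ^ N)⁻¹
            * Real.exp (-r * η) := by gcongr
        _ = C * (1 + η ^ 2) ^ N * (Real.exp (R * η) * Real.exp (-r * η)) *
            ((1 + (s ^ 2 + ‖y‖ ^ 2)) ^ N)⁻¹ := by ring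
        _ = _ := by
            rw [← Real.exp_add]
            ring_nf
    rw [hval]
    simp only [hshift η hη]
    have hs := hDint.prod_left_ae
    rw [← integral_const_mul]
    refine norm_integral_le_of_norm_le (hDint.integral_prod_right.const_mul _) ?_
    filter_upwards [hs] with y hy
    rw [← integral_const_mul]
    exact norm_integral_le_of_norm_le (hy.const_mul _) (Filter.Eventually.of_forall (hpt y))
  have hlim : Filter.Tendsto (fun η : ℝ => C * (1 + η ^ 2) ^ N * Real.exp (-(r - R) * η) * D)
      Filter.atTop (nhds 0) := by
    have h1 : Filter.Tendsto (fun η : ℝ => η ^ (2 * N) * Real.exp (-(r - R) * η))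
        Filter.atTop (nhds 0) := by
      have := tendsto_rpow_mul_exp_neg_mul_atTop_nhds_zero (2 * N : ℕ) (r - R) (by linarith)
      simpa only [Real.rpow_natCast] using this
    have h2 := (h1.const_mul (C * 2 ^ N)).mul_const D
    simp only [mul_zero, zero_mul] at h2
    have hD : 0 ≤ D := integral_nonneg fun y => integral_nonneg fun s => by positivity
    refine squeeze_zero' (Filter.eventually_atTop.mpr ⟨0, fun η _ => by positivity⟩)
      (Filter.eventually_atTop.mpr ⟨1, fun η hη => ?_⟩) h2
    gcongr ?_ * D
    have : (1 + η ^ 2) ^ N ≤ 2 ^ N * η ^ (2 * N) := by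
      rw [pow_mul, ← mul_pow]
      gcongr
      nlinarith
    calc C * (1 + η ^ 2) ^ N * Real.exp (-(r - R) * η)
        ≤ C * (2 ^ N * η ^ (2 * N)) * Real.exp (-(r - R) * η) := by gcongr
      _ = _ := by ring
  have := ge_of_tendsto hlim (Filter.eventually_atTop.mpr ⟨0, hbound⟩)
  exact norm_le_zero_iff.mp this

/-- For `G` even and entire of exponential type `R`, the Fourier transform of `ξ ↦ G(|ξ|)`
vanishes outside the ball of radius `R`. -/
theorem waveInt_radial_eq_zero {R : ℝ} (hR : 0 ≤ R) {G : ℂ → ℂ} (hGd : Differentiable ℂ G)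
    (he : ∀ z, G (-z) = G z) (hG : ExpType R G) {x : WithLp 2 (ℝ × E)} (hx : R < ‖x‖) :
    waveInt (fun ξ : WithLp 2 (ℝ × E) => G ‖ξ‖) x = 0 := by
  have hn : ‖(WithLp.toLp 2 (‖x‖, (0 : E)) : WithLp 2 (ℝ × E))‖ = ‖x‖ := by
    rw [WithLp.prod_norm_eq_of_L2]
    simp
  set e : WithLp 2 (ℝ × E) := WithLp.toLp 2 (‖x‖, (0 : E))
  set L := (Submodule.span ℝ {e - x})ᗮ.reflection
  have hL : L e = x := Submodule.reflection_sub hn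
  refine Eq.trans ?_ (waveInt_radial_axis_eq_zero E hR hGd he hG hx)
  change _ = waveInt _ e
  unfold waveInt
  rw [← L.measurePreserving.integral_comp L.toMeasurableEquiv.measurableEmbedding]
  refine integral_congr_ae (Filter.Eventually.of_forall fun ξ => ?_)
  simp only
  rw [L.norm_map, ← hL, L.inner_map_map]

end Radial

/-! ### The support theorem -/

/-- Injectivity of the Laplace transform in the variable `r²`. -/
theorem eq_zero_of_forall_integral_gauss_eq_zero {D : ℝ → ℂ} (hD : Continuous D)
    (hi : IntegrableOn (fun r : ℝ => D r * Complex.exp (-1 * (r : ℂ) ^ 2)) (Set.Ioi 0))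
    (h : ∀ c : ℂ, 0 < c.re → ∫ r in Set.Ioi (0 : ℝ), D r * Complex.exp (-c * (r : ℂ) ^ 2) = 0)
    {r : ℝ} (hr : 0 < r) : D r = 0 := by
  -- the substitution `u = r²` turns the hypothesis into the vanishing of a Fourier transform
  let q : ℂ → ℝ → ℂ := fun c r => D r * Complex.exp (-c * (r : ℂ) ^ 2)
  let k : ℂ → ℝ → ℂ := fun c u => (|(1 / 2 : ℝ)| * u ^ ((1 / 2 : ℝ) - 1)) • q c (u ^ (1 / 2 : ℝ))
  let φ : ℝ → ℂ := (Set.Ioi 0).indicator (k 1)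
  have hk : ∀ c, ∫ u in Set.Ioi 0, k c u = ∫ r in Set.Ioi 0, q c r := fun c =>
    integral_comp_rpow_Ioi (q c) (by norm_num)
  have hφi : Integrable φ := by
    rw [integrable_indicator_iff measurableSet_Ioi]
    refine (integrableOn_Ioi_comp_rpow_iff (q 1) (by norm_num)).mpr ?_
    exact hi
  have hF : FourierTransform.fourier φ = 0 := by
    ext w
    have h1 := h (1 + 2 * Real.pi * w * Complex.I) (by simp)
    rw [Real.fourier_real_eq_integral_exp_smul]
    rw [Pi.zero_apply, ← h1]
    refine Eq.trans ?_ (hk _)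
    rw [← integral_indicator measurableSet_Ioi]
    refine integral_congr_ae (Filter.Eventually.of_forall fun u => ?_)
    by_cases hu : u ∈ Set.Ioi (0 : ℝ)
    · have hu0 : (0 : ℝ) < u := hu
      have hsq : ((u ^ (1 / 2 : ℝ) : ℝ) : ℂ) ^ 2 = u := by
        rw [← Complex.ofReal_pow, ← Real.rpow_natCast, ← Real.rpow_mul hu0.le]
        norm_num
      simp only [φ, Set.indicator_of_mem hu, k, q, hsq]
      rw [smul_eq_mul, mul_smul_comm, mul_left_comm, ← Complex.exp_add]
      congr 4
      push_cast
      ring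
    · simp [φ, Set.indicator_of_notMem hu]
  have hcont : ContinuousAt φ (r ^ 2) := by
    have hr2 : (0 : ℝ) < r ^ 2 := by positivity
    have : φ =ᶠ[nhds (r ^ 2)] k 1 :=
      Filter.eventually_of_mem (Ioi_mem_nhds hr2) fun u hu => Set.indicator_of_mem hu _
    refine ContinuousAt.congr ?_ this.symm
    have h1 : ContinuousAt (fun u : ℝ => u ^ ((1 / 2 : ℝ) - 1)) (r ^ 2) :=
      Real.continuousAt_rpow_const _ _ (Or.inl hr2.ne')
    have h2 : ContinuousAt (fun u : ℝ => u ^ (1 / 2 : ℝ)) (r ^ 2) :=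
      Real.continuousAt_rpow_const _ _ (Or.inl hr2.ne')
    have h3 : Continuous (q 1) := by
      simp only [q]
      fun_prop
    exact (h1.const_mul _).smul (h3.continuousAt.comp h2)
  have hinv := hφi.fourierInv_fourier_eq (by rw [hF]; exact integrable_zero _ _ _) hcont
  have h0 : φ (r ^ 2) = 0 := by
    rw [← hinv, hF, Real.fourierInv_eq]
    simp
  have hr2 : r ^ 2 ∈ Set.Ioi (0 : ℝ) := by
    simp only [Set.mem_Ioi]
    positivity
  have hroot : (r ^ 2 : ℝ) ^ (1 / 2 : ℝ) = r := by
    rw [← Real.sqrt_eq_rpow, Real.sqrt_sq hr.le]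
  simp only [φ, Set.indicator_of_mem hr2, k, q, hroot] at h0
  have h4 : |(1 / 2 : ℝ)| * (r ^ 2) ^ ((1 / 2 : ℝ) - 1) ≠ 0 := by positivity
  rcases smul_eq_zero.mp h0 with h5 | h5
  · exact absurd h5 h4
  · exact (mul_eq_zero.mp h5).resolve_right (Complex.exp_ne_zero _)

section Support

variable {V : Type*} [NormedAddCommGroup V] [InnerProductSpace ℝ V] [FiniteDimensional ℝ V]
  [MeasurableSpace V] [BorelSpace V]

theorem continuous_waveInt {φ : V → ℂ} (hφ : Integrable φ) : Continuous (waveInt φ) := by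
  refine continuous_of_dominated (bound := fun ξ => ‖φ ξ‖) (fun x => ?_) (fun x => ?_) hφ.norm ?_
  · exact hφ.aestronglyMeasurable.mul (by fun_prop)
  · refine Filter.Eventually.of_forall fun ξ => ?_
    rw [norm_mul, mul_comm Complex.I, Complex.norm_exp_ofReal_mul_I, mul_one]
  · exact Filter.Eventually.of_forall fun ξ => by fun_prop

theorem norm_waveInt_le (φ : V → ℂ) (x : V) : ‖waveInt φ x‖ ≤ ∫ ξ, ‖φ ξ‖ := by
  refine (norm_integral_le_integral_norm _).trans_eq ?_
  refine integral_congr_ae (Filter.Eventually.of_forall fun ξ => ?_)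
  simp only
  rw [norm_mul, mul_comm Complex.I, Complex.norm_exp_ofReal_mul_I, mul_one]

variable {d : ℕ} (b : OrthonormalBasis (Fin d) ℝ V)

theorem integrable_waveInt_mul_gauss {φ : V → ℂ} (hφ : Integrable φ) (P : MvPolynomial (Fin d) ℂ)
    {c : ℂ} (hc : 0 < c.re) :
    Integrable fun x => waveInt φ x * (polyFun b P x * gaussWave c 0 x) :=
  (integrable_polyFun_mul_gaussWave b hc 0 P).bdd_mul (c := ∫ ξ, ‖φ ξ‖)
    (continuous_waveInt hφ).aestronglyMeasurable
    (Filter.Eventually.of_forall fun x => norm_waveInt_le φ x)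

theorem integral_waveInt_mul_gauss {φ : V → ℂ} (hφ : Integrable φ) (P : MvPolynomial (Fin d) ℂ)
    {c : ℂ} (hc : 0 < c.re) :
    ∫ x, waveInt φ x * (polyFun b P x * gaussWave c 0 x)
      = ∫ ξ, φ ξ * ∫ x, polyFun b P x * gaussWave c ξ x := by
  simp only [waveInt, ← integral_mul_const, ← integral_const_mul]
  rw [integral_integral_swap]
  · refine integral_congr_ae (Filter.Eventually.of_forall fun ξ => ?_)
    refine integral_congr_ae (Filter.Eventually.of_forall fun x => ?_)
    simp only [gaussWave, Complex.exp_add, inner_zero_left, real_inner_comm ξ x]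
    simp
    ring
  · have h1 : Integrable (fun q : V × V => (polyFun b P q.1 * gaussWave c 0 q.1) * φ q.2)
        ((volume : Measure V).prod volume) :=
      (integrable_polyFun_mul_gaussWave b hc 0 P).mul_prod hφ
    have h2 := h1.mul_bdd (c := 1)
      (g := fun q : V × V => Complex.exp (Complex.I * ((⟪q.1, q.2⟫_ℝ : ℝ) : ℂ)))
      (by fun_prop) (Filter.Eventually.of_forall fun q => by
        rw [mul_comm Complex.I, Complex.norm_exp_ofReal_mul_I])
    refine h2.congr (Filter.Eventually.of_forall fun q => ?_)
    simp only [Function.uncurry]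
    ring

/-- Pairing the Fourier transform of `φ` with a harmonic polynomial times a Gaussian only involves
the corresponding spherical harmonic component `rᵏ G(r)` of `φ`. -/
theorem integral_sphere_waveInt_gauss [Nontrivial V] {φ : V → ℂ} (hφ : Integrable φ) {k : ℕ}
    {P : MvPolynomial (Fin d) ℂ} (hP : P.IsHomogeneous k) (hl : lapPoly P = 0) {G : ℝ → ℂ}
    (hG : ∀ r : ℝ, 0 < r → ∫ w : Metric.sphere (0 : V) 1, φ (r • (w : V)) * polyFun b P w
      ∂(volume : Measure V).toSphere = (r : ℂ) ^ k * G r) {c : ℂ} (hc : 0 < c.re) :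
    ∫ r in Set.Ioi (0 : ℝ), (r : ℂ) ^ (Module.finrank ℝ V - 1 + k) *
      (∫ w : Metric.sphere (0 : V) 1, waveInt φ (r • (w : V)) * polyFun b P w
        ∂(volume : Measure V).toSphere) * Complex.exp (-c * (r : ℂ) ^ 2)
      = (Complex.I / (2 * c)) ^ k * (Real.pi / c) ^ ((Module.finrank ℝ V : ℂ) / 2) *
        ∫ r in Set.Ioi (0 : ℝ), (r : ℂ) ^ (Module.finrank ℝ V - 1 + 2 * k) * G r *
          Complex.exp (-(r : ℂ) ^ 2 / (4 * c)) := by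
  have hc4 : 0 < ((4 * c)⁻¹).re := by
    rw [Complex.inv_re]
    have h4 : 0 < (4 * c).re := by simpa using hc
    have : 0 < Complex.normSq (4 * c) := Complex.normSq_pos.mpr fun h0 => by simp [h0] at h4
    positivity
  have h1 := integral_waveInt_mul_gauss b hφ P hc
  rw [integral_polar (integrable_waveInt_mul_gauss b hφ P hc)] at h1
  have hL : ∀ r ∈ Set.Ioi (0 : ℝ), (r : ℂ) ^ (Module.finrank ℝ V - 1) *
      ∫ w : Metric.sphere (0 : V) 1, waveInt φ (r • (w : V)) * (polyFun b P (r • (w : V)) *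
        gaussWave c 0 (r • (w : V))) ∂(volume : Measure V).toSphere
      = (r : ℂ) ^ (Module.finrank ℝ V - 1 + k) *
      (∫ w : Metric.sphere (0 : V) 1, waveInt φ (r • (w : V)) * polyFun b P w
        ∂(volume : Measure V).toSphere) * Complex.exp (-c * (r : ℂ) ^ 2) := by
    intro r hr
    have hr0 : 0 < r := hr
    have h2 : ∀ w : Metric.sphere (0 : V) 1, waveInt φ (r • (w : V)) * (polyFun b P (r • (w : V)) *
        gaussWave c 0 (r • (w : V))) = ((r : ℂ) ^ k * Complex.exp (-c * (r : ℂ) ^ 2)) *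
          (waveInt φ (r • (w : V)) * polyFun b P w) := by
      intro w
      have hw : ‖(w : V)‖ = 1 := mem_sphere_zero_iff_norm.mp w.2
      rw [polyFun_smul b hP, gaussWave, norm_smul, hw]
      simp [← Complex.ofReal_pow]
      ring
    simp only [h2]
    rw [integral_const_mul, pow_add]
    ring
  rw [setIntegral_congr_fun measurableSet_Ioi hL] at h1
  rw [h1]
  have hR : ∀ ξ, φ ξ * ∫ x, polyFun b P x * gaussWave c ξ x
      = ((Complex.I / (2 * c)) ^ k * (Real.pi / c) ^ ((Module.finrank ℝ V : ℂ) / 2)) *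
        (φ ξ * (polyFun b P ξ * gaussWave ((4 * c)⁻¹) 0 ξ)) := by
    intro ξ
    rw [integral_harmonic_mul_gaussWave b hc ξ hP hl, integral_gaussWave hc]
    simp only [gaussWave, inner_zero_left]
    rw [show -(4 * c)⁻¹ * (‖ξ‖ : ℂ) ^ 2 + Complex.I * ((0 : ℝ) : ℂ) = -(‖ξ‖ : ℂ) ^ 2 / (4 * c) by
      rw [div_eq_mul_inv]
      simp
      ring]
    ring
  simp only [hR]
  rw [integral_const_mul]
  congr 1
  have hbd : ∃ C, ∀ ξ, ‖polyFun b P ξ * gaussWave ((4 * c)⁻¹) 0 ξ‖ ≤ C := by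
    obtain ⟨C, K, hC, hPK⟩ := exists_norm_polyFun_le b P
    refine ⟨C * (K.factorial * Real.exp (1 + 1 / (4 * ((4 * c)⁻¹).re))), fun ξ => ?_⟩
    rw [norm_mul, norm_gaussWave]
    calc _ ≤ C * (1 + ‖ξ‖) ^ K * Real.exp (-((4 * c)⁻¹).re * ‖ξ‖ ^ 2) := by
          gcongr
          exact hPK ξ
      _ = C * ((1 + ‖ξ‖) ^ K * Real.exp (-((4 * c)⁻¹).re * ‖ξ‖ ^ 2)) := by ring
      _ ≤ _ := mul_le_mul_of_nonneg_left
          (one_add_pow_mul_exp_neg_sq_le hc4 K (norm_nonneg ξ)) hC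
  obtain ⟨C, hC⟩ := hbd
  have hi : Integrable fun ξ => φ ξ * (polyFun b P ξ * gaussWave ((4 * c)⁻¹) 0 ξ) :=
    hφ.mul_bdd (c := C)
      ((continuous_polyFun b P).mul (continuous_gaussWave _ _)).aestronglyMeasurable
      (Filter.Eventually.of_forall hC)
  rw [integral_polar hi]
  refine setIntegral_congr_fun measurableSet_Ioi fun r hr => ?_
  have hr0 : 0 < r := hr
  have h2 : ∀ w : Metric.sphere (0 : V) 1, φ (r • (w : V)) * (polyFun b P (r • (w : V)) *
      gaussWave ((4 * c)⁻¹) 0 (r • (w : V)))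
        = ((r : ℂ) ^ k * Complex.exp (-(r : ℂ) ^ 2 / (4 * c))) *
          (φ (r • (w : V)) * polyFun b P w) := by
    intro w
    have hw : ‖(w : V)‖ = 1 := mem_sphere_zero_iff_norm.mp w.2
    rw [polyFun_smul b hP, gaussWave, norm_smul, hw, Real.norm_of_nonneg hr0.le, inner_zero_left,
      show -(4 * c)⁻¹ * ((r * 1 : ℝ) : ℂ) ^ 2 + Complex.I * ((0 : ℝ) : ℂ)
        = -(r : ℂ) ^ 2 / (4 * c) by
      rw [div_eq_mul_inv]
      simp
      ring]
    ring
  simp only [h2]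
  rw [integral_const_mul, hG r hr0, pow_add, pow_mul]
  ring

theorem continuous_integral_sphere_waveInt {φ : V → ℂ} (hφ : Integrable φ)
    (P : MvPolynomial (Fin d) ℂ) :
    Continuous fun r : ℝ => ∫ w : Metric.sphere (0 : V) 1, waveInt φ (r • (w : V)) * polyFun b P w
        ∂(volume : Measure V).toSphere := by
  have hp : Continuous fun w : Metric.sphere (0 : V) 1 => polyFun b P w :=
    (continuous_polyFun b P).comp continuous_subtype_val
  refine continuous_of_dominated (bound := fun w => (∫ ξ, ‖φ ξ‖) * ‖polyFun b P w‖)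
    (fun r => ?_) (fun r => ?_) ?_ ?_
  · exact (((continuous_waveInt hφ).comp (by fun_prop)).mul hp).aestronglyMeasurable
  · refine Filter.Eventually.of_forall fun w => ?_
    rw [norm_mul]
    gcongr
    exact norm_waveInt_le _ _
  · exact (hp.norm.integrable_of_hasCompactSupport
      (HasCompactSupport.of_compactSpace _)).const_mul _
  · refine Filter.Eventually.of_forall fun w => ?_
    exact ((continuous_waveInt hφ).comp (by fun_prop)).mul continuous_const

theorem integrableOn_integral_sphere_waveInt [Nontrivial V] {φ : V → ℂ} (hφ : Integrable φ) {k : ℕ}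
    {P : MvPolynomial (Fin d) ℂ} (hP : P.IsHomogeneous k)
    {c : ℂ} (hc : 0 < c.re) :
    IntegrableOn (fun r : ℝ => (r : ℂ) ^ (Module.finrank ℝ V - 1 + k) *
      (∫ w : Metric.sphere (0 : V) 1, waveInt φ (r • (w : V)) * polyFun b P w
        ∂(volume : Measure V).toSphere) * Complex.exp (-c * (r : ℂ) ^ 2)) (Set.Ioi 0) := by
  have h1 := integrableOn_polar (integrable_waveInt_mul_gauss b hφ P hc)
  refine h1.congr_fun (fun r hr => ?_) measurableSet_Ioi
  have hr0 : 0 < r := hr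
  have h2 : ∀ w : Metric.sphere (0 : V) 1, waveInt φ (r • (w : V)) * (polyFun b P (r • (w : V)) *
      gaussWave c 0 (r • (w : V))) = ((r : ℂ) ^ k * Complex.exp (-c * (r : ℂ) ^ 2)) *
        (waveInt φ (r • (w : V)) * polyFun b P w) := by
    intro w
    have hw : ‖(w : V)‖ = 1 := mem_sphere_zero_iff_norm.mp w.2
    rw [polyFun_smul b hP, gaussWave, norm_smul, hw]
    simp [← Complex.ofReal_pow]
    ring
  simp only [h2]
  rw [integral_const_mul, pow_add]
  ring

/-- Support theorem: if each spherical harmonic component of degree `k` of `φ` has the form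
`rᵏ G(r)` with `G` even and entire of exponential type `R`, then the Fourier transform of `φ`
vanishes outside the ball of radius `R`. Up to a constant, the component of degree `k` of the
Fourier transform agrees with the Fourier transform of the radial function `G` in dimension
`dim V + 2k`: both have the same integrals against all Gaussians. -/
theorem waveInt_eq_zero_of_harmonic_components (hd : 0 < d) {φ : V → ℂ} (hφ : Integrable φ)
    {R : ℝ} (hR : 0 ≤ R)
    (h : ∀ (k : ℕ) (P : MvPolynomial (Fin d) ℂ), P.IsHomogeneous k → lapPoly P = 0 →
      ∃ G : ℂ → ℂ, Differentiable ℂ G ∧ (∀ z, G (-z) = G z) ∧ ExpType R G ∧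
        ∀ r : ℝ, 0 < r → ∫ w : Metric.sphere (0 : V) 1, φ (r • (w : V)) * polyFun b P w
          ∂(volume : Measure V).toSphere = (r : ℂ) ^ k * G r)
    {x : V} (hx : R < ‖x‖) : waveInt φ x = 0 := by
  have hfin : Module.finrank ℝ V = d := by
    simpa using Module.finrank_eq_card_basis b.toBasis
  have : Nontrivial V := Module.nontrivial_of_finrank_pos (R := ℝ) (by omega)
  have hcomp : ∀ (k : ℕ) (P : MvPolynomial (Fin d) ℂ), P.IsHomogeneous k → lapPoly P = 0 →
      ∀ r : ℝ, R < r → ∫ w : Metric.sphere (0 : V) 1, waveInt φ (r • (w : V)) * polyFun b P w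
        ∂(volume : Measure V).toSphere = 0 := by
    intro k P hP hl r hr
    have hr0 : 0 < r := hR.trans_lt hr
    obtain ⟨G, hGd, hGe, hGt, hG⟩ := h k P hP hl
    -- a Euclidean space of dimension `d + 2k`, carrying the radial function `G(|ξ|)`
    set W := WithLp 2 (ℝ × EuclideanSpace ℝ (Fin (d - 1 + 2 * k)))
    have hW : Module.finrank ℝ W = 1 + (d - 1 + 2 * k) := by
      rw [(WithLp.linearEquiv 2 ℝ _).finrank_eq]
      simp
    have hWn : Nontrivial W := Module.nontrivial_of_finrank_pos (R := ℝ) (by omega)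
    let b' := stdOrthonormalBasis ℝ W
    let ψ : W → ℂ := fun ξ => G ‖ξ‖
    have hψ : Integrable ψ := hGt.integrable_comp_norm hGd.continuous W
    set σ : ℝ := ((volume : Measure W).toSphere).real Set.univ with hσ
    have hσ0 : (σ : ℂ) ≠ 0 := by
      rw [Complex.ofReal_ne_zero, hσ, Measure.real, ENNReal.toReal_ne_zero]
      exact ⟨Measure.measure_univ_ne_zero.mpr (Measure.toSphere_ne_zero _), measure_ne_top _ _⟩
    -- the harmonic component of `waveInt φ`, and the spherical integral of `waveInt ψ` on `W`
    let A : ℝ → ℂ := fun r => ∫ w : Metric.sphere (0 : V) 1, waveInt φ (r • (w : V)) *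
      polyFun b P w ∂(volume : Measure V).toSphere
    let B : ℝ → ℂ := fun r => ∫ w : Metric.sphere (0 : W) 1, waveInt ψ (r • (w : W)) *
      polyFun b' 1 w ∂(volume : Measure W).toSphere
    let κ : ℂ := (Complex.I / (2 * Real.pi)) ^ k * (σ : ℂ)⁻¹
    -- `κ` makes all Gaussian integrals of `D` vanish: `(i/2c)ᵏ (π/c)^{d/2}` and `(π/c)^{d/2 + k}`
    -- differ by the factor `(i/2π)ᵏ`, which does not depend on `c`
    let D : ℝ → ℂ := fun r => (r : ℂ) ^ (d - 1 + k) * A r - κ * ((r : ℂ) ^ (d - 1 + 2 * k) * B r)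
    have hA : Continuous A := continuous_integral_sphere_waveInt b hφ P
    have hB : Continuous B := continuous_integral_sphere_waveInt b' hψ 1
    have h1 : (1 : MvPolynomial (Fin (Module.finrank ℝ W)) ℂ).IsHomogeneous 0 :=
      MvPolynomial.isHomogeneous_one _ _
    have hl1 : lapPoly (1 : MvPolynomial (Fin (Module.finrank ℝ W)) ℂ) = 0 :=
      lapPoly_eq_zero_of_lt h1 two_pos
    have hdim : Module.finrank ℝ W - 1 = d - 1 + 2 * k := by omega
    have hAi : ∀ c : ℂ, 0 < c.re → _ := fun c hc =>
      integral_sphere_waveInt_gauss b hφ hP hl (G := fun r => G r) hG hc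
    have hBi : ∀ c : ℂ, 0 < c.re → _ := fun c hc =>
      integral_sphere_waveInt_gauss b' hψ h1 hl1 (G := fun r => σ * G r) (fun r hr => by
        have : ∀ w : Metric.sphere (0 : W) 1, ψ (r • (w : W)) * polyFun b' 1 w = G r := by
          intro w
          have hw : ‖(w : W)‖ = 1 := mem_sphere_zero_iff_norm.mp w.2
          simp [ψ, polyFun_one, norm_smul, hw, abs_of_pos hr]
        simp [this, hσ]) hc
    have hAint : ∀ c : ℂ, 0 < c.re → _ := fun c hc =>
      integrableOn_integral_sphere_waveInt b hφ hP hc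
    have hBint : ∀ c : ℂ, 0 < c.re → _ := fun c hc =>
      integrableOn_integral_sphere_waveInt b' hψ h1 hc
    simp only [hfin, hdim, add_zero, mul_zero, pow_zero, one_mul] at hAi hBi hAint hBint
    have hDeq : ∀ c : ℂ, (fun r : ℝ => D r * Complex.exp (-c * (r : ℂ) ^ 2))
        = fun r : ℝ => (r : ℂ) ^ (d - 1 + k) * A r * Complex.exp (-c * (r : ℂ) ^ 2)
          - κ * ((r : ℂ) ^ (d - 1 + 2 * k) * B r * Complex.exp (-c * (r : ℂ) ^ 2)) := fun c => by
      ext r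
      simp only [D]
      ring
    have hD0 : D r = 0 := by
      refine eq_zero_of_forall_integral_gauss_eq_zero (D := D) (by fun_prop) ?_ (fun c hc => ?_) hr0
      · rw [hDeq]
        exact (hAint 1 (by simp)).sub ((hBint 1 (by simp)).const_mul κ)
      · have hc0 : c ≠ 0 := fun h0 => by simp [h0] at hc
        have hpi : (Real.pi : ℂ) ≠ 0 := by exact_mod_cast Real.pi_ne_zero
        have hpow : ((Real.pi : ℂ) / c) ^ ((Module.finrank ℝ W : ℂ) / 2)
            = (Real.pi / c) ^ ((d : ℂ) / 2) * (Real.pi / c) ^ k := by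
          have : (Module.finrank ℝ W : ℂ) / 2 = (d : ℂ) / 2 + k := by
            have h2 : Module.finrank ℝ W = d + 2 * k := by omega
            rw [h2]
            push_cast
            ring
          rw [this, Complex.cpow_add _ _ (div_ne_zero hpi hc0), Complex.cpow_natCast]
        rw [hDeq, integral_sub (hAint c hc) ((hBint c hc).const_mul κ), integral_const_mul]
        rw [hAi c hc, hBi c hc, hpow]
        have h3 : ∀ r : ℝ, (r : ℂ) ^ (d - 1 + 2 * k) * (σ * G r) *
            Complex.exp (-(r : ℂ) ^ 2 / (4 * c)) = σ * ((r : ℂ) ^ (d - 1 + 2 * k) * G r *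
            Complex.exp (-(r : ℂ) ^ 2 / (4 * c))) := fun r => by ring
        simp only [h3]
        rw [integral_const_mul]
        have h4 : (Complex.I / (2 * c)) ^ k
            = (Complex.I / (2 * Real.pi)) ^ k * (Real.pi / c) ^ k := by
          rw [← mul_pow]
          congr 1
          field_simp
        simp only [κ]
        rw [h4]
        field_simp
        ring
    -- by the radial theorem in `W`, the second term of `D` vanishes beyond `R`
    have hB0 : B r = 0 := by
      have : ∀ w : Metric.sphere (0 : W) 1, waveInt ψ (r • (w : W)) = 0 := fun w => by
        have hw : ‖(w : W)‖ = 1 := mem_sphere_zero_iff_norm.mp w.2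
        exact waveInt_radial_eq_zero _ hR hGd hGe hGt
          (by rwa [norm_smul, hw, mul_one, Real.norm_of_nonneg hr0.le])
      simp [B, this]
    simp only [D, hB0, mul_zero, sub_zero] at hD0
    exact (mul_eq_zero.mp hD0).resolve_left
      (pow_ne_zero _ (Complex.ofReal_ne_zero.mpr hr0.ne'))
  have hx0 : x ≠ 0 := by
    rintro rfl
    simp at hx
    linarith
  have hn : ‖x‖ ≠ 0 := norm_ne_zero_iff.mpr hx0
  have := eq_zero_of_forall_harmonic_integral_eq_zero b hd
    (fun w : Metric.sphere (0 : V) 1 => waveInt φ (‖x‖ • (w : V)))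
    ((continuous_waveInt hφ).comp (by fun_prop))
    (fun k P hP hl => hcomp k P hP hl ‖x‖ hx)
    ⟨‖x‖⁻¹ • x, by simp [norm_smul, hn]⟩
  simpa [smul_smul, hn] using this

end Support

/-! ### Smooth functions on embedded submanifolds -/

/-- A smooth function on a closed embedded submanifold is the restriction of a global smooth
function: the local extensions are glued by a partition of unity. -/
theorem SmoothOnImage.exists_extension {X V : Type*} [NormedAddCommGroup V] [NormedSpace ℝ V]
    [FiniteDimensional ℝ V] {ι : X → V} (hc : IsClosed (Set.range ι))
    {f : X → ℂ} (hf : SmoothOnImage ι f) : ∃ g : V → ℂ, ContDiff ℝ ∞ g ∧ ∀ a, f a = g (ι a) := by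
  have h := exists_contMDiffMap_forall_mem_convex_of_local (n := ⊤) (modelWithCornersSelf ℝ V)
    (t := fun v : V => {z : ℂ | ∀ a, ι a = v → f a = z}) (F := ℂ) ?_ ?_
  · obtain ⟨g, hg⟩ := h
    exact ⟨g, g.contMDiff.contDiff, fun a => hg (ι a) a rfl⟩
  · intro v z hz w hw s t hs ht hst a ha
    rw [← hz a ha, ← hw a ha, ← add_smul, hst, one_smul]
  · intro v
    by_cases hv : v ∈ Set.range ι
    · obtain ⟨a, rfl⟩ := hv
      obtain ⟨U, hU, haU, g, hg, hfg⟩ := hf a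
      refine ⟨U, hU.mem_nhds haU, g, hg.contDiffOn.contMDiffOn, fun y hy b hb => ?_⟩
      rw [hfg b (by rwa [hb]), hb]
    · exact ⟨(Set.range ι)ᶜ, hc.isOpen_compl.mem_nhds hv, 0, contMDiffOn_const,
        fun y hy b hb => absurd ⟨b, hb⟩ hy⟩

/-- To be smooth at `ι a` it suffices to have an extension that is smooth on a neighbourhood. -/
theorem exists_contDiff_of_contDiffOn {X V : Type*} [NormedAddCommGroup V] [NormedSpace ℝ V]
    [FiniteDimensional ℝ V] {ι : X → V} {f : X → ℂ} {a : X} {W : Set V} (hW : IsOpen W)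
    (ha : ι a ∈ W) {g : V → ℂ} (hg : ContDiffOn ℝ ∞ g W) (h : ∀ b, ι b ∈ W → f b = g (ι b)) :
    ∃ U : Set V, IsOpen U ∧ ι a ∈ U ∧
      ∃ g : V → ℂ, ContDiff ℝ ∞ g ∧ ∀ b : X, ι b ∈ U → f b = g (ι b) := by
  obtain ⟨ε, hε, hball⟩ := Metric.isOpen_iff.mp hW (ι a) ha
  let χ : ContDiffBump (ι a) := ⟨ε / 4, ε / 2, by positivity, by linarith⟩
  refine ⟨Metric.ball (ι a) (ε / 4), Metric.isOpen_ball, Metric.mem_ball_self (by positivity),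
    fun v => (χ v : ℂ) * g v, ?_, fun b hb => ?_⟩
  · rw [contDiff_iff_contDiffAt]
    intro v
    by_cases hv : v ∈ Metric.ball (ι a) ε
    · have h1 : ContDiffAt ℝ ∞ g v := hg.contDiffAt (hW.mem_nhds (hball hv))
      exact (Complex.ofRealCLM.contDiff.contDiffAt.comp v χ.contDiff.contDiffAt).mul h1
    · have h1 : (fun v => (χ v : ℂ) * g v) =ᶠ[nhds v] fun _ => 0 := by
        have h2 : (Metric.closedBall (ι a) (ε / 2))ᶜ ∈ nhds v := by
          refine Metric.isClosed_closedBall.isOpen_compl.mem_nhds fun h3 => hv ?_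
          exact Metric.closedBall_subset_ball (by linarith) h3
        filter_upwards [h2] with w hw
        rw [χ.zero_of_le_dist (le_of_lt (by simpa using hw))]
        simp
      exact contDiffAt_const.congr_of_eventuallyEq h1
  · rw [h b (hball (Metric.ball_subset_ball (by linarith) hb))]
    show g (ι b) = (χ (ι b) : ℂ) * g (ι b)
    rw [χ.one_of_mem_closedBall (Metric.ball_subset_closedBall hb)]
    simp

/-! ### The Grassmannian as a submanifold of the space of endomorphisms -/

/-- The Euclidean space `ℝⁿ`. -/
abbrev Eu (n : ℕ) : Type := EuclideanSpace ℝ (Fin n)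

/-- The Banach algebra of endomorphisms of `ℝⁿ`. -/
abbrev OpEu (n : ℕ) : Type := Eu n →L[ℝ] Eu n

/-- Taking adjoints, as a real linear map. -/
def starOp (n : ℕ) : OpEu n →L[ℝ] OpEu n :=
  LinearMap.toContinuousLinearMap
    { toFun := fun A => star A
      map_add' := fun A B => star_add A B
      map_smul' := fun c A => by rw [star_smul]; rfl }

theorem continuous_star_op (n : ℕ) : Continuous fun A : OpEu n => star A := (starOp n).continuous

/-- The orthogonal projections of rank `p`. -/
def grassmann (p n : ℕ) : Set (OpEu n) :=
  {A | ∃ s : Submodule ℝ (Eu n), Module.finrank ℝ s = p ∧ s.starProjection = A}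

theorem isClosed_grassmann (p n : ℕ) : IsClosed (grassmann p n) := by
  have h : grassmann p n = {A : OpEu n | A * A = A ∧ star A = A ∧
      LinearMap.trace ℝ (Eu n) (A : Eu n →ₗ[ℝ] Eu n) = p} := by
    ext A
    constructor
    · rintro ⟨s, hs, rfl⟩
      have h1 : IsStarProjection s.starProjection :=
        isStarProjection_starProjection
      refine ⟨h1.isIdempotentElem, h1.isSelfAdjoint, ?_⟩
      rw [← hs]
      refine LinearMap.IsProj.trace (p := s) ⟨fun x => ?_, fun x hx => ?_⟩
      · exact Submodule.starProjection_apply_mem s x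
      · exact Submodule.starProjection_eq_self_iff.mpr hx
    · rintro ⟨h1, h2, h3⟩
      obtain ⟨s, hs, rfl⟩ := isStarProjection_iff_eq_starProjection.mp
        (⟨h1, h2⟩ : IsStarProjection A)
      refine ⟨s, ?_, rfl⟩
      have : LinearMap.trace ℝ (Eu n) (s.starProjection : Eu n →ₗ[ℝ] Eu n)
          = (Module.finrank ℝ s : ℝ) := by
        refine LinearMap.IsProj.trace (p := s) ⟨fun x => ?_, fun x hx => ?_⟩
        · exact Submodule.starProjection_apply_mem s x
        · exact Submodule.starProjection_eq_self_iff.mpr hx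
      rw [this] at h3
      exact_mod_cast h3
  rw [h]
  have htr : Continuous fun A : OpEu n => LinearMap.trace ℝ (Eu n) (A : Eu n →ₗ[ℝ] Eu n) :=
    LinearMap.continuous_of_finiteDimensional
      ((LinearMap.trace ℝ (Eu n)).comp (ContinuousLinearMap.coeLM ℝ))
  exact (isClosed_eq (by fun_prop) (by fun_prop)).inter
    ((isClosed_eq (continuous_star_op n) continuous_id).inter (isClosed_eq htr continuous_const))

theorem norm_le_one_of_mem_grassmann {p n : ℕ} {A : OpEu n} (hA : A ∈ grassmann p n) :
    ‖A‖ ≤ 1 := by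
  obtain ⟨s, _, rfl⟩ := hA
  exact s.starProjection_norm_le

theorem isClosed_grassmann_pairs (p n : ℕ) :
    IsClosed {q : OpEu n × Eu n | q.1 ∈ grassmann p n ∧ q.1 q.2 = 0} :=
  ((isClosed_grassmann p n).preimage continuous_fst).inter
    (isClosed_eq (by fun_prop) continuous_const)

theorem AffGr.isClosed_range_embed (p n : ℕ) :
    IsClosed (Set.range (AffGr.embed (p := p) (n := n))) := by
  convert! isClosed_grassmann_pairs p n using 1
  ext ⟨A, x⟩
  constructor
  · rintro ⟨l, hl⟩
    have h1 := congrArg Prod.fst hl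
    have h2 := congrArg Prod.snd hl
    simp only [AffGr.embed] at h1 h2
    refine ⟨⟨l.dir, l.finrank_dir, h1⟩, ?_⟩
    simp only [← h1, ← h2]
    exact (Submodule.starProjection_apply_eq_zero_iff _).mpr l.foot_mem
  · rintro ⟨⟨s, hs, rfl⟩, hx⟩
    exact ⟨⟨s, hs, x, (Submodule.starProjection_apply_eq_zero_iff _).mp hx⟩, rfl⟩

/-- The image of the flag manifold in `End(ℝⁿ) × ℝⁿ`. -/
def flagSet (p n : ℕ) : Set (OpEu n × Eu n) :=
  {q | (q.1 ∈ grassmann p n ∧ q.1 q.2 = 0) ∧ ‖q.2‖ = 1}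

theorem isCompact_flagSet (p n : ℕ) : IsCompact (flagSet p n) := by
  refine ((isCompact_closedBall (0 : OpEu n) 1).prod
    (isCompact_closedBall (0 : Eu n) 1)).of_isClosed_subset ?_ ?_
  · exact (isClosed_grassmann_pairs p n).inter (isClosed_eq (by fun_prop) continuous_const)
  · rintro ⟨A, w⟩ ⟨⟨hA, _⟩, hw⟩
    exact ⟨by simpa using norm_le_one_of_mem_grassmann hA, by simpa using hw.le⟩

theorem FlagMfd.mem_flagSet {p n : ℕ} (a : FlagMfd p n) :
    (a.dir.starProjection, a.vec) ∈ flagSet p n :=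
  ⟨⟨⟨a.dir, a.finrank_dir, rfl⟩, (Submodule.starProjection_apply_eq_zero_iff _).mpr a.vec_mem⟩,
    a.norm_vec⟩

theorem FlagMfd.isClosed_range_embed (p n : ℕ) :
    IsClosed (Set.range (FlagMfd.embed (p := p) (n := n))) := by
  have h : Set.range (FlagMfd.embed (p := p) (n := n))
      = (fun q : OpEu n × Eu n × ℝ => (q.1, q.2.1)) ⁻¹' flagSet p n := by
    ext ⟨A, w, r⟩
    constructor
    · rintro ⟨⟨a, r'⟩, ha⟩
      have h1 := congrArg Prod.fst ha
      have h2 := congrArg (fun q => q.2.1) ha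
      simp only [FlagMfd.embed] at h1 h2
      simpa only [Set.mem_preimage, ← h1, ← h2] using a.mem_flagSet
    · rintro ⟨⟨⟨s, hs, rfl⟩, hx⟩, hw⟩
      exact ⟨(⟨s, hs, w, hw, (Submodule.starProjection_apply_eq_zero_iff _).mp hx⟩, r), rfl⟩
  rw [h]
  exact (isCompact_flagSet p n).isClosed.preimage (by fun_prop)

theorem AffGr.IsSmooth.exists_extension {p n : ℕ} {f : AffGr p n → ℂ} (hf : AffGr.IsSmooth f) :
    ∃ g : OpEu n × Eu n → ℂ, ContDiff ℝ ∞ g ∧ ∀ l, f l = g l.embed :=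
  SmoothOnImage.exists_extension (AffGr.isClosed_range_embed p n) hf

theorem FlagMfd.IsSmooth.exists_extension {p n : ℕ} {F : FlagMfd p n × ℝ → ℂ}
    (hF : FlagMfd.IsSmooth F) :
    ∃ g : OpEu n × Eu n × ℝ → ℂ, ContDiff ℝ ∞ g ∧ ∀ a, F a = g (FlagMfd.embed a) :=
  SmoothOnImage.exists_extension (FlagMfd.isClosed_range_embed p n) hF

theorem starProjection_map_eq {n : ℕ} (u : Eu n ≃ₗᵢ[ℝ] Eu n) (s : Submodule ℝ (Eu n)) :
    (s.map (u.toLinearEquiv : Eu n →ₗ[ℝ] Eu n)).starProjection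
      = (u : Eu n →L[ℝ] Eu n) * s.starProjection * (u.symm : Eu n →L[ℝ] Eu n) := by
  ext1 x
  exact Submodule.starProjection_map_apply u s x

/-- Rotations identify the orthogonal complements of `σ` and `u σ`, with their Lebesgue measures. -/
theorem integral_orthogonal_map {n : ℕ} (u : Eu n ≃ₗᵢ[ℝ] Eu n) (s : Submodule ℝ (Eu n))
    (g : Eu n → ℂ) :
    ∫ x : (s.map (u.toLinearEquiv : Eu n →ₗ[ℝ] Eu n))ᗮ, g x = ∫ x : sᗮ, g (u x) := by
  have h := Submodule.map_orthogonal_equiv s u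
  let v : sᗮ ≃ₗᵢ[ℝ] ((s.map (u.toLinearEquiv : Eu n →ₗ[ℝ] Eu n))ᗮ : Submodule ℝ (Eu n)) :=
    (u.submoduleMap sᗮ).trans (LinearIsometryEquiv.ofEq _ _ h)
  rw [← v.measurePreserving.integral_comp v.toMeasurableEquiv.measurableEmbedding]
  rfl

/-! ### Smooth local sections of `O(n) → Gr(p, n)` -/

theorem reflection_mul_self {R : Type*} [Ring R] {P : R} (hP : P * P = P) :
    (P + P - 1) * (P + P - 1) = 1 := by
  simp only [mul_add, add_mul, mul_sub, sub_mul, mul_one, one_mul, hP]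
  abel

theorem commute_of_commute_reflection {R : Type*} [Ring R] [Algebra ℝ R] {P S : R}
    (h : (P + P - 1) * S = S * (P + P - 1)) : P * S = S * P := by
  have h1 : P * S + P * S = S * P + S * P := by
    simpa only [mul_add, add_mul, mul_sub, sub_mul, mul_one, one_mul, sub_left_inj] using h
  rw [← two_smul ℝ, ← two_smul ℝ (S * P)] at h1
  have h2 := congrArg (fun T : R => (2⁻¹ : ℝ) • T) h1
  simpa [smul_smul] using h2

/-- If `A` and `P` are projections, then `N = M* M` with `M = A P + (1 - A) (1 - P)` is invariant
under conjugation by the reflection `2 P - 1`. -/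
theorem reflection_mul_star_mul_self {R : Type*} [Ring R] [StarRing R] {A P : R} (hA : A * A = A)
    (hP : P * P = P) (hAs : star A = A) (hPs : star P = P) :
    (P + P - 1) * (star (A * P + (1 - A) * (1 - P)) * (A * P + (1 - A) * (1 - P))) * (P + P - 1)
      = star (A * P + (1 - A) * (1 - P)) * (A * P + (1 - A) * (1 - P)) := by
  have e1 : (A * P + (1 - A) * (1 - P)) * (P + P - 1)
      = (A + A - 1) * (A * P + (1 - A) * (1 - P)) := by
    have hA' : ∀ B, A * (A * B) = A * B := fun B => by rw [← mul_assoc, hA]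
    simp only [mul_add, add_mul, mul_sub, sub_mul, mul_one, one_mul, mul_assoc, hP, hA', hA]
    abel
  have e2 : star (P + P - 1) = P + P - 1 := by rw [star_sub, star_add, hPs, star_one]
  have e3 : star (A + A - 1) = A + A - 1 := by rw [star_sub, star_add, hAs, star_one]
  have e4 : (P + P - 1) * star (A * P + (1 - A) * (1 - P))
      = star (A * P + (1 - A) * (1 - P)) * (A + A - 1) := by
    have := congrArg star e1
    rwa [star_mul, e2, star_mul, e3] at this
  rw [← mul_assoc, e4, mul_assoc, mul_assoc, e1, ← mul_assoc (A + A - 1), reflection_mul_self hA,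
    one_mul]

/-- The inverse of `y ↦ y²` near `1`, where its derivative is multiplication by `2`. The last
clause, that `s` is also a left inverse, is the uniqueness of the square root close to `1`. -/
theorem exists_analytic_sqrt (n : ℕ) :
    ∃ s : OpEu n → OpEu n, AnalyticAt ℝ s 1 ∧ s 1 = 1 ∧ (∀ᶠ N in nhds 1, s N * s N = N) ∧
      ∀ᶠ y in nhds (1 : OpEu n), s (y * y) = y := by
  have hf : ContDiffAt ℝ ω (fun y : OpEu n => y * y) 1 := contDiffAt_id.mul contDiffAt_id
  let e : OpEu n ≃L[ℝ] OpEu n := ContinuousLinearEquiv.smulLeft (Units.mk0 (2 : ℝ) two_ne_zero)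
  have hf' : HasFDerivAt (fun y : OpEu n => y * y) (e : OpEu n →L[ℝ] OpEu n) 1 := by
    refine ((hasFDerivAt_id (𝕜 := ℝ) (1 : OpEu n)).mul'
      (hasFDerivAt_id (1 : OpEu n))).congr_fderiv (ContinuousLinearMap.ext fun y => ?_)
    have h : (1 : OpEu n) * y + y * (1 : OpEu n) = (2 : ℝ) • y := by
      rw [one_mul, mul_one]; exact (two_smul ℝ y).symm
    exact h
  have hn : (ω : WithTop ℕ∞) ≠ 0 := by simp
  have hs := hf.hasStrictFDerivAt' hf' hn
  have h1 : (1 : OpEu n) * 1 = 1 := one_mul 1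
  refine ⟨hf.localInverse hf' hn, ?_, ?_, ?_, hs.eventually_left_inverse⟩
  · have := (hf.to_localInverse hf' hn).analyticAt
    rwa [h1] at this
  · have := hf.localInverse_apply_image hf' hn
    rwa [h1] at this
  · have := hs.eventually_right_inverse
    rwa [h1] at this

theorem analyticAt_star {n : ℕ} (A : OpEu n) : AnalyticAt ℝ (fun A : OpEu n => star A) A :=
  (starOp n).analyticAt A

/-- The map `O(n) → Gr(p, n)` has smooth local sections. Near `A = P₀`, the projection to `σ₀`,
the operator `M = A P₀ + (1 - A) (1 - P₀)` is invertible, and if `A` is the projection to `σ` then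
`M` maps `σ₀` to `σ`; the section is the orthogonal part of the polar decomposition of `M`. -/
theorem exists_local_section {n : ℕ} (s₀ : Submodule ℝ (Eu n)) :
    ∃ (U : OpEu n → OpEu n) (W : Set (OpEu n)), IsOpen W ∧ s₀.starProjection ∈ W ∧
      ContDiffOn ℝ ∞ U W ∧ ∃ hU : ∀ A ∈ W, U A ∈ unitary (OpEu n),
        ∀ (s : Submodule ℝ (Eu n)) (hs : s.starProjection ∈ W),
          Module.finrank ℝ s = Module.finrank ℝ s₀ →
          s₀.map ((Unitary.linearIsometryEquiv ⟨_, hU _ hs⟩).toLinearEquiv : Eu n →ₗ[ℝ] Eu n)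
            = s := by
  obtain ⟨r, hr, hr1, hrr, hru⟩ := exists_analytic_sqrt n
  set P := s₀.starProjection with hP
  have hPP : P * P = P := s₀.isIdempotentElem_starProjection
  have hPs : star P = P := isSelfAdjoint_starProjection s₀
  -- polar decomposition `M = U S` with `S = √(M* M)`
  let M : OpEu n → OpEu n := fun A => A * P + (1 - A) * (1 - P)
  let N : OpEu n → OpEu n := fun A => star (M A) * M A
  let S : OpEu n → OpEu n := fun A => r (N A)
  have hMP : M P = 1 := by simp only [M, mul_sub, sub_mul, hPP]; noncomm_ring
  have hNP : N P = 1 := by simp only [N, hMP, star_one, mul_one]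
  have hSP : S P = 1 := by simp only [S, hNP, hr1]
  have hMa : AnalyticAt ℝ M P := by fun_prop
  have hNa : AnalyticAt ℝ N P := ((analyticAt_star _).fun_comp hMa).mul hMa
  have hSa : AnalyticAt ℝ S P := by
    refine AnalyticAt.fun_comp (g := r) (f := N) ?_ hNa
    rwa [hNP]
  have hUa : AnalyticAt ℝ (fun A => M A * Ring.inverse (S A)) P := by
    refine hMa.mul (AnalyticAt.fun_comp (g := Ring.inverse) ?_ hSa)
    rw [hSP]
    exact analyticAt_inverse (1 : (OpEu n)ˣ)
  let ρ : OpEu n := P + P - 1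
  have hρ : ρ * ρ = 1 := reflection_mul_self hPP
  have hev1 : ∀ᶠ A in nhds P, S A * S A = N A :=
    hNa.continuousAt.eventually (by rw [hNP]; exact hrr)
  have hev2 : ∀ᶠ A in nhds P, r (star (S A) * star (S A)) = star (S A) := by
    have h1 : ContinuousAt (fun A => star (S A)) P :=
      (continuous_star_op n).continuousAt.comp hSa.continuousAt
    refine h1.eventually (p := fun y => r (y * y) = y) ?_
    simp only [hSP, star_one]
    exact hru
  have hev3 : ∀ᶠ A in nhds P, r (ρ * S A * ρ * (ρ * S A * ρ)) = ρ * S A * ρ := by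
    have h1 : ContinuousAt (fun A => ρ * S A * ρ) P :=
      (continuousAt_const.mul hSa.continuousAt).mul continuousAt_const
    refine h1.eventually (p := fun y => r (y * y) = y) ?_
    simp only [hSP, mul_one, hρ]
    exact hru
  have hev4 : ∀ᶠ A in nhds P, IsUnit (S A) := by
    refine hSa.continuousAt.eventually (p := fun y => IsUnit y) ?_
    rw [hSP]
    exact Units.isOpen.mem_nhds isUnit_one
  have hev5 : ∀ᶠ A in nhds P, IsUnit (M A) := by
    refine hMa.continuousAt.eventually (p := fun y => IsUnit y) ?_
    rw [hMP]
    exact Units.isOpen.mem_nhds isUnit_one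
  obtain ⟨W, hW, hWo, hPW⟩ := eventually_nhds_iff.mp
    (hev1.and (hev2.and (hev3.and (hev4.and (hev5.and hUa.eventually_analyticAt)))))
  -- `S*` is a square root of `N* = N` close to `1`, hence equal to `S`
  have hself : ∀ A ∈ W, star (S A) = S A := by
    intro A hA
    obtain ⟨h1, h2, -⟩ := hW A hA
    rw [← h2, ← star_mul, h1]
    simp only [N, star_mul, star_star]
    rfl
  have hU : ∀ A ∈ W, M A * Ring.inverse (S A) ∈ unitary (OpEu n) := by
    intro A hA
    obtain ⟨h1, -, -, h4, h5, -⟩ := hW A hA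
    have hi : star (Ring.inverse (S A)) = Ring.inverse (S A) := by
      rw [← Ring.inverse_star, hself A hA]
    have h6 : star (M A * Ring.inverse (S A)) * (M A * Ring.inverse (S A)) = 1 := by
      rw [star_mul, hi, mul_assoc, ← mul_assoc (star (M A))]
      show Ring.inverse (S A) * (N A * Ring.inverse (S A)) = 1
      rw [← h1, mul_assoc, Ring.mul_inverse_cancel _ h4, mul_one, Ring.inverse_mul_cancel _ h4]
    have h7 : IsUnit (M A * Ring.inverse (S A)) := h5.mul h4.ringInverse
    refine ⟨h6, ?_⟩
    obtain ⟨v, hv⟩ := h7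
    rw [← hv] at h6 ⊢
    rw [Units.mul_eq_one_iff_eq_inv.mp h6, Units.mul_inv]
  refine ⟨fun A => M A * Ring.inverse (S A), W, hWo, hPW, fun A hA => ?_, hU, fun s hs hfin => ?_⟩
  · exact ((hW A hA).2.2.2.2.2.contDiffAt).contDiffWithinAt
  · refine Submodule.eq_of_le_of_finrank_eq ?_ ((finrank_map_isometry _ s₀).trans hfin.symm)
    set A := s.starProjection with hA
    have hAA : A * A = A := s.isIdempotentElem_starProjection
    have hAs : star A = A := isSelfAdjoint_starProjection s
    obtain ⟨h1, -, h3, h4, -⟩ := hW A hs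
    have hNρ : ρ * N A * ρ = N A := reflection_mul_star_mul_self hAA hPP hAs hPs
    -- likewise `ρ S ρ` is a square root of `ρ N ρ = N` close to `1`, so `S` commutes with `ρ` and
    -- `P`
    have hSρ : ρ * S A * ρ = S A := by
      rw [← h3]
      have : ρ * S A * ρ * (ρ * S A * ρ) = ρ * (S A * (ρ * ρ) * S A) * ρ := by
        simp only [mul_assoc]
      rw [this, hρ, mul_one, h1, hNρ]
    have hSP' : Commute (S A) P := by
      refine (commute_of_commute_reflection (?_ : ρ * S A = S A * ρ)).symm
      conv_rhs => rw [← hSρ]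
      rw [mul_assoc, hρ, mul_one]
    have hIP : Ring.inverse (S A) * P = P * Ring.inverse (S A) := by
      obtain ⟨v, hv⟩ := h4
      rw [← hv] at hSP' ⊢
      rw [Ring.inverse_unit]
      exact hSP'.units_inv_left
    -- `M P = A P`, hence `U` maps the range of `P` into the range of `A`
    have hUP : A * (M A * Ring.inverse (S A) * P) = M A * Ring.inverse (S A) * P := by
      have e1 : M A * P = A * P := by
        simp only [M, add_mul, mul_assoc, sub_mul, one_mul, hPP, sub_self, mul_zero, add_zero]
      rw [mul_assoc (M A), hIP, ← mul_assoc (M A), e1, ← mul_assoc A, ← mul_assoc A, hAA]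
    rintro _ ⟨x, hx, rfl⟩
    have hx' : P x = x := Submodule.starProjection_eq_self_iff.mpr hx
    refine Submodule.starProjection_eq_self_iff.mp ?_
    have := DFunLike.congr_fun hUP x
    show A ((M A * Ring.inverse (S A)) x) = (M A * Ring.inverse (S A)) x
    simpa only [mul_apply_eq_comp, hx'] using this

/-! ### Integrals depending on a parameter -/

theorem one_add_pow_le_two_pow_mul {x : ℝ} (hx : 0 ≤ x) (N : ℕ) :
    (1 + x) ^ N ≤ 2 ^ N * (1 + x ^ N) := by
  have h2 : (1 + x) ^ N ≤ (2 * max 1 x) ^ N :=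
    pow_le_pow_left₀ (by positivity) (by linarith [le_max_left 1 x, le_max_right 1 x]) N
  rw [mul_pow] at h2
  refine h2.trans (mul_le_mul_of_nonneg_left ?_ (by positivity))
  rcases max_cases 1 x with h | h
  · rw [h.1, one_pow]; linarith [pow_nonneg hx N]
  · rw [h.1]; linarith

section Parameter

variable {V : Type*} [NormedAddCommGroup V] [InnerProductSpace ℝ V] [FiniteDimensional ℝ V]
  [MeasurableSpace V] [BorelSpace V]

theorem integrable_of_eq_zero_of_lt_norm {v : V → ℂ} (hv : Continuous v) {ρ : ℝ}
    (h0 : ∀ y, ρ < ‖y‖ → v y = 0) : Integrable v :=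
  hv.integrable_of_hasCompactSupport
    (HasCompactSupport.of_support_subset_isCompact (isCompact_closedBall (0 : V) ρ) fun y hy => by
      by_contra h
      exact hy (h0 y (by simpa using h)))

/-- Differentiation under the integral sign, for integrands with uniformly bounded support. -/
theorem hasDerivAt_integral_of_contDiff {Ψ : ℝ × V → ℂ} (hΨ : ContDiff ℝ 1 Ψ) {ρ : ℝ}
    (h0 : ∀ t y, ρ < ‖y‖ → Ψ (t, y) = 0) (t₀ : ℝ) :
    HasDerivAt (fun t => ∫ y, Ψ (t, y)) (∫ y, deriv (fun t => Ψ (t, y)) t₀) t₀ := by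
  have hd : ∀ (t : ℝ) (y : V), HasDerivAt (fun t => Ψ (t, y)) (fderiv ℝ Ψ (t, y) (1, 0)) t := by
    intro t y
    have h1 : HasFDerivAt Ψ (fderiv ℝ Ψ (t, y)) (t, y) :=
      (hΨ.differentiable one_ne_zero (t, y)).hasFDerivAt
    exact h1.comp_hasDerivAt t ((hasDerivAt_id t).prodMk (hasDerivAt_const t y))
  have hc : Continuous fun q : ℝ × V => fderiv ℝ Ψ q (1, 0) :=
    (hΨ.continuous_fderiv one_ne_zero).clm_apply continuous_const
  have hz : ∀ t y, ρ < ‖y‖ → fderiv ℝ Ψ (t, y) (1, 0) = 0 := by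
    intro t y hy
    rw [← (hd t y).deriv]
    simp only [h0 _ y hy, deriv_const]
  obtain ⟨C, hC⟩ := ((isCompact_Icc (a := t₀ - 1) (b := t₀ + 1)).prod
    (isCompact_closedBall (0 : V) ρ)).exists_bound_of_continuousOn hc.continuousOn
  have h := hasDerivAt_integral_of_dominated_loc_of_deriv_le (μ := (volume : Measure V))
    (F := fun t y => Ψ (t, y)) (F' := fun t y => fderiv ℝ Ψ (t, y) (1, 0)) (x₀ := t₀)
    (s := Set.Icc (t₀ - 1) (t₀ + 1)) (bound := (Metric.closedBall (0 : V) ρ).indicator fun _ => C)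
    (Icc_mem_nhds (by linarith) (by linarith)) ?_ ?_ ?_ ?_ ?_ ?_
  · simpa only [(hd t₀ _).deriv] using h.2
  · exact Filter.Eventually.of_forall fun t =>
      (hΨ.continuous.comp (by fun_prop)).aestronglyMeasurable
  · exact integrable_of_eq_zero_of_lt_norm (hΨ.continuous.comp (by fun_prop)) (h0 t₀)
  · exact (hc.comp (by fun_prop : Continuous fun y : V => (t₀, y))).aestronglyMeasurable
  · refine Filter.Eventually.of_forall fun y t ht => ?_
    by_cases hy : y ∈ Metric.closedBall (0 : V) ρ
    · rw [Set.indicator_of_mem hy]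
      exact hC (t, y) ⟨ht, hy⟩
    · rw [Set.indicator_of_notMem hy, hz t y (by simpa using hy), norm_zero]
  · exact (integrable_indicator_iff measurableSet_closedBall).mpr
      (integrableOn_const (by exact measure_closedBall_lt_top.ne))
  · exact Filter.Eventually.of_forall fun y t _ => hd t y

/-- Smooth dependence on a parameter, for integrands with uniformly bounded support. -/
theorem contDiffOn_integral_of_support {Q : Type*} [NormedAddCommGroup Q] [NormedSpace ℝ Q]
    {G : Q → V → ℂ} {W : Set Q} (hW : IsOpen W) {ρ : ℝ}
    (h0 : ∀ q ∈ W, ∀ y, ρ < ‖y‖ → G q y = 0)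
    (hG : ContDiffOn ℝ ∞ (fun q : Q × V => G q.1 q.2) (W ×ˢ Set.univ)) :
    ContDiffOn ℝ ∞ (fun q => ∫ y, G q y) W := by
  have h := contDiffOn_convolution_right_with_param_comp (𝕜 := ℝ) (μ := (volume : Measure V))
    (n := ⊤) (ContinuousLinearMap.lsmul ℝ ℝ : ℝ →L[ℝ] ℂ →L[ℝ] ℂ) (s := W) (v := fun _ => (0 : V))
    contDiffOn_const (f := fun _ => (1 : ℝ)) (g := G) (k := Metric.closedBall 0 ρ) hW
    (isCompact_closedBall _ _) (fun q y hq hy => h0 q hq y (by simpa using hy))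
    (locallyIntegrable_const _) hG
  refine h.congr fun q hq => ?_
  simp only [convolution, ContinuousLinearMap.lsmul_apply, one_smul, zero_sub]
  exact (integral_neg_eq_self (fun y => G q y) _).symm

/-- An integral of `b x * E (z * c x)` with `E` entire and `c` bounded is entire in `z`. -/
theorem differentiable_integral_mul_comp {α : Type*} [MeasurableSpace α] {μ : Measure α}
    {E : ℂ → ℂ} (hE : Differentiable ℂ E) {b c : α → ℂ} (hb : Integrable b μ)
    (hc : AEStronglyMeasurable c μ) {K : ℝ} (hK : ∀ x, b x ≠ 0 → ‖c x‖ ≤ K) :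
    Differentiable ℂ fun z : ℂ => ∫ x, b x * E (z * c x) ∂μ := by
  intro z₀
  have hE' : Continuous (deriv E) := (hE.contDiff (n := 1)).continuous_deriv le_rfl
  obtain ⟨C₀, hC₀⟩ := (isCompact_closedBall (0 : ℂ)
    ((‖z₀‖ + 1) * K)).exists_bound_of_continuousOn hE.continuous.continuousOn
  obtain ⟨C, hC⟩ := (isCompact_closedBall (0 : ℂ)
    ((‖z₀‖ + 1) * K)).exists_bound_of_continuousOn hE'.continuousOn
  have hmem : ∀ x, b x ≠ 0 → ∀ z ∈ Metric.ball z₀ 1,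
      z * c x ∈ Metric.closedBall (0 : ℂ) ((‖z₀‖ + 1) * K) := by
    intro x hx z hz
    rw [mem_closedBall_zero_iff, norm_mul]
    refine mul_le_mul ?_ (hK x hx) (norm_nonneg _) (by positivity)
    have h1 : ‖z - z₀‖ < 1 := by simpa [dist_eq_norm] using hz
    linarith [norm_le_norm_add_norm_sub' z z₀]
  refine (hasDerivAt_integral_of_dominated_loc_of_deriv_le (𝕜 := ℂ) (μ := μ)
    (F := fun z x => b x * E (z * c x)) (F' := fun z x => b x * (deriv E (z * c x) * c x))
    (s := Metric.ball z₀ 1) (bound := fun x => ‖b x‖ * (C * K))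
    (Metric.ball_mem_nhds _ one_pos) ?_ ?_ ?_ ?_ ?_ ?_).2.differentiableAt
  · exact Filter.Eventually.of_forall fun z => hb.aestronglyMeasurable.mul
      (hE.continuous.comp_aestronglyMeasurable (hc.const_mul z))
  · refine (hb.norm.mul_const C₀).mono' (hb.aestronglyMeasurable.mul
      (hE.continuous.comp_aestronglyMeasurable (hc.const_mul z₀)))
      (Filter.Eventually.of_forall fun x => ?_)
    by_cases hx : b x = 0
    · simp [hx]
    · rw [norm_mul]
      exact mul_le_mul_of_nonneg_left
        (hC₀ _ (hmem x hx z₀ (Metric.mem_ball_self one_pos))) (norm_nonneg _)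
  · exact hb.aestronglyMeasurable.mul
      ((hE'.comp_aestronglyMeasurable (hc.const_mul z₀)).mul hc)
  · refine Filter.Eventually.of_forall fun x z hz => ?_
    by_cases hx : b x = 0
    · simp [hx]
    · rw [norm_mul, norm_mul]
      refine mul_le_mul_of_nonneg_left (mul_le_mul (hC _ (hmem x hx z hz)) (hK x hx)
        (norm_nonneg _) ((norm_nonneg _).trans (hC _ (hmem x hx z hz)))) (norm_nonneg _)
  · exact hb.norm.mul_const _
  · refine Filter.Eventually.of_forall fun x z _ => ?_
    have h1 : HasDerivAt (fun z => z * c x) (c x) z := by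
      simpa using (hasDerivAt_id z).mul_const (c x)
    exact ((hE (z * c x)).hasDerivAt.comp z h1).const_mul (b x)

/-- The Taylor remainder of the exponential function: `E` is entire in
`exp ζ = ∑ j < k, c j * ζ ^ j + ζ ^ k * E ζ`. -/
theorem exists_exp_eq_sum_add (k : ℕ) : ∃ (c : ℕ → ℂ) (E : ℂ → ℂ), Differentiable ℂ E ∧
    ∀ ζ, Complex.exp ζ = ∑ j ∈ Finset.range k, c j * ζ ^ j + ζ ^ k * E ζ := by
  induction k with
  | zero => exact ⟨0, Complex.exp, Complex.differentiable_exp, fun ζ => by simp⟩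
  | succ k ih =>
    obtain ⟨c, E, hE, h⟩ := ih
    refine ⟨Function.update c k (E 0), dslope E 0, ?_, fun ζ => ?_⟩
    · rw [← differentiableOn_univ]
      exact (Complex.differentiableOn_dslope Filter.univ_mem).mpr hE.differentiableOn
    · rw [h ζ, Finset.sum_range_succ, Function.update_self]
      have h1 : ∑ j ∈ Finset.range k, Function.update c k (E 0) j * ζ ^ j
          = ∑ j ∈ Finset.range k, c j * ζ ^ j :=
        Finset.sum_congr rfl fun j hj => by
          rw [Function.update_of_ne (Finset.mem_range.mp hj).ne]
      have h2 : E ζ = E 0 + ζ * dslope E 0 ζ := by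
        have := sub_smul_dslope E 0 ζ
        rw [sub_zero, smul_eq_mul] at this
        rw [this]; ring
      rw [h1]
      nth_rewrite 1 [h2]
      ring

/-- The surface measure of the unit sphere is invariant under the antipodal map. -/
theorem measurePreserving_neg_sphere : MeasurePreserving (fun w : Metric.sphere (0 : V) 1 => -w)
    (volume : Measure V).toSphere (volume : Measure V).toSphere := by
  have hm : Measurable fun w : Metric.sphere (0 : V) 1 => -w := continuous_neg.measurable
  refine ⟨hm, Measure.ext fun s hs => ?_⟩
  rw [Measure.map_apply hm hs, Measure.toSphere_apply' _ (hm hs), Measure.toSphere_apply' _ hs]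
  congr 1
  rw [← Measure.measure_neg]
  congr 1
  ext x
  simp only [Set.mem_neg, Set.mem_smul, Set.mem_image, Set.mem_preimage]
  constructor
  · rintro ⟨t, ht, _, ⟨w, hw, rfl⟩, h⟩
    exact ⟨t, ht, _, ⟨-w, hw, rfl⟩, by simp [h]⟩
  · rintro ⟨t, ht, _, ⟨w, hw, rfl⟩, h⟩
    exact ⟨t, ht, _, ⟨-w, by simpa using hw, rfl⟩, by simp [h]⟩

/-- The harmonic components of the Fourier transform of a compactly supported function `v`: the
component of degree `k` vanishes to order `k` at `0`, since `h` is orthogonal on the sphere to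
polynomials of lower degree, and has the parity of `k`. -/
theorem exists_entire_harmonic_component [Nontrivial V] {d : ℕ} (b : OrthonormalBasis (Fin d) ℝ V)
    {v : V → ℂ} (hv : Continuous v) {ρ : ℝ} (h0 : ∀ y, ρ < ‖y‖ → v y = 0) {k : ℕ}
    {P : MvPolynomial (Fin d) ℂ} (hP : P.IsHomogeneous k) (hl : lapPoly P = 0) :
    ∃ g : ℂ → ℂ, Differentiable ℂ g ∧ (∀ z, g (-z) = g z) ∧ ∀ z : ℂ, z ≠ 0 → g z = (z ^ k)⁻¹ *
      ∫ w : Metric.sphere (0 : V) 1, (∫ y, v y * Complex.exp (-Complex.I * z *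
        ((⟪(w : V), y⟫_ℝ : ℝ) : ℂ))) * polyFun b P w ∂(volume : Measure V).toSphere := by
  obtain ⟨c, E, hE, hexp⟩ := exists_exp_eq_sum_add k
  let μ : Measure (Metric.sphere (0 : V) 1 × V) := (volume : Measure V).toSphere.prod volume
  let ip : Metric.sphere (0 : V) 1 × V → ℂ := fun q =>
    -Complex.I * ((⟪(q.1 : V), q.2⟫_ℝ : ℝ) : ℂ)
  have hip : Continuous ip := by fun_prop
  have hpc := continuous_polyFun b P
  have hint : ∀ φ : Metric.sphere (0 : V) 1 × V → ℂ, Continuous φ →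
      Integrable (fun q => v q.2 * polyFun b P q.1 * φ q) μ := by
    intro φ hφ
    refine Continuous.integrable_of_hasCompactSupport (by fun_prop) ?_
    refine HasCompactSupport.of_support_subset_isCompact
      (isCompact_univ.prod (isCompact_closedBall (0 : V) ρ)) fun q hq => ⟨trivial, ?_⟩
    by_contra h
    exact hq (by simp [h0 q.2 (by simpa using h)])
  -- subtract the Taylor polynomial of degree `< k` from the exponential and divide by `zᵏ`
  let g : ℂ → ℂ := fun z => ∫ q, v q.2 * polyFun b P q.1 * ip q ^ k * E (z * ip q) ∂μ
  let J : ℂ → ℂ := fun z => ∫ w : Metric.sphere (0 : V) 1, (∫ y, v y * Complex.exp (-Complex.I * z *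
        ((⟪(w : V), y⟫_ℝ : ℝ) : ℂ))) * polyFun b P w ∂(volume : Measure V).toSphere
  have hJ : ∀ z, J z = ∫ q, v q.2 * polyFun b P q.1 * Complex.exp (z * ip q) ∂μ := by
    intro z
    rw [integral_prod _ (hint _ (by fun_prop))]
    refine integral_congr_ae (Filter.Eventually.of_forall fun w => ?_)
    simp only [← integral_mul_const]
    refine integral_congr_ae (Filter.Eventually.of_forall fun y => ?_)
    simp only [ip]
    rw [show z * (-Complex.I * ((⟪(w : V), y⟫_ℝ : ℝ) : ℂ))
      = -Complex.I * z * ((⟪(w : V), y⟫_ℝ : ℝ) : ℂ) by ring]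
    ring
  -- for fixed `y`, `w ↦ ⟨w, y⟩ʲ` is a polynomial of degree `j < k`, so orthogonal to `P`
  have hlow : ∀ j < k, ∫ q, v q.2 * polyFun b P q.1 * ip q ^ j ∂μ = 0 := by
    intro j hj
    rw [integral_prod_symm _ (hint _ (by fun_prop))]
    refine integral_eq_zero_of_ae (Filter.Eventually.of_forall fun y => ?_)
    let Q : MvPolynomial (Fin d) ℂ :=
      (∑ i, MvPolynomial.C ((⟪b i, y⟫_ℝ : ℝ) : ℂ) * MvPolynomial.X i) ^ j
    have hQ : Q.IsHomogeneous j := by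
      have : (∑ i, MvPolynomial.C ((⟪b i, y⟫_ℝ : ℝ) : ℂ) * MvPolynomial.X i :
          MvPolynomial (Fin d) ℂ).IsHomogeneous 1 :=
        MvPolynomial.IsHomogeneous.sum _ _ _ fun i _ => by
          simpa using (MvPolynomial.isHomogeneous_C (Fin d) _).mul
            (MvPolynomial.isHomogeneous_X ℂ i)
      simpa using this.pow j
    have hQe : ∀ x, polyFun b Q x = ((⟪x, y⟫_ℝ : ℝ) : ℂ) ^ j := by
      intro x
      have h1 : polyFun b (∑ i, MvPolynomial.C ((⟪b i, y⟫_ℝ : ℝ) : ℂ) * MvPolynomial.X i) x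
          = ((⟪x, y⟫_ℝ : ℝ) : ℂ) := by
        rw [← b.sum_inner_mul_inner x y]
        simp only [polyFun_sum, polyFun_mul, polyFun_C, polyFun_X]
        push_cast
        exact Finset.sum_congr rfl fun i _ => by rw [real_inner_comm x (b i), mul_comm]
      rw [← h1]
      simp only [Q, polyFun, map_pow]
    have h2 := integral_sphere_harmonic_mul_eq_zero b hP hl hQ hj
    have h3 : ∀ w : Metric.sphere (0 : V) 1, v y * polyFun b P w * ip (w, y) ^ j
        = v y * (-Complex.I) ^ j * (polyFun b P w * polyFun b Q w) := by
      intro w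
      rw [hQe, mul_pow]; ring
    simp only [h3, integral_const_mul, h2, mul_zero, Pi.zero_apply]
  have hgJ : ∀ z, J z = z ^ k * g z := by
    intro z
    rw [hJ]
    have h1 : ∀ q, v q.2 * polyFun b P q.1 * Complex.exp (z * ip q)
        = ∑ j ∈ Finset.range k, c j * z ^ j * (v q.2 * polyFun b P q.1 * ip q ^ j)
          + z ^ k * (v q.2 * polyFun b P q.1 * ip q ^ k * E (z * ip q)) := by
      intro q
      rw [hexp, mul_add, Finset.mul_sum]
      congr 1
      · exact Finset.sum_congr rfl fun j _ => by rw [mul_pow]; ring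
      · rw [mul_pow]; ring
    simp only [h1]
    have hEc := hE.continuous
    have h2 : Integrable (fun q => v q.2 * polyFun b P q.1 * ip q ^ k * E (z * ip q)) μ := by
      simpa only [mul_assoc] using hint (fun q => ip q ^ k * E (z * ip q)) (by fun_prop)
    rw [integral_add (integrable_finsetSum _ fun j _ => (hint _ (by fun_prop)).const_mul _)
      (h2.const_mul _), integral_finsetSum _ fun j _ => (hint _ (by fun_prop)).const_mul _,
      integral_const_mul]
    rw [Finset.sum_eq_zero, zero_add]
    intro j hj
    rw [integral_const_mul, hlow j (Finset.mem_range.mp hj), mul_zero]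
  -- parity: substitute `-w` for `w`
  have hJneg : ∀ z, J (-z) = (-1) ^ k * J z := by
    intro z
    simp only [J]
    rw [← (measurePreserving_neg_sphere (V := V)).integral_comp
      (Homeomorph.neg (Metric.sphere (0 : V) 1)).measurableEmbedding, ← integral_const_mul]
    refine integral_congr_ae (Filter.Eventually.of_forall fun w => ?_)
    have h1 : polyFun b P (-(w : V)) = (-1) ^ k * polyFun b P w := by
      have := polyFun_smul b hP (-1) (w : V)
      simpa using this
    have h2 : ((-w : Metric.sphere (0 : V) 1) : V) = -(w : V) := rfl
    simp only [h2, h1, inner_neg_left, Complex.ofReal_neg, mul_neg, neg_mul, neg_neg]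
    ring
  refine ⟨g, ?_, fun z => ?_, fun z hz => ?_⟩
  · refine differentiable_integral_mul_comp (K := ρ) hE (hint _ (hip.pow k))
      hip.aestronglyMeasurable fun q hq => ?_
    have hq2 : ‖q.2‖ ≤ ρ := by
      by_contra h
      exact hq (by simp [h0 q.2 (by simpa using h)])
    have := abs_real_inner_le_norm (q.1 : V) q.2
    rw [norm_eq_of_mem_sphere, one_mul] at this
    simpa [ip] using this.trans hq2
  · by_cases hz : z = 0
    · rw [hz, neg_zero]
    · have h1 := hJneg z
      rw [hgJ, hgJ, neg_pow, ← mul_assoc, mul_assoc] at h1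
      have h2 : (-1 : ℂ) ^ k * z ^ k ≠ 0 :=
        mul_ne_zero (pow_ne_zero _ (by simp)) (pow_ne_zero _ hz)
      refine mul_left_cancel₀ h2 ?_
      rw [← mul_assoc] at h1
      exact h1
  · show g z = (z ^ k)⁻¹ * J z
    rw [hgJ, inv_mul_cancel_left₀ (pow_ne_zero _ hz)]

end Parameter

/-! ### Infinitesimal rotations -/

section NormedAlgebra

variable {𝔸 : Type*} [NormedRing 𝔸] [NormedAlgebra ℝ 𝔸] [CompleteSpace 𝔸]

theorem exp_smul_mul_exp_neg_smul (X : 𝔸) (t : ℝ) :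
    NormedSpace.exp (t • X) * NormedSpace.exp ((-t) • X) = 1 := by
  let _ : NormedAlgebra ℚ 𝔸 := NormedAlgebra.restrictScalars ℚ ℝ _
  rw [← NormedSpace.exp_add_of_commute ((Commute.refl X).smul_left t |>.smul_right (-t)),
    ← add_smul, add_neg_cancel, zero_smul, NormedSpace.exp_zero]

theorem contDiff_exp_smul (X : 𝔸) : ContDiff ℝ ∞ fun t : ℝ => NormedSpace.exp (t • X) := by
  have h : ContDiff ℝ ∞ (NormedSpace.exp : 𝔸 → 𝔸) :=
    contDiff_iff_contDiffAt.mpr fun A => (NormedSpace.exp_analytic (𝕂 := ℝ) A).contDiffAt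
  exact h.comp (contDiff_id.smul contDiff_const)

theorem hasDerivAt_exp_smul_zero (X : 𝔸) :
    HasDerivAt (fun t : ℝ => NormedSpace.exp (t • X)) X 0 := by
  simpa using hasDerivAt_exp_smul_const (𝕂 := ℝ) X (0 : ℝ)

theorem hasDerivAt_exp_neg_smul_zero (X : 𝔸) :
    HasDerivAt (fun t : ℝ => NormedSpace.exp ((-t) • X)) (-X) 0 := by
  simpa [neg_smul] using hasDerivAt_exp_smul_zero (-X)

/-- The derivative at `t = 0` of the conjugates of `A` under `exp (-t X)`. -/
theorem hasDerivAt_conj_exp (X A : 𝔸) :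
    HasDerivAt (fun t : ℝ => NormedSpace.exp ((-t) • X) * A * NormedSpace.exp (t • X))
      (-(X * A - A * X)) 0 := by
  have h := ((hasDerivAt_exp_neg_smul_zero X).mul_const A).mul (hasDerivAt_exp_smul_zero X)
  convert! h using 1
  simp only [neg_zero, zero_smul, NormedSpace.exp_zero, one_mul, mul_one, neg_mul]
  abel

end NormedAlgebra

section Rotation

variable {p n : ℕ}

theorem expRot_apply (X : SoAlg n) (t : ℝ) (x : Eu n) :
    expRot X t x = NormedSpace.exp (t • (X : OpEu n)) x := rfl

theorem expRot_symm_apply (X : SoAlg n) (t : ℝ) (x : Eu n) :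
    (expRot X t).symm x = NormedSpace.exp ((-t) • (X : OpEu n)) x := by
  rw [LinearIsometryEquiv.symm_apply_eq, expRot_apply]
  exact (DFunLike.congr_fun (exp_smul_mul_exp_neg_smul (X : OpEu n) t) x).symm

theorem starProjection_expRot (X : SoAlg n) (t : ℝ) (s : Submodule ℝ (Eu n)) :
    (s.map ((expRot X t).toLinearEquiv : Eu n →ₗ[ℝ] Eu n)).starProjection
      = NormedSpace.exp (t • (X : OpEu n)) * s.starProjection
        * NormedSpace.exp ((-t) • (X : OpEu n)) := by
  rw [starProjection_map_eq]
  ext1 x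
  simp only [mul_apply_eq_comp]
  exact congrArg _ (congrArg _ (expRot_symm_apply X t x))

theorem hasDerivAt_exp_neg_apply (X : OpEu n) (x : Eu n) :
    HasDerivAt (fun t : ℝ => NormedSpace.exp ((-t) • X) x) (-(X x)) 0 := by
  have h := (hasDerivAt_exp_neg_smul_zero X).clm_apply (hasDerivAt_const (0 : ℝ) x)
  rwa [map_zero, add_zero] at h

theorem contDiff_ofReal_inner {E : Type*} [NormedAddCommGroup E] [NormedSpace ℝ E] {f g : E → Eu n}
    (hf : ContDiff ℝ ∞ f) (hg : ContDiff ℝ ∞ g) :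
    ContDiff ℝ ∞ fun x => ((⟪f x, g x⟫_ℝ : ℝ) : ℂ) :=
  Complex.ofRealCLM.contDiff.comp (hf.inner ℝ hg)

theorem contDiff_coe_snd {E : Type*} [NormedAddCommGroup E] [NormedSpace ℝ E]
    (s : Submodule ℝ (Eu n)) : ContDiff ℝ ∞ fun q : E × s => (q.2 : Eu n) :=
  (Submodule.subtypeL s).contDiff.comp contDiff_snd

end Rotation

/-! ### Superpositions of plane waves on the flag manifold -/

section Wave

variable {p n : ℕ}

/-- The superposition `∫ u(σ, ω, y) e^{-iz⟨ω, y⟩} dy` over `y ∈ σᗮ` of plane waves with amplitude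
`u`, where `σ` enters `u` through its orthogonal projection. -/
def flagWave (u : OpEu n × Eu n × Eu n → ℂ) (a : FlagMfd p n) (z : ℂ) : ℂ :=
  ∫ y : a.dirᗮ, u (a.dir.starProjection, a.vec, y) *
    Complex.exp (-Complex.I * z * ((⟪a.vec, (y : Eu n)⟫_ℝ : ℝ) : ℂ))

/-- Smooth amplitudes of bounded support in the last variable. -/
def IsAmplitude (u : OpEu n × Eu n × Eu n → ℂ) : Prop :=
  ContDiff ℝ ∞ u ∧ ∃ ρ : ℝ, ∀ A w y, ρ < ‖y‖ → u (A, w, y) = 0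

/-- The amplitude `u` vanishes at `(σ, ω, y)` for all flags `(σ, ω)` and all `y ∈ σᗮ` of norm
`> R`. -/
def AmplitudeSupp (p : ℕ) (R : ℝ) (u : OpEu n × Eu n × Eu n → ℂ) : Prop :=
  ∀ (a : FlagMfd p n) (y : Eu n), y ∈ a.dirᗮ → R < ‖y‖ →
    u (a.dir.starProjection, a.vec, y) = 0

theorem IsAmplitude.exists_supp {u : OpEu n × Eu n × Eu n → ℂ} (hu : IsAmplitude u) (p : ℕ) :
    ∃ ρ, AmplitudeSupp p ρ u := by
  obtain ⟨-, ρ, h⟩ := hu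
  exact ⟨ρ, fun a y _ hy => h _ _ _ hy⟩

theorem IsAmplitude.fderiv_apply {u : OpEu n × Eu n × Eu n → ℂ} (hu : IsAmplitude u)
    {v : OpEu n × Eu n × Eu n → OpEu n × Eu n × Eu n} (hv : ContDiff ℝ ∞ v) :
    IsAmplitude fun q => fderiv ℝ u q (v q) := by
  obtain ⟨hc, ρ, h0⟩ := hu
  refine ⟨(hc.fderiv_right (m := ∞) (by simp)).clm_apply hv, ρ, fun A w y hy => ?_⟩
  have h1 : u =ᶠ[nhds (A, w, y)] fun _ => 0 := by
    have h2 : {q : OpEu n × Eu n × Eu n | ρ < ‖q.2.2‖} ∈ nhds (A, w, y) :=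
      (isOpen_lt continuous_const (by fun_prop)).mem_nhds hy
    filter_upwards [h2] with q hq
    exact h0 _ _ _ hq
  show fderiv ℝ u (A, w, y) _ = 0
  rw [h1.fderiv_eq, fderiv_fun_const]
  rfl

theorem IsAmplitude.mul {u φ : OpEu n × Eu n × Eu n → ℂ} (hu : IsAmplitude u)
    (hφ : ContDiff ℝ ∞ φ) : IsAmplitude fun q => φ q * u q := by
  obtain ⟨hc, ρ, h0⟩ := hu
  exact ⟨hφ.mul hc, ρ, fun A w y hy => by
    show φ _ * u (A, w, y) = 0
    rw [h0 A w y hy, mul_zero]⟩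

theorem IsAmplitude.integrable {u : OpEu n × Eu n × Eu n → ℂ} (hu : IsAmplitude u)
    (A : OpEu n) (w : Eu n) (s : Submodule ℝ (Eu n)) {φ : s → ℂ} (hφ : Continuous φ) :
    Integrable fun y : s => u (A, w, y) * φ y := by
  obtain ⟨hc, ρ, h0⟩ := hu
  have hc' := hc.continuous
  refine integrable_of_eq_zero_of_lt_norm (ρ := ρ) (by fun_prop) fun y hy => ?_
  rw [h0 A w y (by simpa using hy), zero_mul]

/-- The amplitude of the derivative of a superposition of waves in the direction `X ∈ so(n)`. -/
def lieAmp (X : SoAlg n) (u : OpEu n × Eu n × Eu n → ℂ) : OpEu n × Eu n × Eu n → ℂ := fun q =>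
  fderiv ℝ u q (-((X : OpEu n) * q.1 - q.1 * (X : OpEu n)), -((X : OpEu n) q.2.1),
    -((X : OpEu n) q.2.2))

/-- The amplitude of the derivative of a superposition of waves in `r`. -/
def radialAmp (u : OpEu n × Eu n × Eu n → ℂ) : OpEu n × Eu n × Eu n → ℂ := fun q =>
  (-Complex.I * ((⟪q.2.1, q.2.2⟫_ℝ : ℝ) : ℂ)) * u q

/-- The amplitude of `z` times a superposition of waves, from integration by parts. -/
def decayAmp (u : OpEu n × Eu n × Eu n → ℂ) : OpEu n × Eu n × Eu n → ℂ := fun q =>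
  (-Complex.I) * fderiv ℝ u q (0, 0, q.2.1)

theorem IsAmplitude.lieAmp {u : OpEu n × Eu n × Eu n → ℂ} (hu : IsAmplitude u) (X : SoAlg n) :
    IsAmplitude (lieAmp X u) :=
  hu.fderiv_apply (by fun_prop)

theorem IsAmplitude.radialAmp {u : OpEu n × Eu n × Eu n → ℂ} (hu : IsAmplitude u) :
    IsAmplitude (radialAmp u) :=
  hu.mul (contDiff_const.mul (contDiff_ofReal_inner (by fun_prop) (by fun_prop)))

theorem IsAmplitude.decayAmp {u : OpEu n × Eu n × Eu n → ℂ} (hu : IsAmplitude u) :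
    IsAmplitude (decayAmp u) :=
  (hu.fderiv_apply (by fun_prop)).mul contDiff_const

/-- Rotating the flag amounts to rotating the arguments of the amplitude, since the phase `⟨ω, y⟩`
is invariant. -/
theorem flagWave_rotate (u : OpEu n × Eu n × Eu n → ℂ) (a : FlagMfd p n) (X : SoAlg n) (t : ℝ)
    (z : ℂ) : flagWave u (a.rotate (expRot X (-t))) z =
      ∫ y : a.dirᗮ, u (NormedSpace.exp ((-t) • (X : OpEu n)) * a.dir.starProjection
          * NormedSpace.exp (t • (X : OpEu n)), NormedSpace.exp ((-t) • (X : OpEu n)) a.vec,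
          NormedSpace.exp ((-t) • (X : OpEu n)) (y : Eu n)) *
        Complex.exp (-Complex.I * z * ((⟪a.vec, (y : Eu n)⟫_ℝ : ℝ) : ℂ)) := by
  have h := integral_orthogonal_map (expRot X (-t)) a.dir fun y : Eu n =>
    u ((a.rotate (expRot X (-t))).dir.starProjection, expRot X (-t) a.vec, y) *
      Complex.exp (-Complex.I * z * ((⟪expRot X (-t) a.vec, y⟫_ℝ : ℝ) : ℂ))
  refine h.trans ?_
  simp only [LinearIsometryEquiv.inner_map_map]
  have h2 : (a.rotate (expRot X (-t))).dir.starProjection = _ :=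
    starProjection_expRot X (-t) a.dir
  rw [h2, neg_neg]
  rfl

/-- The superpositions of waves are stable under the action of `so(n)`: after `flagWave_rotate` the
rotation parameter enters the amplitude only, so one may differentiate under the integral. -/
theorem lieDeriv_flagWave {u : OpEu n × Eu n × Eu n → ℂ} (hu : IsAmplitude u) (X : SoAlg n) :
    FlagMfd.lieDeriv X (fun a : FlagMfd p n × ℝ => flagWave u a.1 a.2)
      = fun a => flagWave (lieAmp X u) a.1 a.2 := by
  ext ⟨a, r⟩
  obtain ⟨hc, ρ, h0⟩ := hu
  simp only [FlagMfd.lieDeriv, flagWave_rotate]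
  let γ : ℝ × a.dirᗮ → OpEu n × Eu n × Eu n := fun q =>
    (NormedSpace.exp ((-q.1) • (X : OpEu n)) * a.dir.starProjection
          * NormedSpace.exp (q.1 • (X : OpEu n)), NormedSpace.exp ((-q.1) • (X : OpEu n)) a.vec,
          NormedSpace.exp ((-q.1) • (X : OpEu n)) (q.2 : Eu n))
  have hγ : ContDiff ℝ ∞ γ := by
    have e1 : ContDiff ℝ ∞ fun q : ℝ × a.dirᗮ => NormedSpace.exp (q.1 • (X : OpEu n)) :=
      (contDiff_exp_smul _).comp contDiff_fst
    have e2 : ContDiff ℝ ∞ fun q : ℝ × a.dirᗮ => NormedSpace.exp ((-q.1) • (X : OpEu n)) :=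
      (contDiff_exp_smul _).comp contDiff_fst.neg
    exact ((e2.mul contDiff_const).mul e1).prodMk ((e2.clm_apply contDiff_const).prodMk
      (e2.clm_apply (contDiff_coe_snd _)))
  have hexp : ContDiff ℝ ∞ fun q : ℝ × a.dirᗮ =>
      Complex.exp (-Complex.I * (r : ℂ) * ((⟪a.vec, (q.2 : Eu n)⟫_ℝ : ℝ) : ℂ)) := by
    exact (contDiff_const.mul (contDiff_ofReal_inner contDiff_const (contDiff_coe_snd _))).cexp
  have hnorm : ∀ (t : ℝ) (y : Eu n), ‖NormedSpace.exp ((-t) • (X : OpEu n)) y‖ = ‖y‖ := fun t y =>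
    (expRot X (-t)).norm_map y
  have h := hasDerivAt_integral_of_contDiff (Ψ := fun q : ℝ × a.dirᗮ => u (γ q) *
      Complex.exp (-Complex.I * (r : ℂ) * ((⟪a.vec, (q.2 : Eu n)⟫_ℝ : ℝ) : ℂ)))
      (((hc.comp hγ).mul hexp).of_le (by simp)) (ρ := ρ) (fun t y hy => by
        rw [h0 _ _ _ (by rw [hnorm]; simpa using hy), zero_mul]) 0
  refine h.deriv.trans ?_
  refine integral_congr_ae (Filter.Eventually.of_forall fun y => ?_)
  have hγ' : HasDerivAt (fun t => γ (t, y))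
      (-((X : OpEu n) * a.dir.starProjection - a.dir.starProjection * (X : OpEu n)),
        -((X : OpEu n) a.vec), -((X : OpEu n) (y : Eu n))) 0 :=
    (hasDerivAt_conj_exp _ _).prodMk
      ((hasDerivAt_exp_neg_apply (X : OpEu n) a.vec).prodMk
        (hasDerivAt_exp_neg_apply (X : OpEu n) (y : Eu n)))
  have hγ0 : γ (0, y) = (a.dir.starProjection, a.vec, (y : Eu n)) := by
    have h0 : (0 : ℝ) • (X : OpEu n) = 0 := zero_smul ℝ (X : OpEu n)
    have h1 : NormedSpace.exp ((0 : ℝ) • (X : OpEu n)) = 1 := by rw [h0, NormedSpace.exp_zero]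
    simp only [γ, neg_zero, h1, one_mul, mul_one]
    rfl
  have hu' : HasFDerivAt u (fderiv ℝ u (γ (0, y))) (γ (0, y)) :=
    (hc.differentiable (by simp) _).hasFDerivAt
  have h2 := (hu'.comp_hasDerivAt (0 : ℝ) hγ').mul_const
    (Complex.exp (-Complex.I * (r : ℂ) * ((⟪a.vec, (y : Eu n)⟫_ℝ : ℝ) : ℂ)))
  refine h2.deriv.trans ?_
  rw [hγ0]
  rfl

theorem hasDerivAt_flagWave {u : OpEu n × Eu n × Eu n → ℂ} (hu : IsAmplitude u)
    (a : FlagMfd p n) (r : ℝ) :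
    HasDerivAt (fun r : ℝ => flagWave u a r) (flagWave (radialAmp u) a r) r := by
  obtain ⟨hc, ρ, h0⟩ := hu
  have hin : ContDiff ℝ ∞ fun q : ℝ × a.dirᗮ => ((⟪a.vec, (q.2 : Eu n)⟫_ℝ : ℝ) : ℂ) :=
    contDiff_ofReal_inner contDiff_const (contDiff_coe_snd _)
  have hr : ContDiff ℝ ∞ fun q : ℝ × a.dirᗮ => -Complex.I * (q.1 : ℂ) :=
    contDiff_const.mul (Complex.ofRealCLM.contDiff.comp contDiff_fst)
  have hu' : ContDiff ℝ ∞ fun q : ℝ × a.dirᗮ => u (a.dir.starProjection, a.vec, (q.2 : Eu n)) :=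
    hc.comp (contDiff_const.prodMk (contDiff_const.prodMk (contDiff_coe_snd _)))
  have h := hasDerivAt_integral_of_contDiff (Ψ := fun q : ℝ × a.dirᗮ =>
      u (a.dir.starProjection, a.vec, (q.2 : Eu n)) *
      Complex.exp (-Complex.I * (q.1 : ℂ) * ((⟪a.vec, (q.2 : Eu n)⟫_ℝ : ℝ) : ℂ)))
      ((hu'.mul (hr.mul hin).cexp).of_le (by simp)) (ρ := ρ) (fun t y hy => by
        rw [h0 _ _ _ (by simpa using hy), zero_mul]) r
  convert! h using 1
  refine integral_congr_ae (Filter.Eventually.of_forall fun y => ?_)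
  have h1 : HasDerivAt (fun t : ℝ => -Complex.I * (t : ℂ) * ((⟪a.vec, (y : Eu n)⟫_ℝ : ℝ) : ℂ))
      (-Complex.I * ((⟪a.vec, (y : Eu n)⟫_ℝ : ℝ) : ℂ)) r := by
    simpa using ((Complex.ofRealCLM.hasDerivAt (x := r)).const_mul (-Complex.I)).mul_const
      ((⟪a.vec, (y : Eu n)⟫_ℝ : ℝ) : ℂ)
  have h2 := (h1.cexp.const_mul (u (a.dir.starProjection, a.vec, (y : Eu n)))).deriv
  refine Eq.trans ?_ h2.symm
  simp only [radialAmp]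
  ring

/-- Multiplication by `z` keeps the class of superpositions of waves: `z e^{-iz⟨ω, y⟩}` is `i` times
the derivative of the wave in the direction `ω ∈ σᗮ`, and one integrates by parts. -/
theorem mul_flagWave {u : OpEu n × Eu n × Eu n → ℂ} (hu : IsAmplitude u) (a : FlagMfd p n)
    (z : ℂ) : z * flagWave u a z = flagWave (decayAmp u) a z := by
  let w : a.dirᗮ := ⟨a.vec, a.vec_mem⟩
  let f : a.dirᗮ → ℂ := fun y => u (a.dir.starProjection, a.vec, (y : Eu n))
  let e : a.dirᗮ → ℂ := fun y =>
    Complex.exp (-Complex.I * z * ((⟪a.vec, (y : Eu n)⟫_ℝ : ℝ) : ℂ))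
  have hin : ∀ y : a.dirᗮ, HasFDerivAt (fun y : a.dirᗮ => ((⟪w, y⟫_ℝ : ℝ) : ℂ))
      (Complex.ofRealCLM.comp (innerSL ℝ w)) y := fun y =>
    Complex.ofRealCLM.hasFDerivAt.comp y (innerSL ℝ w).hasFDerivAt
  have he : ∀ y, HasFDerivAt e (e y • ((-Complex.I * z) •
      (Complex.ofRealCLM.comp (innerSL ℝ w)))) y := fun y => ((hin y).const_mul _).cexp
  have hι : ∀ y : a.dirᗮ, HasFDerivAt
      (fun y : a.dirᗮ => (a.dir.starProjection, a.vec, (y : Eu n)))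
      ((0 : a.dirᗮ →L[ℝ] OpEu n).prod ((0 : a.dirᗮ →L[ℝ] Eu n).prod (Submodule.subtypeL _))) y :=
    fun y => (hasFDerivAt_const _ _).prodMk
      ((hasFDerivAt_const _ _).prodMk (Submodule.subtypeL a.dirᗮ).hasFDerivAt)
  have hf : ∀ y : a.dirᗮ, HasFDerivAt f ((fderiv ℝ u (a.dir.starProjection, a.vec, (y : Eu n))).comp
      ((0 : a.dirᗮ →L[ℝ] OpEu n).prod ((0 : a.dirᗮ →L[ℝ] Eu n).prod (Submodule.subtypeL _)))) y :=
    fun y => ((hu.1.differentiable (by simp) _).hasFDerivAt).comp y (hι y)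
  have hfw : ∀ y : a.dirᗮ, fderiv ℝ f y w
      = fderiv ℝ u (a.dir.starProjection, a.vec, (y : Eu n)) (0, 0, a.vec) := fun y => by
    rw [(hf y).fderiv]; rfl
  have hww : ⟪w, w⟫_ℝ = 1 := by
    rw [real_inner_self_eq_norm_sq]
    have : ‖w‖ = 1 := a.norm_vec
    rw [this, one_pow]
  have hew : ∀ y, fderiv ℝ e y w = e y * (-Complex.I * z) := fun y => by
    rw [(he y).fderiv]
    show e y * (-Complex.I * z * ((⟪w, w⟫_ℝ : ℝ) : ℂ)) = _
    rw [hww, Complex.ofReal_one, mul_one]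
  have hec : Continuous e := by fun_prop
  -- integration by parts on `σᗮ` in the direction of the unit vector `ω`
  have hI := integral_mul_fderiv_eq_neg_fderiv_mul_of_integrable (μ := (volume : Measure a.dirᗮ))
    (f := f) (g := e) (v := w) ?_ ?_ ?_ (fun y _ => (hf y).differentiableAt)
    (fun y _ => (he y).differentiableAt)
  · simp only [hfw, hew] at hI
    have h1 : ∫ y, f y * (e y * (-Complex.I * z)) = -Complex.I * (z * flagWave u a z) := by
      simp only [flagWave, ← integral_const_mul]
      refine integral_congr_ae (Filter.Eventually.of_forall fun y => ?_)
      simp only [f, e]; ring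
    have h2 : flagWave (decayAmp u) a z = -Complex.I *
        ∫ y : a.dirᗮ, fderiv ℝ u (a.dir.starProjection, a.vec, (y : Eu n)) (0, 0, a.vec) * e y := by
      simp only [flagWave, ← integral_const_mul]
      refine integral_congr_ae (Filter.Eventually.of_forall fun y => ?_)
      simp only [decayAmp, e]; ring
    rw [h2, ← neg_eq_iff_eq_neg.mpr hI, h1]
    linear_combination (z * flagWave u a z) * Complex.I_sq
  · simp only [hfw]
    exact (hu.fderiv_apply (v := fun q => (0, 0, q.2.1)) (by fun_prop)).integrable _ _ _ hec
  · simp only [hew]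
    exact hu.integrable _ _ _ (hec.mul continuous_const)
  · exact hu.integrable _ _ _ hec

theorem AmplitudeSupp.decayAmp {u : OpEu n × Eu n × Eu n → ℂ} (hu : IsAmplitude u) {R : ℝ}
    (hs : AmplitudeSupp p R u) : AmplitudeSupp p R (decayAmp u) := by
  intro a y hy hR
  have h1 : HasDerivAt (fun t : ℝ => u (a.dir.starProjection, a.vec, y + t • a.vec))
      (fderiv ℝ u (a.dir.starProjection, a.vec, y) (0, 0, a.vec)) 0 := by
    have h2 : HasDerivAt (fun t : ℝ => (a.dir.starProjection, a.vec, y + t • a.vec))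
        ((0 : OpEu n), (0 : Eu n), a.vec) 0 := by
      refine (hasDerivAt_const _ _).prodMk ((hasDerivAt_const _ _).prodMk ?_)
      simpa using ((hasDerivAt_id (0 : ℝ)).smul_const a.vec).const_add y
    have h3 : HasFDerivAt u (fderiv ℝ u (a.dir.starProjection, a.vec, y))
        (a.dir.starProjection, a.vec, y + (0 : ℝ) • a.vec) := by
      rw [zero_smul, add_zero]
      exact (hu.1.differentiable (by simp) _).hasFDerivAt
    exact h3.comp_hasDerivAt (0 : ℝ) h2
  have h2 : (fun t : ℝ => u (a.dir.starProjection, a.vec, y + t • a.vec)) =ᶠ[nhds 0]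
      fun _ => 0 := by
    have h3 : {t : ℝ | R < ‖y + t • a.vec‖} ∈ nhds 0 :=
      (isOpen_lt continuous_const (by fun_prop)).mem_nhds (by simpa using hR)
    filter_upwards [h3] with t ht
    exact hs a _ (a.dirᗮ.add_mem hy (a.dirᗮ.smul_mem t a.vec_mem)) ht
  have h3 := h1.deriv
  rw [h2.deriv_eq, deriv_const] at h3
  simp only [_root_.decayAmp, ← h3, mul_zero]

theorem nontrivial_orthogonal (a : FlagMfd p n) : Nontrivial a.dirᗮ :=
  ⟨⟨⟨a.vec, a.vec_mem⟩, 0, fun h => by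
    have h1 : a.vec = 0 := congrArg Subtype.val h
    have := a.norm_vec
    rw [h1, norm_zero] at this
    exact zero_ne_one this⟩⟩

theorem finrank_orthogonal {s : Submodule ℝ (Eu n)} (hs : Module.finrank ℝ s = p) :
    Module.finrank ℝ sᗮ = n - p := by
  have := s.finrank_add_finrank_orthogonal
  rw [finrank_euclideanSpace_fin, hs] at this
  omega

/-- Superpositions of waves whose amplitude is supported in `|y| ≤ R` are of exponential type `R`,
uniformly on the flag manifold. -/
theorem exists_norm_flagWave_le {u : OpEu n × Eu n × Eu n → ℂ} (hu : IsAmplitude u) {R : ℝ}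
    (hs : AmplitudeSupp p R u) :
    ∃ C, ∀ (a : FlagMfd p n) (z : ℂ), ‖flagWave u a z‖ ≤ C * Real.exp (R * |z.im|) := by
  obtain ⟨M, hM⟩ := ((isCompact_flagSet p n).prod
    (isCompact_closedBall (0 : Eu n) R)).exists_bound_of_continuousOn
    (f := fun q : (OpEu n × Eu n) × Eu n => u (q.1.1, q.1.2, q.2))
    (hu.1.continuous.comp (by fun_prop)).continuousOn
  refine ⟨M * (ENNReal.ofReal R ^ (n - p) * ENNReal.ofReal (√Real.pi ^ (n - p) /
    Real.Gamma (((n - p : ℕ) : ℝ) / 2 + 1))).toReal, fun a z => ?_⟩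
  have := nontrivial_orthogonal a
  have hv : (volume : Measure a.dirᗮ).real (Metric.closedBall 0 R) = (ENNReal.ofReal R ^ (n - p) *
      ENNReal.ofReal (√Real.pi ^ (n - p) / Real.Gamma (((n - p : ℕ) : ℝ) / 2 + 1))).toReal := by
    rw [Measure.real, InnerProductSpace.volume_closedBall, finrank_orthogonal a.finrank_dir]
  unfold flagWave
  rw [← setIntegral_eq_integral_of_forall_compl_eq_zero (s := Metric.closedBall 0 R) fun y hy => by
    rw [hs a y y.2 (by simpa using hy), zero_mul]]
  refine (norm_setIntegral_le_of_norm_le_const (C := M * Real.exp (R * |z.im|))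
    measure_closedBall_lt_top fun y hy => ?_).trans (le_of_eq (by rw [hv]; ring))
  rw [norm_mul]
  have hy' : ‖(y : Eu n)‖ ≤ R := by simpa using hy
  have h1 := hM ((a.dir.starProjection, a.vec), (y : Eu n)) ⟨a.mem_flagSet, by simpa using hy'⟩
  refine mul_le_mul h1 ?_ (norm_nonneg _) ((norm_nonneg _).trans h1)
  rw [Complex.norm_exp, Real.exp_le_exp]
  have h2 : (-Complex.I * z * ((⟪a.vec, (y : Eu n)⟫_ℝ : ℝ) : ℂ)).re
      = z.im * ⟪a.vec, (y : Eu n)⟫_ℝ := by simp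
  rw [h2]
  have h3 := abs_real_inner_le_norm a.vec (y : Eu n)
  rw [a.norm_vec, one_mul] at h3
  calc z.im * ⟪a.vec, (y : Eu n)⟫_ℝ ≤ |z.im| * |⟪a.vec, (y : Eu n)⟫_ℝ| := by
        rw [← abs_mul]; exact le_abs_self _
    _ ≤ |z.im| * R := mul_le_mul_of_nonneg_left (h3.trans hy') (abs_nonneg _)
    _ = R * |z.im| := mul_comm _ _

/-- Powers of `z` are absorbed by the amplitude without enlarging its support. -/
theorem pow_mul_flagWave {u : OpEu n × Eu n × Eu n → ℂ} (hu : IsAmplitude u) {R : ℝ}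
    (hs : AmplitudeSupp p R u) (N : ℕ) : ∃ v, IsAmplitude v ∧ AmplitudeSupp p R v ∧
      ∀ (a : FlagMfd p n) (z : ℂ), z ^ N * flagWave u a z = flagWave v a z := by
  induction N with
  | zero => exact ⟨u, hu, hs, fun a z => by simp⟩
  | succ N ih =>
    obtain ⟨v, hv, hvs, h⟩ := ih
    refine ⟨decayAmp v, hv.decayAmp, hvs.decayAmp hv, fun a z => ?_⟩
    rw [pow_succ', mul_assoc, h, mul_flagWave hv]

theorem exists_pow_mul_norm_flagWave_le {u : OpEu n × Eu n × Eu n → ℂ} (hu : IsAmplitude u)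
    {R : ℝ} (hs : AmplitudeSupp p R u) (N : ℕ) : ∃ C, ∀ (a : FlagMfd p n) (z : ℂ),
      ‖z‖ ^ N * ‖flagWave u a z‖ ≤ C * Real.exp (R * |z.im|) := by
  obtain ⟨v, hv, hvs, h⟩ := pow_mul_flagWave hu hs N
  obtain ⟨C, hC⟩ := exists_norm_flagWave_le hv hvs
  exact ⟨C, fun a z => by rw [← norm_pow, ← norm_mul, h]; exact hC a z⟩

theorem integral_orthogonal_of_map_eq (e : Eu n ≃ₗᵢ[ℝ] Eu n) {s t : Submodule ℝ (Eu n)}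
    (h : s.map (e.toLinearEquiv : Eu n →ₗ[ℝ] Eu n) = t) (g : Eu n → ℂ) :
    ∫ x : tᗮ, g x = ∫ x : sᗮ, g (e x) := by
  subst h
  exact integral_orthogonal_map e s g

/-- Superpositions of waves are smooth: a local section `U` of `O(n) → Gr(p, n)` moves the integrals
over the varying spaces `σᗮ` to a fixed one. -/
theorem isSmooth_flagWave {u : OpEu n × Eu n × Eu n → ℂ} (hu : IsAmplitude u) :
    FlagMfd.IsSmooth fun a : FlagMfd p n × ℝ => flagWave u a.1 a.2 := by
  rintro ⟨a₀, r₀⟩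
  obtain ⟨hc, ρ, h0⟩ := hu
  obtain ⟨U, W, hW, haW, hUc, hU, hsec⟩ := exists_local_section a₀.dir
  let W' : Set (OpEu n × Eu n × ℝ) := Prod.fst ⁻¹' W
  have hW' : IsOpen W' := hW.preimage continuous_fst
  let G : OpEu n × Eu n × ℝ → a₀.dirᗮ → ℂ := fun q y => u (q.1, q.2.1, U q.1 y) *
    Complex.exp (-Complex.I * (q.2.2 : ℂ) * ((⟪q.2.1, U q.1 y⟫_ℝ : ℝ) : ℂ))
  have hnorm : ∀ A ∈ W, ∀ y, ‖U A y‖ = ‖y‖ := fun A hA y =>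
    (Unitary.linearIsometryEquiv ⟨_, hU A hA⟩).norm_map y
  have hUy : ContDiffOn ℝ ∞ (fun q : (OpEu n × Eu n × ℝ) × a₀.dirᗮ => U q.1.1 q.2)
      (W' ×ˢ Set.univ) :=
    (hUc.comp (by fun_prop) fun q hq => hq.1).clm_apply
      (contDiff_coe_snd _).contDiffOn
  have hG : ContDiffOn ℝ ∞ (fun q : (OpEu n × Eu n × ℝ) × a₀.dirᗮ => G q.1 q.2)
      (W' ×ˢ Set.univ) := by
    have e1 : ContDiffOn ℝ ∞ (fun q : (OpEu n × Eu n × ℝ) × a₀.dirᗮ => q.1.2.1)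
      (W' ×ˢ Set.univ) := by fun_prop
    have e2 : ContDiffOn ℝ ∞ (fun q : (OpEu n × Eu n × ℝ) × a₀.dirᗮ => (q.1.2.2 : ℂ))
      (W' ×ˢ Set.univ) := (Complex.ofRealCLM.contDiff.comp (by fun_prop)).contDiffOn
    refine (hc.comp_contDiffOn (ContDiffOn.prodMk (by fun_prop) (e1.prodMk hUy))).mul
      (ContDiffOn.cexp ((contDiffOn_const.mul e2).mul
        (Complex.ofRealCLM.contDiff.comp_contDiffOn (e1.inner ℝ hUy))))
  refine exists_contDiff_of_contDiffOn hW' haW (contDiffOn_integral_of_support hW' (ρ := ρ)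
    (fun q hq y hy => ?_) hG) ?_
  · simp only [G]
    rw [h0 _ _ _ (by rw [hnorm _ hq]; simpa using hy), zero_mul]
  · rintro ⟨a, r⟩ ha
    exact integral_orthogonal_of_map_eq _ (hsec a.dir ha (a.finrank_dir.trans a₀.finrank_dir.symm))
      fun y => u (a.dir.starProjection, a.vec, y) *
        Complex.exp (-Complex.I * (r : ℂ) * ((⟪a.vec, y⟫_ℝ : ℝ) : ℂ))

theorem isSchwartz_flagWave {u : OpEu n × Eu n × Eu n → ℂ} (hu : IsAmplitude u) :
    FlagMfd.IsSchwartz fun a : FlagMfd p n × ℝ => flagWave u a.1 a.2 := by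
  refine ⟨isSmooth_flagWave hu, fun N j Xs => ?_⟩
  have h1 : ∃ v, IsAmplitude v ∧ Xs.foldr FlagMfd.lieDeriv
      (fun a : FlagMfd p n × ℝ => flagWave u a.1 a.2) = fun a => flagWave v a.1 a.2 := by
    induction Xs with
    | nil => exact ⟨u, hu, rfl⟩
    | cons X Xs ih =>
      obtain ⟨v, hv, h⟩ := ih
      exact ⟨lieAmp X v, hv.lieAmp X, by rw [List.foldr_cons, h, lieDeriv_flagWave hv]⟩
  obtain ⟨v, hv, h⟩ := h1
  have h2 : ∃ v', IsAmplitude v' ∧ ∀ a : FlagMfd p n,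
      iteratedDeriv j (fun r : ℝ => flagWave v a r) = fun r : ℝ => flagWave v' a r := by
    clear N h
    induction j with
    | zero => exact ⟨v, hv, fun a => iteratedDeriv_zero⟩
    | succ j ih =>
      obtain ⟨v', hv', h'⟩ := ih
      refine ⟨radialAmp v', hv'.radialAmp, fun a => ?_⟩
      rw [iteratedDeriv_succ, h' a]
      exact funext fun r => (hasDerivAt_flagWave hv' a r).deriv
  obtain ⟨v', hv', h'⟩ := h2
  obtain ⟨ρ, hρ⟩ := hv'.exists_supp p
  obtain ⟨C, hC⟩ := exists_pow_mul_norm_flagWave_le hv' hρ N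
  refine ⟨C, fun a r => ?_⟩
  rw [h, h' a]
  simpa using hC a r

/-- The partial Fourier transform of a test function satisfies the Paley–Wiener conditions, and is
a Schwartz function in polar coordinates. -/
theorem polarFourier_testFunctions {R : ℝ} (hR : 0 < R) {f : AffGr p n → ℂ}
    (hf : f ∈ AffGr.testFunctions p n R) :
    FlagMfd.IsSchwartz (polarFourier f) ∧ PaleyWiener R (polarFourier f) := by
  obtain ⟨hsm, hsupp⟩ := hf
  obtain ⟨g, hg, hfg⟩ := hsm.exists_extension
  let χ : ContDiffBump (0 : Eu n) := ⟨R, R + 1, hR, by linarith⟩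
  -- the extension of `f` need not have bounded support off the submanifold, so it is cut off
  -- outside the ball of radius `R`
  let u : OpEu n × Eu n × Eu n → ℂ := fun q => (χ q.2.2 : ℂ) * g (q.1, q.2.2)
  have hu : IsAmplitude u := by
    refine ⟨(Complex.ofRealCLM.contDiff.comp (χ.contDiff.comp (by fun_prop))).mul
      (hg.comp (by fun_prop)), R + 1, fun A w y hy => ?_⟩
    have : χ y = 0 := χ.zero_of_le_dist (by simpa using hy.le)
    simp [u, this]
  have huf : ∀ (s : Submodule ℝ (Eu n)) (hs : Module.finrank ℝ s = p) (w : Eu n) (y : sᗮ),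
      f ⟨s, hs, y, y.2⟩ = u (s.starProjection, w, y) := by
    intro s hs w y
    by_cases hy : ‖(y : Eu n)‖ ≤ R
    · have : χ (y : Eu n) = 1 := χ.one_of_mem_closedBall (by simpa using hy)
      simp only [u, this, Complex.ofReal_one, one_mul]
      exact hfg _
    · have h1 : f ⟨s, hs, y, y.2⟩ = 0 := hsupp _ (lt_of_not_ge hy)
      have h2 := hfg ⟨s, hs, y, y.2⟩
      rw [h1] at h2 ⊢
      have h3 : g (s.starProjection, (y : Eu n)) = 0 := h2.symm
      simp [u, h3]
  have hus : AmplitudeSupp p R u := fun a y hy hRy => by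
    rw [← huf a.dir a.finrank_dir a.vec ⟨y, hy⟩]
    exact hsupp _ hRy
  have hpol : polarFourier f = fun a : FlagMfd p n × ℝ => flagWave u a.1 a.2 := by
    ext ⟨a, r⟩
    refine integral_congr_ae (Filter.Eventually.of_forall fun y => ?_)
    simp only [FlagMfd.toAffGr, inner_smul_left, Complex.ofReal_mul]
    rw [huf a.dir a.finrank_dir a.vec y]
    simp [mul_assoc]
  rw [hpol]
  refine ⟨isSchwartz_flagWave hu, flagWave u, fun a => ?_, fun a r => rfl, fun N => ?_,
    fun k s hs h hh => ?_⟩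
  · have h1 := differentiable_integral_mul_comp (μ := (volume : Measure a.dirᗮ))
      Complex.differentiable_exp (b := fun y => u (a.dir.starProjection, a.vec, (y : Eu n)))
      (c := fun y => -Complex.I * ((⟪a.vec, (y : Eu n)⟫_ℝ : ℝ) : ℂ)) (K := R)
      (by simpa using hu.integrable a.dir.starProjection a.vec a.dirᗮ
            (continuous_const : Continuous fun _ => (1 : ℂ)))
      (by fun_prop) fun y hy => ?_
    · convert h1 using 1
      ext z
      refine integral_congr_ae (Filter.Eventually.of_forall fun y => ?_)
      dsimp only
      congr 2
      ring
    · have h2 : ‖(y : Eu n)‖ ≤ R := by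
        by_contra h
        exact hy (hus a y y.2 (lt_of_not_ge h))
      have h3 := abs_real_inner_le_norm a.vec (y : Eu n)
      rw [a.norm_vec, one_mul] at h3
      simpa using h3.trans h2
  · obtain ⟨C₀, hC₀⟩ := exists_norm_flagWave_le hu hus
    obtain ⟨C, hC⟩ := exists_pow_mul_norm_flagWave_le hu hus N
    refine ⟨2 ^ N * (C₀ + C), fun a z => ?_⟩
    have h1 := one_add_pow_le_two_pow_mul (norm_nonneg z) N
    rw [neg_mul, Real.exp_neg, ← div_eq_mul_inv, div_le_iff₀ (Real.exp_pos _)]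
    calc (1 + ‖z‖) ^ N * ‖flagWave u a z‖
        ≤ 2 ^ N * (1 + ‖z‖ ^ N) * ‖flagWave u a z‖ :=
          mul_le_mul_of_nonneg_right h1 (norm_nonneg _)
      _ = 2 ^ N * (‖flagWave u a z‖ + ‖z‖ ^ N * ‖flagWave u a z‖) := by ring
      _ ≤ 2 ^ N * (C₀ * Real.exp (R * |z.im|) + C * Real.exp (R * |z.im|)) :=
          mul_le_mul_of_nonneg_left (add_le_add (hC₀ a z) (hC a z)) (by positivity)
      _ = _ := by ring
  · let b := stdOrthonormalBasis ℝ sᗮ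
    obtain ⟨P, hP, hl, rfl⟩ := hh.exists_polyFun b
    rcases subsingleton_or_nontrivial sᗮ with hsub | hnon
    · refine ⟨0, differentiable_const 0, fun z => rfl, fun z _ => ?_⟩
      have : (volume : Measure sᗮ).toSphere = 0 := Measure.toSphere_eq_zero_iff _ |>.mpr hsub
      rw [this, integral_zero_measure, mul_zero]
      rfl
    · have h0 : ∀ y : sᗮ, R + 1 < ‖y‖ → u (s.starProjection, 0, (y : Eu n)) = 0 := fun y hy => by
        have : χ (y : Eu n) = 0 := χ.zero_of_le_dist (by simpa using hy.le)
        simp [u, this]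
      have hvc : Continuous fun y : sᗮ => u (s.starProjection, 0, (y : Eu n)) :=
        hu.1.continuous.comp (by fun_prop)
      exact exists_entire_harmonic_component b hvc h0 hP hl

end Wave

/-! ### Families of integrands closed under differentiation -/

/-- Differentiation under the integral sign for a family `𝒢` of integrands whose derivatives are
combinations of members of `𝒢` with smooth coefficients `c i`: if the members of `𝒢` have
integrable majorants, then all their integrals are smooth in the parameter. -/
theorem contDiffOn_integral_of_family {E Y κ : Type*} [NormedAddCommGroup E] [NormedSpace ℝ E]
    [MeasurableSpace Y] {μ : Measure Y} [Fintype κ] {W : Set E} (hW : IsOpen W)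
    {c : κ → E → (E →L[ℝ] ℝ)} (hc : ∀ i, ContDiffOn ℝ ∞ (c i) W) (𝒢 : Set (E → Y → ℂ))
    (hd : ∀ G ∈ 𝒢, ∃ G' : κ → E → Y → ℂ, (∀ i, G' i ∈ 𝒢) ∧ ∀ᵐ y ∂μ, ∀ q ∈ W,
      HasFDerivAt (fun q => G q y) (∑ i, (c i q).smulRight (G' i q y)) q)
    (hm : ∀ G ∈ 𝒢, ∀ q ∈ W, AEStronglyMeasurable (G q) μ)
    (hb : ∀ G ∈ 𝒢, ∃ B : Y → ℝ, Integrable B μ ∧ ∀ᵐ y ∂μ, ∀ q ∈ W, ‖G q y‖ ≤ B y)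
    {G : E → Y → ℂ} (hG : G ∈ 𝒢) : ContDiffOn ℝ ∞ (fun q => ∫ y, G q y ∂μ) W := by
  have hint : ∀ G ∈ 𝒢, ∀ q ∈ W, Integrable (G q) μ := by
    intro G hG q hq
    obtain ⟨B, hB, hle⟩ := hb G hG
    exact hB.mono' (hm G hG q hq) (hle.mono fun y hy => hy q hq)
  have key : ∀ G ∈ 𝒢, ∃ G' : κ → E → Y → ℂ, (∀ i, G' i ∈ 𝒢) ∧ ∀ q ∈ W,
      HasFDerivAt (fun q => ∫ y, G q y ∂μ) (∑ i, (c i q).smulRight (∫ y, G' i q y ∂μ)) q := by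
    intro G hG
    obtain ⟨G', hG', hder⟩ := hd G hG
    refine ⟨G', hG', fun q₀ hq₀ => ?_⟩
    choose B hB hle using fun i => hb (G' i) (hG' i)
    let L : κ → ℂ →L[ℝ] (E →L[ℝ] ℂ) := fun i => ContinuousLinearMap.smulRightL ℝ E ℂ (c i q₀)
    have hs : {q | q ∈ W ∧ ∀ i, ‖c i q‖ < ‖c i q₀‖ + 1} ∈ nhds q₀ := by
      refine Filter.inter_mem (hW.mem_nhds hq₀) ?_
      refine Filter.eventually_all.mpr fun i => ?_
      exact (((hc i).continuousOn.continuousAt (hW.mem_nhds hq₀)).norm).eventually_lt_const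
        (lt_add_one _)
    have h := hasFDerivAt_integral_of_dominated_of_fderiv_le (𝕜 := ℝ) (μ := μ) (F := G)
      (F' := fun q y => ∑ i, (c i q).smulRight (G' i q y)) (x₀ := q₀)
      (bound := fun y => ∑ i, (‖c i q₀‖ + 1) * B i y) hs
      ((hW.mem_nhds hq₀) |> Filter.mem_of_superset <| hm G hG) (hint G hG q₀ hq₀) ?_ ?_ ?_ ?_
    · convert! h using 1
      refine Eq.symm ((integral_finsetSum _ fun i _ =>
        (L i).integrable_comp (hint _ (hG' i) q₀ hq₀)).trans ?_)
      exact Finset.sum_congr rfl fun i _ => (L i).integral_comp_comm (hint _ (hG' i) q₀ hq₀)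
    · exact Finset.aestronglyMeasurable_fun_sum _ fun i _ =>
        (L i).continuous.comp_aestronglyMeasurable (hm _ (hG' i) q₀ hq₀)
    · have hall : ∀ᵐ y ∂μ, ∀ i, ∀ q ∈ W, ‖G' i q y‖ ≤ B i y := ae_all_iff.mpr hle
      filter_upwards [hall] with y hy q hq
      refine (norm_sum_le _ _).trans (Finset.sum_le_sum fun i _ => ?_)
      rw [ContinuousLinearMap.norm_smulRight_apply]
      exact mul_le_mul (hq.2 i).le (hy i q hq.1) (norm_nonneg _) (by positivity)
    · exact integrable_finsetSum _ fun i _ => (hB i).const_mul _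
    · filter_upwards [hder] with y hy q hq using hy q hq.1
  rw [contDiffOn_infty]
  intro m
  induction m generalizing G with
  | zero =>
    obtain ⟨G', -, h⟩ := key G hG
    exact contDiffOn_zero.mpr fun q hq => (h q hq).continuousAt.continuousWithinAt
  | succ m ih =>
    obtain ⟨G', hG', h⟩ := key G hG
    have h2 := (contDiffOn_succ_iff_fderiv_of_isOpen (𝕜 := ℝ) (n := (m : ℕ∞ω))
      (f := fun q => ∫ y, G q y ∂μ) hW).mpr
      ⟨fun q hq => (h q hq).differentiableAt.differentiableWithinAt, by simp, ?_⟩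
    · exact_mod_cast h2
    · have h3 : ContDiffOn ℝ m (fun q => ∑ i, (c i q).smulRight (∫ y, G' i q y ∂μ)) W :=
        ContDiffOn.sum fun i _ => ((hc i).of_le (by exact_mod_cast le_top)).smulRight (ih (hG' i))
      exact h3.congr fun q hq => (h q hq).fderiv

/-! ### Rapidly decreasing functions on the flag manifold -/

section Rapid

variable {p n : ℕ}

/-- The action of `X ∈ so(n)` on functions on `End(ℝⁿ) × ℝⁿ × ℝ`, which extends the action on
functions on `F_{p,n} × ℝ`. -/
def lieSym (X : OpEu n) (H : OpEu n × Eu n × ℝ → ℂ) : OpEu n × Eu n × ℝ → ℂ := fun q =>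
  fderiv ℝ H q (-(X * q.1 - q.1 * X), -(X q.2.1), 0)

theorem contDiff_lieSym {H : OpEu n × Eu n × ℝ → ℂ} (hH : ContDiff ℝ ∞ H) (X : OpEu n) :
    ContDiff ℝ ∞ (lieSym X H) :=
  (hH.fderiv_right (m := ∞) (by simp)).clm_apply (by fun_prop)

/-- `lieSym X` restricts to the action of `X` on functions on `F_{p,n} × ℝ`. -/
theorem lieDeriv_comp_embed {H : OpEu n × Eu n × ℝ → ℂ} (hH : ContDiff ℝ ∞ H) (X : SoAlg n) :
    FlagMfd.lieDeriv X (fun a : FlagMfd p n × ℝ => H (FlagMfd.embed a))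
      = fun a => lieSym (X : OpEu n) H (FlagMfd.embed a) := by
  ext ⟨a, r⟩
  let γ : ℝ → OpEu n × Eu n × ℝ := fun t =>
    (NormedSpace.exp ((-t) • (X : OpEu n)) * a.dir.starProjection
      * NormedSpace.exp (t • (X : OpEu n)), NormedSpace.exp ((-t) • (X : OpEu n)) a.vec, r)
  have hγ : ∀ t, FlagMfd.embed (a.rotate (expRot X (-t)), r) = γ t := fun t => by
    have h2 : (a.rotate (expRot X (-t))).dir.starProjection = _ :=
      starProjection_expRot X (-t) a.dir
    rw [neg_neg] at h2
    exact Prod.ext h2 rfl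
  have hγ' : HasDerivAt γ
      (-((X : OpEu n) * a.dir.starProjection - a.dir.starProjection * (X : OpEu n)),
      -((X : OpEu n) a.vec), 0) 0 :=
    (hasDerivAt_conj_exp _ _).prodMk
      ((hasDerivAt_exp_neg_apply (X : OpEu n) a.vec).prodMk (hasDerivAt_const _ _))
  have hγ0 : γ 0 = FlagMfd.embed (a, r) := by
    have h0 : (0 : ℝ) • (X : OpEu n) = 0 := zero_smul ℝ (X : OpEu n)
    have h1 : NormedSpace.exp ((0 : ℝ) • (X : OpEu n)) = 1 := by rw [h0, NormedSpace.exp_zero]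
    simp only [γ, neg_zero, h1, one_mul, mul_one]
    rfl
  have hH' : HasFDerivAt H (fderiv ℝ H (γ 0)) (γ 0) := (hH.differentiable (by simp) _).hasFDerivAt
  simp only [FlagMfd.lieDeriv, hγ]
  refine (hH'.comp_hasDerivAt (0 : ℝ) hγ').deriv.trans ?_
  rw [hγ0]
  rfl

/-- A smooth function on `End(ℝⁿ) × ℝⁿ × ℝ` whose derivatives along rotations decrease rapidly on
`F_{p,n} × ℝ`. -/
def RapidDecay (p : ℕ) (H : OpEu n × Eu n × ℝ → ℂ) : Prop :=
  ContDiff ℝ ∞ H ∧ ∀ (Xs : List (SoAlg n)) (N : ℕ), ∃ C, ∀ (a : FlagMfd p n) (r : ℝ),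
    (1 + |r|) ^ N * ‖Xs.foldr (fun X : SoAlg n => lieSym (X : OpEu n)) H (FlagMfd.embed (a, r))‖ ≤ C

theorem RapidDecay.lieSym {H : OpEu n × Eu n × ℝ → ℂ} (hH : RapidDecay p H) (X : SoAlg n) :
    RapidDecay p (lieSym (X : OpEu n) H) := by
  refine ⟨contDiff_lieSym hH.1 X, fun Xs N => ?_⟩
  have := hH.2 (Xs ++ [X]) N
  rwa [List.foldr_append] at this

theorem RapidDecay.exists_bound {H : OpEu n × Eu n × ℝ → ℂ} (hH : RapidDecay p H) (N : ℕ) :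
    ∃ C, ∀ (a : FlagMfd p n) (r : ℝ), (1 + |r|) ^ N * ‖H (FlagMfd.embed (a, r))‖ ≤ C :=
  hH.2 [] N

/-- A Schwartz function extends to a function in `RapidDecay`: any smooth extension `H` works, as
the estimates only concern the values of the derivatives on `F_{p,n} × ℝ`. -/
theorem FlagMfd.IsSchwartz.exists_rapidDecay {F : FlagMfd p n × ℝ → ℂ}
    (hF : FlagMfd.IsSchwartz F) : ∃ H, RapidDecay p H ∧ ∀ a, F a = H (FlagMfd.embed a) := by
  obtain ⟨H, hH, hFH⟩ := hF.1.exists_extension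
  refine ⟨H, ⟨hH, fun Xs N => ?_⟩, hFH⟩
  have h1 : ContDiff ℝ ∞ (Xs.foldr (fun X : SoAlg n => _root_.lieSym (X : OpEu n)) H) ∧
      Xs.foldr FlagMfd.lieDeriv F
        = fun a => Xs.foldr (fun X : SoAlg n => _root_.lieSym (X : OpEu n)) H
          (FlagMfd.embed a) := by
    induction Xs with
    | nil => exact ⟨hH, funext hFH⟩
    | cons X Xs ih =>
      refine ⟨contDiff_lieSym ih.1 X, ?_⟩
      rw [List.foldr_cons, ih.2, lieDeriv_comp_embed ih.1]
      rfl
  obtain ⟨C₀, hC₀⟩ := hF.2 0 0 Xs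
  obtain ⟨C, hC⟩ := hF.2 N 0 Xs
  simp only [h1.2, iteratedDeriv_zero] at hC hC₀
  refine ⟨2 ^ N * (C₀ + C), fun a r => ?_⟩
  refine (mul_le_mul_of_nonneg_right (one_add_pow_le_two_pow_mul (abs_nonneg r) N)
    (norm_nonneg _)).trans ?_
  rw [mul_assoc, add_mul]
  exact mul_le_mul_of_nonneg_left (add_le_add (by simpa using hC₀ a r) (hC a r)) (by positivity)

/-! ### Derivatives along a local section -/

/-- The skew-adjoint parts of the members of a basis of `End(ℝⁿ)`. -/
def skewBasis (n : ℕ) (i : Fin (Module.finrank ℝ (OpEu n))) : SoAlg n :=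
  ⟨(2⁻¹ : ℝ) • (Module.finBasis ℝ (OpEu n) i - star (Module.finBasis ℝ (OpEu n) i)), by
    rw [skewAdjoint.mem_iff, star_smul, star_sub, star_star, ← neg_sub, smul_neg]
    rfl⟩

/-- The coefficients of the infinitesimal rotation `dU(A)[B] U(A)*` with respect to `skewBasis`. -/
def sectionCoeff (U : OpEu n → OpEu n) (i : Fin (Module.finrank ℝ (OpEu n))) (A : OpEu n) :
    OpEu n →L[ℝ] ℝ :=
  (LinearMap.toContinuousLinearMap ((Module.finBasis ℝ (OpEu n)).coord i)).comp
    (((ContinuousLinearMap.compL ℝ (Eu n) (Eu n) (Eu n)).flip (star (U A))).comp (fderiv ℝ U A))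

theorem contDiffOn_sectionCoeff {U : OpEu n → OpEu n} {W : Set (OpEu n)} (hW : IsOpen W)
    (hU : ContDiffOn ℝ ∞ U W) (i : Fin (Module.finrank ℝ (OpEu n))) :
    ContDiffOn ℝ ∞ (sectionCoeff U i) W := by
  have h1 : ContDiffOn ℝ ∞ (fun A => star (U A)) W := (starOp n).contDiff.comp_contDiffOn hU
  exact contDiffOn_const.clm_comp
    (((ContinuousLinearMap.contDiff _).comp_contDiffOn h1).clm_comp
      (hU.fderiv_of_isOpen hW (by simp)))

/-- The `skewBasis` spans `so(n)`, though it is not linearly independent: a skew-adjoint operator is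
expanded in a basis of `End(ℝⁿ)`, and the skew-adjoint part of the expansion is taken. -/
theorem eq_sum_skewBasis {X : OpEu n} (hX : star X = -X) :
    X = ∑ i, (Module.finBasis ℝ (OpEu n)).coord i X • (skewBasis n i : OpEu n) := by
  have h1 : (2 : ℝ) • X = ∑ i, (Module.finBasis ℝ (OpEu n)).coord i X •
      (Module.finBasis ℝ (OpEu n) i - star (Module.finBasis ℝ (OpEu n) i)) := by
    have h2 : X = ∑ i, (Module.finBasis ℝ (OpEu n)).coord i X • Module.finBasis ℝ (OpEu n) i :=
      ((Module.finBasis ℝ (OpEu n)).sum_repr X).symm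
    have h3 : starOp n X = ∑ i, (Module.finBasis ℝ (OpEu n)).coord i X •
        starOp n (Module.finBasis ℝ (OpEu n) i) := by
      conv_lhs => rw [h2]
      simp only [map_sum, map_smul]
    simp only [smul_sub, Finset.sum_sub_distrib]
    rw [← h2]
    refine (two_smul ℝ X).trans ?_
    rw [← sub_neg_eq_add, ← hX]
    congr 1
  have h4 : (2⁻¹ : ℝ) • ((2 : ℝ) • X) = X := inv_smul_smul₀ two_ne_zero X
  refine h4.symm.trans ((congrArg _ h1).trans ?_)
  rw [Finset.smul_sum]
  exact Finset.sum_congr rfl fun i _ => smul_comm (2⁻¹ : ℝ) _ _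

/-- The derivative of `U U* = 1`: the operator `dU(A)[B] U(A)*` is skew-adjoint. -/
theorem star_fderiv_mul_star {U : OpEu n → OpEu n} {W : Set (OpEu n)} (hW : IsOpen W)
    (hUc : ContDiffOn ℝ ∞ U W) (hU : ∀ A ∈ W, U A ∈ unitary (OpEu n)) {A : OpEu n} (hA : A ∈ W)
    (B : OpEu n) : U A * star (fderiv ℝ U A B) = -(fderiv ℝ U A B * star (U A)) := by
  have hd : HasFDerivAt U (fderiv ℝ U A) A :=
    ((hUc.contDiffAt (hW.mem_nhds hA)).differentiableAt (by simp)).hasFDerivAt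
  have h1 := hd.mul' ((starOp n).hasFDerivAt.comp A hd)
  have h2 : HasFDerivAt (fun A => U A * star (U A)) (0 : OpEu n →L[ℝ] OpEu n) A :=
    (hasFDerivAt_const (1 : OpEu n) A).congr_of_eventuallyEq
      (Filter.eventually_of_mem (hW.mem_nhds hA) fun A hA => (Unitary.mem_iff.mp (hU A hA)).2)
  have h3 := DFunLike.congr_fun (h1.unique h2) B
  have h4 : U A * star (fderiv ℝ U A B) + fderiv ℝ U A B * star (U A) = 0 := h3
  exact eq_neg_of_add_eq_zero_left h4

theorem mul_conj_sub_conj_mul {R : Type*} [Ring R] {X u v P d d' : R} (h₁ : X * u = d)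
    (h₂ : v * X = -d') : X * (u * P * v) - u * P * v * X = u * P * d' + d * P * v := by
  rw [mul_assoc (u * P), h₂, mul_assoc u P, ← mul_assoc X, h₁, mul_neg, sub_neg_eq_add, add_comm,
    mul_assoc d]

/-- The derivatives of `H` along a local section only involve the action of `so(n)` on `H`. Indeed
`X = dU(A)[B] U(A)*` is skew-adjoint, and `dU(A)[B] = X U(A)`, so that moving `A` in the direction
`B` acts on the orbit point `(U P U*, U w)` as the infinitesimal rotation `X` does. This is why no
decay of other derivatives of the extension `H` is needed. -/
theorem hasFDerivAt_section {U : OpEu n → OpEu n} {W : Set (OpEu n)} (hW : IsOpen W)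
    (hUc : ContDiffOn ℝ ∞ U W) (hU : ∀ A ∈ W, U A ∈ unitary (OpEu n)) {A : OpEu n} (hA : A ∈ W)
    {H : OpEu n × Eu n × ℝ → ℂ} (hH : ContDiff ℝ ∞ H) (P : OpEu n) (w : Eu n) (r : ℝ) :
    HasFDerivAt (fun A => H (U A * P * star (U A), U A w, r))
      (∑ i, (-sectionCoeff U i A).smulRight
        (lieSym (skewBasis n i : OpEu n) H (U A * P * star (U A), U A w, r))) A := by
  have hd : HasFDerivAt U (fderiv ℝ U A) A :=
    ((hUc.contDiffAt (hW.mem_nhds hA)).differentiableAt (by simp)).hasFDerivAt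
  have hs : HasFDerivAt (fun A => star (U A)) ((starOp n).comp (fderiv ℝ U A)) A :=
    (starOp n).hasFDerivAt.comp A hd
  set q := (U A * P * star (U A), U A w, r) with hq
  have hH' : HasFDerivAt H (fderiv ℝ H q) q := (hH.differentiable (by simp) _).hasFDerivAt
  have h1 : HasFDerivAt (fun A => U A * P * star (U A)) _ A := (hd.mul_const' P).mul' hs
  have h2 : HasFDerivAt (fun A => U A w) _ A := hd.clm_apply (hasFDerivAt_const w A)
  have h3 := hH'.comp A (h1.prodMk (h2.prodMk (hasFDerivAt_const r A)))
  refine h3.congr_fderiv (ContinuousLinearMap.ext fun B => ?_)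
  have hUU : star (U A) * U A = 1 := (Unitary.mem_iff.mp (hU A hA)).1
  set X : OpEu n := fderiv ℝ U A B * star (U A) with hX
  have hskew : star X = -X := by
    rw [hX, star_mul, star_star]
    exact star_fderiv_mul_star hW hUc hU hA B
  have hXU : X * U A = fderiv ℝ U A B := by rw [hX, mul_assoc, hUU, mul_one]
  have hUX : star (U A) * X = -star (fderiv ℝ U A B) := by
    have := congrArg star hXU
    rw [star_mul, hskew] at this
    have e : star (U A) * -X = -(star (U A) * X) :=
      ContinuousLinearMap.ext fun x => map_neg (star (U A)) (X x)
    rw [← this, e, neg_neg]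
  let L : OpEu n →ₗ[ℝ] ℂ :=
    { toFun := fun Y => fderiv ℝ H q (Y * q.1 - q.1 * Y, Y q.2.1, 0)
      map_add' := fun Y Z => by
        rw [← map_add]
        congr 1
        refine Prod.ext ?_ (Prod.ext rfl (add_zero _).symm)
        show (Y + Z) * q.1 - q.1 * (Y + Z) = (Y * q.1 - q.1 * Y) + (Z * q.1 - q.1 * Z)
        rw [add_mul, mul_add]; abel
      map_smul' := fun c Y => by
        rw [RingHom.id_apply, ← map_smul]
        congr 1
        refine Prod.ext ?_ (Prod.ext rfl (smul_zero c).symm)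
        show (c • Y) * q.1 - q.1 * (c • Y) = c • (Y * q.1 - q.1 * Y)
        have e1 : (c • Y) * q.1 = c • (Y * q.1) := ContinuousLinearMap.ext fun x => rfl
        have e2 : q.1 * (c • Y) = c • (q.1 * Y) :=
          ContinuousLinearMap.ext fun x => map_smul q.1 c (Y x)
        rw [e1, e2]
        exact (smul_sub c _ _).symm }
  have hL : ∀ Y, lieSym Y H q = -L Y := fun Y => by
    have e : (-(Y * q.1 - q.1 * Y), -(Y q.2.1), (0 : ℝ)) = -(Y * q.1 - q.1 * Y, Y q.2.1, (0 : ℝ)) :=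
      Prod.ext rfl (Prod.ext rfl neg_zero.symm)
    exact (congrArg (fderiv ℝ H q) e).trans (map_neg (fderiv ℝ H q) _)
  have hLX : L X = ∑ i, sectionCoeff U i A B • L (skewBasis n i : OpEu n) := by
    refine (congrArg L (eq_sum_skewBasis hskew)).trans ?_
    rw [map_sum]
    exact Finset.sum_congr rfl fun i _ => map_smul L _ _
  have hlhs : L X = fderiv ℝ H q (U A * P * star (fderiv ℝ U A B)
      + fderiv ℝ U A B * P * star (U A), fderiv ℝ U A B w, 0) := by
    show fderiv ℝ H q _ = _
    congr 1
    refine Prod.ext ?_ (Prod.ext ?_ rfl)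
    · show X * (U A * P * star (U A)) - U A * P * star (U A) * X = _
      exact mul_conj_sub_conj_mul hXU hUX
    · show X (U A w) = _
      rw [← hXU]; rfl
  have hrhs : (∑ i, (-sectionCoeff U i A).smulRight (lieSym (skewBasis n i : OpEu n) H q)) B
      = L X := by
    rw [hLX, _root_.sum_apply]
    refine Finset.sum_congr rfl fun i _ => ?_
    rw [ContinuousLinearMap.smulRight_apply, hL, _root_.neg_apply, smul_neg, neg_smul, neg_neg]
  rw [hrhs, hlhs]
  show fderiv ℝ H q (_, _, _) = _
  congr 1
  refine Prod.ext ?_ (Prod.ext ?_ rfl)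
  · rfl
  · show U A 0 + fderiv ℝ U A B w = _
    rw [map_zero, zero_add]

end Rapid

/-! ### Smoothness of the inverse transform -/

section InverseSmooth

variable {p n : ℕ}

/-- The integrands that occur in the derivatives of the inverse transform, pulled back to the fixed
space `s₀ᗮ` by a local section `U`. -/
def sectionIntegrands (p : ℕ) (U : OpEu n → OpEu n) (s₀ : Submodule ℝ (Eu n)) :
    Set (OpEu n × Eu n → s₀ᗮ → ℂ) :=
  {G | ∃ (H : OpEu n × Eu n × ℝ → ℂ) (β : s₀ᗮ → ℂ), RapidDecay p H ∧ Continuous β ∧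
    (∃ (K : ℝ) (M : ℕ), 0 ≤ K ∧ ∀ ξ, ‖β ξ‖ ≤ K * (1 + ‖ξ‖) ^ M) ∧
    G = fun (q : OpEu n × Eu n) (ξ : s₀ᗮ) =>
      H (U q.1 * s₀.starProjection * star (U q.1), U q.1 (‖ξ‖⁻¹ • (ξ : Eu n)), ‖ξ‖) *
        (β ξ * Complex.exp (Complex.I * ((⟪q.2, (ξ : Eu n)⟫_ℝ : ℝ) : ℂ)))}

theorem ae_ne_zero (V : Type*) [NormedAddCommGroup V] [InnerProductSpace ℝ V]
    [FiniteDimensional ℝ V] [MeasurableSpace V] [BorelSpace V] [Nontrivial V] :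
    ∀ᵐ x : V, x ≠ 0 := by
  have h : (volume : Measure V) {0} = 0 := measure_singleton 0
  exact compl_mem_ae_iff.mpr h

theorem norm_normalize_eq_one {V : Type*} [NormedAddCommGroup V] [NormedSpace ℝ V] {x : V}
    (hx : x ≠ 0) : ‖‖x‖⁻¹ • x‖ = 1 := by
  rw [norm_smul, norm_inv, norm_norm, inv_mul_cancel₀ (norm_ne_zero_iff.mpr hx)]

/-- Functions of polynomial growth times rapidly decreasing functions are dominated by one
integrable function. -/
theorem pow_mul_le_of_decay {d M : ℕ} {r a b K C : ℝ} (hr : 0 ≤ r) (hb : 0 ≤ b) (hK : 0 ≤ K)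
    (ha : a ≤ K * (1 + r) ^ M) (h : (1 + r) ^ (M + 2 * d) * b ≤ C) :
    b * a ≤ K * C * ((1 + r ^ 2) ^ d)⁻¹ := by
  have h1 : (1 + r ^ 2) ^ d ≤ (1 + r) ^ (2 * d) := by
    rw [pow_mul]
    exact pow_le_pow_left₀ (by positivity) (by nlinarith) d
  rw [← div_eq_mul_inv, le_div_iff₀ (by positivity)]
  calc b * a * (1 + r ^ 2) ^ d ≤ b * (K * (1 + r) ^ M) * (1 + r) ^ (2 * d) :=
        mul_le_mul (mul_le_mul_of_nonneg_left ha hb) h1 (by positivity) (by positivity)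
    _ = K * ((1 + r) ^ (M + 2 * d) * b) := by rw [pow_add]; ring
    _ ≤ K * C := mul_le_mul_of_nonneg_left h hK

/-- The coefficients of the derivatives of the integrands: those in the direction of the operator
variable come from the section, those in the direction of the vector variable are constant. -/
def integrandCoeff (U : OpEu n → OpEu n) :
    Fin (Module.finrank ℝ (OpEu n)) ⊕ Fin n → OpEu n × Eu n → (OpEu n × Eu n →L[ℝ] ℝ)
  | Sum.inl i => fun q => (-sectionCoeff U i q.1).comp (ContinuousLinearMap.fst ℝ _ _)
  | Sum.inr j => fun _ => (EuclideanSpace.proj j : Eu n →L[ℝ] ℝ).comp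
      (ContinuousLinearMap.snd ℝ _ _)

/-- The integrals over the fixed space `s₀ᗮ` depend smoothly on the operator and vector variables.
The set `sectionIntegrands` is closed under differentiation by `hasFDerivAt_section`, and its
members have integrable majorants because they are rapidly decreasing on `F_{p,n} × ℝ`. -/
theorem contDiffOn_integral_section {s₀ : Submodule ℝ (Eu n)} (hs₀ : Module.finrank ℝ s₀ = p)
    [Nontrivial s₀ᗮ] {U : OpEu n → OpEu n} {W : Set (OpEu n)} (hW : IsOpen W)
    (hUc : ContDiffOn ℝ ∞ U W) (hU : ∀ A ∈ W, U A ∈ unitary (OpEu n))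
    {G : OpEu n × Eu n → s₀ᗮ → ℂ} (hG : G ∈ sectionIntegrands p U s₀) :
    ContDiffOn ℝ ∞ (fun q => ∫ ξ, G q ξ) (Prod.fst ⁻¹' W) := by
  refine contDiffOn_integral_of_family (hW.preimage continuous_fst) (c := integrandCoeff U)
    ?_ _ ?_ ?_ ?_ hG
  · rintro (i | j)
    · exact ((contDiffOn_sectionCoeff hW hUc i).comp contDiffOn_fst fun q hq => hq).neg.clm_comp
        contDiffOn_const
    · exact contDiffOn_const
  · rintro _ ⟨H, β, hH, hβ, ⟨K, M, hK, hβK⟩, rfl⟩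
    let e : OpEu n × Eu n → s₀ᗮ → ℂ := fun q ξ =>
      Complex.exp (Complex.I * ((⟪q.2, (ξ : Eu n)⟫_ℝ : ℝ) : ℂ))
    -- derivatives in `A` act on `H` by `lieSym`; derivatives in the vector variable multiply `β` by
    -- a coordinate of `ξ`
    refine ⟨Sum.elim
      (fun i q ξ => lieSym (skewBasis n i : OpEu n) H (U q.1 * s₀.starProjection * star (U q.1),
          U q.1 (‖ξ‖⁻¹ • (ξ : Eu n)), ‖ξ‖) * (β ξ * e q ξ))
      (fun j q ξ => H (U q.1 * s₀.starProjection * star (U q.1), U q.1 (‖ξ‖⁻¹ • (ξ : Eu n)), ‖ξ‖) *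
        ((β ξ * (Complex.I * (((ξ : Eu n) j : ℝ) : ℂ))) * e q ξ)), ?_, ?_⟩
    · rintro (i | j)
      · exact ⟨_, β, hH.lieSym _, hβ, ⟨K, M, hK, hβK⟩, rfl⟩
      · refine ⟨H, _, hH, ?_, ⟨K, M + 1, hK, fun ξ => ?_⟩, rfl⟩
        · exact hβ.mul (continuous_const.mul (Complex.continuous_ofReal.comp
            ((EuclideanSpace.proj j : Eu n →L[ℝ] ℝ).continuous.comp continuous_subtype_val)))
        · rw [norm_mul, norm_mul, Complex.norm_I, one_mul, Complex.norm_real, pow_succ, ← mul_assoc]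
          refine mul_le_mul (hβK ξ) ?_ (norm_nonneg _) (by positivity)
          have := PiLp.norm_apply_le (ξ : Eu n) j
          have h2 : ‖(ξ : Eu n)‖ = ‖ξ‖ := rfl
          linarith
    · refine Filter.Eventually.of_forall fun ξ q hq => ?_
      have h1 := (hasFDerivAt_section hW hUc hU (A := q.1) hq hH.1 s₀.starProjection
        (‖ξ‖⁻¹ • (ξ : Eu n)) ‖ξ‖).comp q (hasFDerivAt_fst (𝕜 := ℝ) (p := q))
      have h2 : HasFDerivAt (fun q : OpEu n × Eu n => ((⟪q.2, (ξ : Eu n)⟫_ℝ : ℝ) : ℂ))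
          (Complex.ofRealCLM.comp (((innerSL ℝ (ξ : Eu n))).comp
            (ContinuousLinearMap.snd ℝ (OpEu n) (Eu n)))) q := by
        have h3 := Complex.ofRealCLM.hasFDerivAt.comp q ((innerSL ℝ (ξ : Eu n)).hasFDerivAt.comp q
          (hasFDerivAt_snd (𝕜 := ℝ) (p := q)))
        refine h3.congr_of_eventuallyEq (Filter.Eventually.of_forall fun q => ?_)
        exact congrArg Complex.ofReal (real_inner_comm _ _)
      have h3 := h1.mul (((h2.const_mul Complex.I).cexp).const_mul (β ξ))
      refine h3.congr_fderiv (ContinuousLinearMap.ext fun v => ?_)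
      have hin : ((⟪(ξ : Eu n), v.2⟫_ℝ : ℝ) : ℂ)
          = ∑ j, ((v.2 j : ℝ) : ℂ) * (((ξ : Eu n) j : ℝ) : ℂ) := by
        rw [PiLp.inner_apply]
        push_cast
        exact Finset.sum_congr rfl fun j _ => by simp
      have hproj : ∀ j, (EuclideanSpace.proj j : Eu n →L[ℝ] ℝ) v.2 = v.2 j := fun j => rfl
      rw [_root_.sum_apply, Fintype.sum_sum_type]
      simp only [integrandCoeff, Sum.elim_inl, Sum.elim_inr, ContinuousLinearMap.smulRight_apply,
        ContinuousLinearMap.comp_apply, ContinuousLinearMap.coe_fst', ContinuousLinearMap.coe_snd',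
        _root_.add_apply, _root_.smul_apply, _root_.sum_apply, innerSL_apply_apply,
        Complex.ofRealCLM_apply, hin, smul_eq_mul, Complex.real_smul, hproj,
        Function.comp_apply]
      rw [add_comm]
      congr 1
      · rw [Finset.mul_sum]
        exact Finset.sum_congr rfl fun i _ => by simp only [e]; ring
      · simp only [Finset.mul_sum]
        exact Finset.sum_congr rfl fun j _ => by simp only [e]; ring
  · rintro _ ⟨H, β, hH, hβ, -, rfl⟩ q -
    have h1 := hH.1.continuous
    have h2 : Measurable fun ξ : s₀ᗮ => U q.1 (‖ξ‖⁻¹ • (ξ : Eu n)) :=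
      (U q.1).continuous.measurable.comp (by fun_prop)
    refine Measurable.aestronglyMeasurable ?_
    refine Measurable.mul
      (h1.measurable.comp (measurable_const.prodMk (h2.prodMk (by fun_prop)))) ?_
    exact (by fun_prop : Continuous fun ξ : s₀ᗮ =>
      β ξ * Complex.exp (Complex.I * ((⟪q.2, (ξ : Eu n)⟫_ℝ : ℝ) : ℂ))).measurable
  · rintro _ ⟨H, β, hH, hβ, ⟨K, M, hK, hβK⟩, rfl⟩
    obtain ⟨C, hC⟩ := hH.exists_bound (M + 2 * (Module.finrank ℝ s₀ᗮ + 1))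
    refine ⟨_, (integrable_inv_one_add_norm_sq_pow s₀ᗮ).const_mul (K * C), ?_⟩
    filter_upwards [ae_ne_zero s₀ᗮ] with ξ hξ q hq
    rw [norm_mul, norm_mul]
    have h1 : ‖Complex.exp (Complex.I * ((⟪q.2, (ξ : Eu n)⟫_ℝ : ℝ) : ℂ))‖ = 1 := by
      rw [mul_comm, Complex.norm_exp_ofReal_mul_I]
    rw [h1, mul_one]
    let u := Unitary.linearIsometryEquiv ⟨U q.1, hU q.1 hq⟩
    -- for `ξ ≠ 0` the arguments of `H` lie on `F_{p,n} × ℝ`, where the rapid decay holds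
    let a : FlagMfd p n := (FlagMfd.ofSphere s₀ hs₀ ⟨‖ξ‖⁻¹ • ξ, by
      simpa using norm_normalize_eq_one hξ⟩).rotate u
    have ha : FlagMfd.embed (a, ‖ξ‖)
        = (U q.1 * s₀.starProjection * star (U q.1), U q.1 (‖ξ‖⁻¹ • (ξ : Eu n)), ‖ξ‖) :=
      Prod.ext (starProjection_map_eq u s₀) rfl
    have h2 := hC a ‖ξ‖
    rw [ha, abs_norm] at h2
    exact pow_mul_le_of_decay (norm_nonneg ξ) (norm_nonneg _) hK (hβK ξ) h2

/-- The inverse of the partial Fourier transform, up to a constant factor, of a rapidly decreasing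
function on `F_{p,n} × ℝ` is smooth on the affine Grassmannian. -/
theorem isSmooth_inverse (hpn : p < n) {H : OpEu n × Eu n × ℝ → ℂ} (hH : RapidDecay p H) :
    AffGr.IsSmooth fun l : AffGr p n => ∫ ξ : l.dirᗮ,
      H (l.dir.starProjection, ‖ξ‖⁻¹ • (ξ : Eu n), ‖ξ‖) *
        Complex.exp (Complex.I * ((⟪l.foot, (ξ : Eu n)⟫_ℝ : ℝ) : ℂ)) := by
  intro l₀
  obtain ⟨U, W, hW, hlW, hUc, hU, hsec⟩ := exists_local_section l₀.dir
  have : Nontrivial l₀.dirᗮ := by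
    refine Module.nontrivial_of_finrank_pos (R := ℝ) ?_
    rw [finrank_orthogonal l₀.finrank_dir]
    omega
  let G : OpEu n × Eu n → l₀.dirᗮ → ℂ := fun q ξ =>
      H (U q.1 * l₀.dir.starProjection * star (U q.1), U q.1 (‖ξ‖⁻¹ • (ξ : Eu n)), ‖ξ‖) *
        (1 * Complex.exp (Complex.I * ((⟪q.2, (ξ : Eu n)⟫_ℝ : ℝ) : ℂ)))
  have hG : G ∈ sectionIntegrands p U l₀.dir :=
    ⟨H, fun _ => 1, hH, continuous_const, ⟨1, 0, zero_le_one, fun ξ => by simp⟩, rfl⟩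
  have hT := contDiffOn_integral_section l₀.finrank_dir hW hUc hU hG
  -- undo the rotation of the foot: `⟨x, U ξ⟩ = ⟨U* x, ξ⟩`
  have hUs : ContDiffOn ℝ ∞ (fun q : OpEu n × Eu n => (q.1, star (U q.1) q.2))
      (Prod.fst ⁻¹' W) := by
    have h1 : ContDiffOn ℝ ∞ (fun q : OpEu n × Eu n => star (U q.1)) (Prod.fst ⁻¹' W) :=
      (starOp n).contDiff.comp_contDiffOn (hUc.comp contDiffOn_fst fun q hq => hq)
    exact contDiffOn_fst.prodMk (h1.clm_apply contDiffOn_snd)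
  refine exists_contDiff_of_contDiffOn (hW.preimage continuous_fst) hlW
    (hT.comp hUs fun q hq => hq) fun l hl => ?_
  have hmap := hsec l.dir hl (l.finrank_dir.trans l₀.finrank_dir.symm)
  set u := Unitary.linearIsometryEquiv ⟨U l.dir.starProjection, hU _ hl⟩ with hu
  refine (integral_orthogonal_of_map_eq u hmap fun ξ : Eu n =>
    H (l.dir.starProjection, ‖ξ‖⁻¹ • ξ, ‖ξ‖) *
        Complex.exp (Complex.I * ((⟪l.foot, ξ⟫_ℝ : ℝ) : ℂ))).trans ?_
  refine integral_congr_ae (Filter.Eventually.of_forall fun ξ => ?_)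
  have hP : l.dir.starProjection = U l.dir.starProjection * l₀.dir.starProjection
      * star (U l.dir.starProjection) := by
    have h1 := starProjection_map_eq u l₀.dir
    have h2 : (l₀.dir.map (u.toLinearEquiv : Eu n →ₗ[ℝ] Eu n)).starProjection
        = l.dir.starProjection := by
      congr 1
    exact h2.symm.trans h1
  have hin : ⟪l.foot, u (ξ : Eu n)⟫_ℝ = ⟪star (U l.dir.starProjection) l.foot, (ξ : Eu n)⟫_ℝ := by
    have h1 : star (U l.dir.starProjection) l.foot = u.symm l.foot := rfl
    rw [h1, ← u.inner_map_map (u.symm l.foot), u.apply_symm_apply]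
  have hsm : ‖(ξ : Eu n)‖⁻¹ • u (ξ : Eu n) = U l.dir.starProjection (‖ξ‖⁻¹ • (ξ : Eu n)) := by
    exact (map_smul u _ _).symm
  show H (l.dir.starProjection, ‖u (ξ : Eu n)‖⁻¹ • u (ξ : Eu n), ‖u (ξ : Eu n)‖) * _ =
    H (U l.dir.starProjection * l₀.dir.starProjection * star (U l.dir.starProjection),
      U l.dir.starProjection (‖ξ‖⁻¹ • (ξ : Eu n)), ‖ξ‖) * (1 * _)
  rw [one_mul, u.norm_map, hsm, ← hP, hin]
  rfl

end InverseSmooth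

/-! ### Fourier inversion -/

section Inversion

open scoped FourierTransform

variable {V : Type*} [NormedAddCommGroup V] [InnerProductSpace ℝ V] [FiniteDimensional ℝ V]
  [MeasurableSpace V] [BorelSpace V]

/-- The constant `(2π)^{-d}` of the Fourier inversion formula. -/
def inversionConst (d : ℕ) : ℂ := ((((2 * Real.pi) ^ d)⁻¹ : ℝ) : ℂ)

theorem integral_comp_two_pi_smul (g : V → ℂ) : ∫ x, g ((2 * Real.pi) • x)
    = inversionConst (Module.finrank ℝ V) * ∫ x, g x := by
  rw [Measure.integral_comp_smul, abs_of_pos (by positivity), inversionConst, Complex.real_smul]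

/-- Fourier inversion, for a function whose Fourier transform is known to be integrable and given by
`φ` outside the origin. -/
theorem eq_waveInt_of_fourier_eq [Nontrivial V] {f φ : V → ℂ} (hfc : Continuous f)
    (hf : Integrable f) (hφ : Integrable φ) (h : ∀ ξ, ξ ≠ 0 →
      ∫ x, f x * Complex.exp (-Complex.I * ((⟪ξ, x⟫_ℝ : ℝ) : ℂ)) = φ ξ) (x : V) :
    f x = inversionConst (Module.finrank ℝ V) * waveInt φ x := by
  let ψ : V → ℂ := fun ξ => ∫ x, f x * Complex.exp (-Complex.I * ((⟪ξ, x⟫_ℝ : ℝ) : ℂ))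
  have hψφ : ψ =ᵐ[volume] φ := (ae_ne_zero V).mono fun ξ hξ => h ξ hξ
  have hψ : Integrable ψ := hφ.congr hψφ.symm
  have hF : 𝓕 f = fun w => ψ ((2 * Real.pi) • w) := by
    ext w
    rw [Real.fourier_eq']
    refine integral_congr_ae (Filter.Eventually.of_forall fun v => ?_)
    simp only [inner_smul_left, smul_eq_mul]
    rw [mul_comm, real_inner_comm]
    congr 2
    push_cast
    simp
    ring
  have hFi : Integrable (𝓕 f) := by
    rw [hF]
    exact hψ.comp_smul (by positivity)
  have h1 := hf.fourierInv_fourier_eq hFi hfc.continuousAt (v := x)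
  rw [← h1, Real.fourierInv_eq', hF]
  let g : V → ℂ := fun ξ => ψ ξ * Complex.exp (Complex.I * ((⟪x, ξ⟫_ℝ : ℝ) : ℂ))
  have h2 : ∀ v, Complex.exp (((2 * Real.pi * ⟪v, x⟫_ℝ : ℝ) : ℂ) * Complex.I) •
      ψ ((2 * Real.pi) • v) = g ((2 * Real.pi) • v) := by
    intro v
    simp only [g, inner_smul_right, smul_eq_mul]
    rw [mul_comm, real_inner_comm, mul_comm _ Complex.I]
  simp only [h2]
  rw [integral_comp_two_pi_smul]
  congr 1
  exact integral_congr_ae (hψφ.mono fun ξ hξ => by simp only [g, hξ])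

/-- Fourier inversion in the other order. -/
theorem fourier_waveInt_eq {φ : V → ℂ} (hφ : Integrable φ) (hw : Integrable (waveInt φ)) {ξ : V}
    (hc : ContinuousAt φ ξ) : ∫ x, inversionConst (Module.finrank ℝ V) * waveInt φ x *
      Complex.exp (-Complex.I * ((⟪ξ, x⟫_ℝ : ℝ) : ℂ)) = φ ξ := by
  have hF : 𝓕⁻ φ = fun w => waveInt φ ((2 * Real.pi) • w) := by
    ext w
    rw [Real.fourierInv_eq']
    refine integral_congr_ae (Filter.Eventually.of_forall fun v => ?_)
    simp only [inner_smul_left, smul_eq_mul]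
    rw [mul_comm, real_inner_comm, mul_comm _ Complex.I]
    simp
  have hFi : Integrable (𝓕⁻ φ) := by
    rw [hF]
    exact hw.comp_smul (by positivity)
  have hFi' : Integrable (𝓕 φ) := by
    have : 𝓕 φ = fun w => 𝓕⁻ φ (-w) := by
      ext w
      rw [Real.fourierInv_eq_fourier_neg, neg_neg]
    rw [this]
    exact hFi.comp_neg
  have h1 := hφ.fourier_fourierInv_eq hFi' hc
  rw [← h1, Real.fourier_eq', hF]
  let g : V → ℂ := fun x => waveInt φ x * Complex.exp (-Complex.I * ((⟪ξ, x⟫_ℝ : ℝ) : ℂ))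
  have h2 : ∀ v, Complex.exp (((-2 * Real.pi * ⟪v, ξ⟫_ℝ : ℝ) : ℂ) * Complex.I) •
      waveInt φ ((2 * Real.pi) • v) = g ((2 * Real.pi) • v) := by
    intro v
    simp only [g, inner_smul_right, smul_eq_mul]
    rw [mul_comm, real_inner_comm]
    congr 2
    push_cast
    ring
  simp only [h2]
  rw [integral_comp_two_pi_smul, ← integral_const_mul]
  simp only [g, mul_assoc]

end Inversion

/-! ### Paley–Wiener functions on a fibre -/

section Fiber

variable {p n : ℕ}

/-- The function `rω ↦ H(σ, ω, r)`, `r > 0`, on the fibre `σᗮ`. -/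
def fiberFun (H : OpEu n × Eu n × ℝ → ℂ) (s : Submodule ℝ (Eu n)) : sᗮ → ℂ := fun ξ =>
  H (s.starProjection, ‖ξ‖⁻¹ • (ξ : Eu n), ‖ξ‖)

theorem measurable_fiberFun {H : OpEu n × Eu n × ℝ → ℂ} (hH : Continuous H)
    (s : Submodule ℝ (Eu n)) : Measurable (fiberFun H s) :=
  hH.measurable.comp (measurable_const.prodMk ((by fun_prop : Measurable fun ξ : sᗮ =>
    (‖ξ‖⁻¹ • (ξ : Eu n))).prodMk (by fun_prop)))

theorem continuousAt_fiberFun {H : OpEu n × Eu n × ℝ → ℂ} (hH : Continuous H)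
    (s : Submodule ℝ (Eu n)) {ξ : sᗮ} (hξ : ξ ≠ 0) : ContinuousAt (fiberFun H s) ξ := by
  have h1 : ContinuousAt (fun ξ : sᗮ => ‖ξ‖⁻¹ • (ξ : Eu n)) ξ :=
    (continuous_norm.continuousAt.inv₀ (norm_ne_zero_iff.mpr hξ)).smul
      continuous_subtype_val.continuousAt
  exact hH.continuousAt.comp (continuousAt_const.prodMk (h1.prodMk continuous_norm.continuousAt))

theorem nontrivial_orthogonal_of_lt (hpn : p < n) {s : Submodule ℝ (Eu n)}
    (hs : Module.finrank ℝ s = p) : Nontrivial sᗮ := by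
  refine Module.nontrivial_of_finrank_pos (R := ℝ) ?_
  rw [finrank_orthogonal hs]
  omega

variable {F : FlagMfd p n × ℝ → ℂ} {H : OpEu n × Eu n × ℝ → ℂ} {R : ℝ}

theorem fiberFun_pos_smul (hFH : ∀ a, F a = H (FlagMfd.embed a)) {s : Submodule ℝ (Eu n)}
    (hs : Module.finrank ℝ s = p) (w : Metric.sphere (0 : sᗮ) 1) {r : ℝ} (hr : 0 < r) :
    fiberFun H s (r • (w : sᗮ)) = F (FlagMfd.ofSphere s hs w, r) := by
  have h1 : ‖r • (w : sᗮ)‖ = r := by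
    rw [norm_smul, norm_eq_of_mem_sphere, mul_one, Real.norm_of_nonneg hr.le]
  rw [hFH, fiberFun, h1]
  have h2 : r⁻¹ • ((r • (w : sᗮ) : sᗮ) : Eu n) = ((w : sᗮ) : Eu n) := by
    rw [Submodule.coe_smul, inv_smul_smul₀ hr.ne']
  rw [h2]
  rfl

theorem fiberFun_eq (hFH : ∀ a, F a = H (FlagMfd.embed a)) {s : Submodule ℝ (Eu n)}
    (hs : Module.finrank ℝ s = p) {ξ : sᗮ} (hξ : ξ ≠ 0) :
    fiberFun H s ξ = F (FlagMfd.ofSphere s hs ⟨‖ξ‖⁻¹ • ξ, by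
      simpa using norm_normalize_eq_one hξ⟩, ‖ξ‖) := by
  rw [← fiberFun_pos_smul hFH hs _ (norm_pos_iff.mpr hξ)]
  simp only [smul_inv_smul₀ (norm_ne_zero_iff.mpr hξ)]

theorem PaleyWiener.exists_bound (hF : PaleyWiener R F) (N : ℕ) :
    ∃ C, ∀ a (r : ℝ), (1 + |r|) ^ N * ‖F (a, r)‖ ≤ C := by
  obtain ⟨Φ, -, hΦF, hb, -⟩ := hF
  obtain ⟨C, hC⟩ := hb N
  refine ⟨C, fun a r => ?_⟩
  simpa [hΦF] using hC a r

/-- The estimates of the Paley–Wiener condition on the real axis make the fibre functions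
integrable. -/
theorem PaleyWiener.integrable_fiberFun (hpn : p < n) (hF : PaleyWiener R F) (hH : Continuous H)
    (hFH : ∀ a, F a = H (FlagMfd.embed a)) {s : Submodule ℝ (Eu n)}
    (hs : Module.finrank ℝ s = p) : Integrable (fiberFun H s) := by
  have := nontrivial_orthogonal_of_lt hpn hs
  obtain ⟨C, hC⟩ := hF.exists_bound (0 + 2 * (Module.finrank ℝ sᗮ + 1))
  refine ((integrable_inv_one_add_norm_sq_pow sᗮ).const_mul (1 * C)).mono'
    (measurable_fiberFun hH s).aestronglyMeasurable ?_
  filter_upwards [ae_ne_zero sᗮ] with ξ hξ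
  have h2 := hC (FlagMfd.ofSphere s hs ⟨‖ξ‖⁻¹ • ξ, by
      simpa using norm_normalize_eq_one hξ⟩) ‖ξ‖
  rw [abs_norm, ← fiberFun_eq hFH hs hξ] at h2
  have h3 := pow_mul_le_of_decay (a := 1) (norm_nonneg ξ) (norm_nonneg _) zero_le_one (by simp) h2
  rwa [mul_one] at h3

/-- The values of a Paley–Wiener function at `(σ, ω; r)` and `(σ, -ω; -r)` agree, since all their
harmonic components do. -/
theorem PaleyWiener.neg_neg (hpn : p < n) (hF : PaleyWiener R F) (hH : Continuous H)
    (hFH : ∀ a, F a = H (FlagMfd.embed a)) {s : Submodule ℝ (Eu n)}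
    (hs : Module.finrank ℝ s = p) (w : Metric.sphere (0 : sᗮ) 1) {r : ℝ} (hr : r ≠ 0) :
    F (FlagMfd.ofSphere s hs (-w), -r) = F (FlagMfd.ofSphere s hs w, r) := by
  have := nontrivial_orthogonal_of_lt hpn hs
  obtain ⟨Φ, -, hΦF, -, hharm⟩ := hF
  let b := stdOrthonormalBasis ℝ sᗮ
  have hcont : ∀ r : ℝ, Continuous fun w : Metric.sphere (0 : sᗮ) 1 =>
      F (FlagMfd.ofSphere s hs w, r) := by
    intro r
    simp only [hFH]
    show Continuous fun w : Metric.sphere (0 : sᗮ) 1 => H (s.starProjection, ((w : sᗮ) : Eu n), r)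
    exact hH.comp (continuous_const.prodMk
      ((continuous_subtype_val.comp continuous_subtype_val).prodMk continuous_const))
  have hcn : Continuous fun w : Metric.sphere (0 : sᗮ) 1 =>
      F (FlagMfd.ofSphere s hs (-w), -r) := (hcont (-r)).comp continuous_neg
  have h := eq_zero_of_forall_harmonic_integral_eq_zero b Module.finrank_pos
    (fun w => F (FlagMfd.ofSphere s hs (-w), -r) - F (FlagMfd.ofSphere s hs w, r))
    (hcn.sub (hcont r)) (fun k P hP hl => ?_) w
  · exact sub_eq_zero.mp h
  obtain ⟨g, -, hge, hg⟩ := hharm k s hs _ (isHarmonicPoly_polyFun b hP hl)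
  have hPc : Continuous fun w : Metric.sphere (0 : sᗮ) 1 => polyFun b P w :=
    (continuous_polyFun b P).comp continuous_subtype_val
  have hI : ∀ r : ℝ, r ≠ 0 → ∫ w : Metric.sphere (0 : sᗮ) 1, F (FlagMfd.ofSphere s hs w, r) *
      polyFun b P w ∂(volume : Measure sᗮ).toSphere = (r : ℂ) ^ k * g r := by
    intro r hr
    have hr' : (r : ℂ) ≠ 0 := by exact_mod_cast hr
    rw [hg r hr', mul_inv_cancel_left₀ (pow_ne_zero _ hr')]
    simp only [hΦF]
  have hint : ∀ {v : Metric.sphere (0 : sᗮ) 1 → ℂ}, Continuous v →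
      Integrable (fun w => v w * polyFun b P w) (volume : Measure sᗮ).toSphere := fun hv =>
    (hv.mul hPc).integrable_of_hasCompactSupport (HasCompactSupport.of_compactSpace _)
  -- both `P` and `rᵏ g(r)` have the parity of `k`, so the two signs cancel
  have hneg : ∫ w : Metric.sphere (0 : sᗮ) 1, F (FlagMfd.ofSphere s hs (-w), -r) *
      polyFun b P w ∂(volume : Measure sᗮ).toSphere = (r : ℂ) ^ k * g r := by
    rw [← (measurePreserving_neg_sphere (V := sᗮ)).integral_comp
      (Homeomorph.neg (Metric.sphere (0 : sᗮ) 1)).measurableEmbedding]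
    have h1 : ∀ w : Metric.sphere (0 : sᗮ) 1, polyFun b P ((-w : Metric.sphere (0 : sᗮ) 1) : sᗮ)
        = (-1) ^ k * polyFun b P w := fun w => by
      have := polyFun_smul b hP (-1) (w : sᗮ)
      simpa using this
    simp only [_root_.neg_neg, h1]
    have h2 : ∀ w : Metric.sphere (0 : sᗮ) 1, F (FlagMfd.ofSphere s hs w, -r) *
        ((-1) ^ k * polyFun b P w) = (-1) ^ k * (F (FlagMfd.ofSphere s hs w, -r) * polyFun b P w) :=
      fun w => by ring
    simp only [h2]
    rw [integral_const_mul, hI (-r) (neg_ne_zero.mpr hr), Complex.ofReal_neg, hge, neg_pow (r : ℂ),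
      ← mul_assoc, ← mul_assoc, ← mul_pow]
    simp
  simp only [sub_mul]
  rw [integral_sub (hint hcn) (hint (hcont r)), hneg, hI r hr, sub_self]

/-- By the symmetry `PaleyWiener.neg_neg`, polar coordinates with negative radius are compatible
with `fiberFun`, whose definition uses positive radii only. -/
theorem fiberFun_smul (hpn : p < n) (hF : PaleyWiener R F) (hH : Continuous H)
    (hFH : ∀ a, F a = H (FlagMfd.embed a)) {s : Submodule ℝ (Eu n)}
    (hs : Module.finrank ℝ s = p) (w : Metric.sphere (0 : sᗮ) 1) {r : ℝ} (hr : r ≠ 0) :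
    fiberFun H s (r • (w : sᗮ)) = F (FlagMfd.ofSphere s hs w, r) := by
  rcases hr.lt_or_gt with h | h
  · rw [← hF.neg_neg hpn hH hFH hs w hr, ← fiberFun_pos_smul hFH hs _ (neg_pos.mpr h)]
    congr 1
    show r • (w : sᗮ) = (-r) • (-(w : sᗮ))
    rw [neg_smul_neg]
  · exact fiberFun_pos_smul hFH hs w h

/-- The inverse Fourier transform of a Paley–Wiener function of type `R` is supported in the ball of
radius `R`. -/
theorem PaleyWiener.waveInt_fiberFun_eq_zero (hpn : p < n) (hR : 0 ≤ R) (hF : PaleyWiener R F)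
    (hH : Continuous H) (hFH : ∀ a, F a = H (FlagMfd.embed a)) {s : Submodule ℝ (Eu n)}
    (hs : Module.finrank ℝ s = p) {x : sᗮ} (hx : R < ‖x‖) : waveInt (fiberFun H s) x = 0 := by
  have := nontrivial_orthogonal_of_lt hpn hs
  let b := stdOrthonormalBasis ℝ sᗮ
  refine waveInt_eq_zero_of_harmonic_components b Module.finrank_pos
    (hF.integrable_fiberFun hpn hH hFH hs) hR (fun k P hP hl => ?_) hx
  obtain ⟨Φ, -, hΦF, hb, hharm⟩ := hF
  obtain ⟨g, hgd, hge, hg⟩ := hharm k s hs _ (isHarmonicPoly_polyFun b hP hl)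
  refine ⟨g, hgd, hge, fun N => ?_, fun r hr => ?_⟩
  · obtain ⟨C, hC⟩ := hb N
    obtain ⟨K, hK⟩ := isCompact_univ.exists_bound_of_continuousOn
      (f := fun w : Metric.sphere (0 : sᗮ) 1 => polyFun b P w)
      ((continuous_polyFun b P).comp continuous_subtype_val).continuousOn
    obtain ⟨B, hB⟩ := (isCompact_closedBall (0 : ℂ) 1).exists_bound_of_continuousOn
      hgd.continuous.continuousOn
    have hK0 : 0 ≤ K := by
      obtain ⟨w⟩ : Nonempty (Metric.sphere (0 : sᗮ) 1) :=
        (NormedSpace.sphere_nonempty.mpr zero_le_one).to_subtype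
      exact (norm_nonneg _).trans (hK w trivial)
    have hB0 : 0 ≤ B := (norm_nonneg _).trans (hB 0 (by simp))
    have hC0 : 0 ≤ C := by
      obtain ⟨w⟩ : Nonempty (Metric.sphere (0 : sᗮ) 1) :=
        (NormedSpace.sphere_nonempty.mpr zero_le_one).to_subtype
      exact le_trans (by positivity) (hC (FlagMfd.ofSphere s hs w) 0)
    set m := (volume : Measure sᗮ).toSphere.real Set.univ with hm
    have hm0 : 0 ≤ m := measureReal_nonneg
    refine ⟨2 ^ N * B + C * K * m, fun z => ?_⟩
    have he : 1 ≤ Real.exp (R * |z.im|) := Real.one_le_exp (by positivity)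
    -- near `0` the factor `z⁻ᵏ` is unbounded, but `g` is bounded there by continuity; for `|z| ≥ 1`
    -- the estimate of `Φ` passes to `g` through the integral
    by_cases hz : ‖z‖ ≤ 1
    · have h1 : (1 + ‖z‖) ^ N ≤ 2 ^ N := pow_le_pow_left₀ (by positivity) (by linarith) N
      calc (1 + ‖z‖) ^ N * ‖g z‖ ≤ 2 ^ N * B :=
            mul_le_mul h1 (hB z (by simpa using hz)) (norm_nonneg _) (by positivity)
        _ ≤ 2 ^ N * B + C * K * m := le_add_of_nonneg_right (by positivity)
        _ ≤ _ := le_mul_of_one_le_right (by positivity) he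
    · have hz1 : 1 ≤ ‖z‖ := (lt_of_not_ge hz).le
      have hz0 : z ≠ 0 := fun h => by simp [h] at hz1; linarith
      have h1 : ∀ w : Metric.sphere (0 : sᗮ) 1, ‖Φ (FlagMfd.ofSphere s hs w) z * polyFun b P w‖
          ≤ C * Real.exp (R * |z.im|) / (1 + ‖z‖) ^ N * K := by
        intro w
        rw [norm_mul]
        refine mul_le_mul ?_ (hK w trivial) (norm_nonneg _) (by positivity)
        have h2 := hC (FlagMfd.ofSphere s hs w) z
        rw [neg_mul, Real.exp_neg, ← div_eq_mul_inv, div_le_iff₀ (Real.exp_pos _)] at h2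
        rw [le_div_iff₀ (by positivity), mul_comm]
        exact h2
      have h2 := norm_integral_le_of_norm_le_const (μ := (volume : Measure sᗮ).toSphere)
        (Filter.Eventually.of_forall h1)
      have h3 : ‖g z‖ ≤ C * Real.exp (R * |z.im|) / (1 + ‖z‖) ^ N * K * m := by
        rw [hg z hz0, norm_mul, norm_inv, norm_pow]
        refine le_trans (mul_le_of_le_one_left (norm_nonneg _) ?_) h2
        exact inv_le_one_of_one_le₀ (one_le_pow₀ hz1)
      have hpos : (0 : ℝ) < (1 + ‖z‖) ^ N := by positivity
      calc (1 + ‖z‖) ^ N * ‖g z‖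
          ≤ (1 + ‖z‖) ^ N * (C * Real.exp (R * |z.im|) / (1 + ‖z‖) ^ N * K * m) :=
            mul_le_mul_of_nonneg_left h3 hpos.le
        _ = C * K * m * Real.exp (R * |z.im|) := by field_simp
        _ ≤ _ := mul_le_mul_of_nonneg_right (le_add_of_nonneg_left (by positivity))
            (Real.exp_pos _).le
  · have hr' : (r : ℂ) ≠ 0 := by exact_mod_cast hr.ne'
    rw [hg r hr', mul_inv_cancel_left₀ (pow_ne_zero _ hr')]
    simp only [hΦF, fiberFun_pos_smul hFH hs _ hr]

/-- Surjectivity of the partial Fourier transform onto the Paley–Wiener space. -/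
theorem exists_testFunction_of_paleyWiener (hpn : p < n) (hR : 0 < R)
    (hFS : FlagMfd.IsSchwartz F) (hF : PaleyWiener R F) :
    ∃ f ∈ AffGr.testFunctions p n R, polarFourier f = F := by
  obtain ⟨H, hH, hFH⟩ := hFS.exists_rapidDecay
  have hHc : Continuous H := hH.1.continuous
  let f : AffGr p n → ℂ := fun l => inversionConst (n - p) * ∫ ξ : l.dirᗮ,
      H (l.dir.starProjection, ‖ξ‖⁻¹ • (ξ : Eu n), ‖ξ‖) *
        Complex.exp (Complex.I * ((⟪l.foot, (ξ : Eu n)⟫_ℝ : ℝ) : ℂ))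
  have hfw : ∀ (s : Submodule ℝ (Eu n)) (hs : Module.finrank ℝ s = p) (x : sᗮ),
      f ⟨s, hs, x, x.2⟩ = inversionConst (n - p) * waveInt (fiberFun H s) x := fun s hs x => rfl
  have hf : f ∈ AffGr.testFunctions p n R := by
    refine ⟨fun l => ?_, fun l hl => ?_⟩
    · obtain ⟨W, hW, hlW, g, hg, hgf⟩ := isSmooth_inverse hpn hH l
      exact ⟨W, hW, hlW, fun v => inversionConst (n - p) * g v, contDiff_const.mul hg,
        fun b hb => congrArg (fun z : ℂ => inversionConst (n - p) * z) (hgf b hb)⟩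
    · have h1 := hF.waveInt_fiberFun_eq_zero hpn hR.le hHc hFH l.finrank_dir
        (x := ⟨l.foot, l.foot_mem⟩) hl
      exact (hfw l.dir l.finrank_dir ⟨l.foot, l.foot_mem⟩).trans (by rw [h1, mul_zero])
  refine ⟨f, hf, ?_⟩
  have hne : ∀ (a : FlagMfd p n) (r : ℝ), r ≠ 0 → polarFourier f (a, r) = F (a, r) := by
    intro a r hr
    have := nontrivial_orthogonal a
    let w : Metric.sphere (0 : a.dirᗮ) 1 := ⟨⟨a.vec, a.vec_mem⟩, by
      rw [mem_sphere_zero_iff_norm]; exact a.norm_vec⟩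
    have hint := hF.integrable_fiberFun hpn hHc hFH a.finrank_dir
    have hw0 : r • (w : a.dirᗮ) ≠ 0 :=
      smul_ne_zero hr (norm_ne_zero_iff.mp (by rw [norm_eq_of_mem_sphere]; exact one_ne_zero))
    have hwi : Integrable (waveInt (fiberFun H a.dir)) :=
      integrable_of_eq_zero_of_lt_norm (continuous_waveInt hint) fun x hx =>
        hF.waveInt_fiberFun_eq_zero hpn hR.le hHc hFH a.finrank_dir hx
    have h1 := fourier_waveInt_eq hint hwi (continuousAt_fiberFun hHc a.dir hw0)
    rw [fiberFun_smul hpn hF hHc hFH a.finrank_dir w hr, finrank_orthogonal a.finrank_dir] at h1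
    exact h1
  ext ⟨a, r⟩
  -- at `r = 0` both sides are limits of their values at `r ≠ 0`
  by_cases hr : r = 0
  · have hc1 : Continuous fun r : ℝ => F (a, r) := by
      simp only [hFH]
      show Continuous fun r : ℝ => H (a.dir.starProjection, a.vec, r)
      exact hHc.comp (continuous_const.prodMk (continuous_const.prodMk continuous_id))
    have hc2 : Continuous fun r : ℝ => polarFourier f (a, r) := by
      obtain ⟨K, hK, hfK⟩ := (polarFourier_testFunctions hR hf).1.1.exists_extension
      simp only [hfK]
      show Continuous fun r : ℝ => K (a.dir.starProjection, a.vec, r)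
      exact hK.continuous.comp (continuous_const.prodMk (continuous_const.prodMk continuous_id))
    have h := hc2.ext_on (dense_compl_singleton (0 : ℝ)) hc1 fun r hr => hne a r hr
    exact congrFun h r
  · exact hne a r hr

/-- A Schwartz function whose partial Fourier transform satisfies the Paley–Wiener conditions of
type `R` is supported at distance `≤ R` from the origin. -/
theorem mem_testFunctions_of_paleyWiener (hpn : p < n) (hR : 0 < R) {f : AffGr p n → ℂ}
    (hf : AffGr.IsSchwartz f) (hs : FlagMfd.IsSmooth (polarFourier f))
    (hF : PaleyWiener R (polarFourier f)) : f ∈ AffGr.testFunctions p n R := by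
  refine ⟨hf.1, fun l hl => ?_⟩
  obtain ⟨H, hH, hFH⟩ := hs.exists_extension
  obtain ⟨g, hg, hfg⟩ := hf.1.exists_extension
  have := nontrivial_orthogonal_of_lt hpn l.finrank_dir
  let fs : l.dirᗮ → ℂ := fun x => f ⟨l.dir, l.finrank_dir, x, x.2⟩
  have hfc : Continuous fs := by
    simp only [fs, hfg]
    show Continuous fun x : l.dirᗮ => g (l.dir.starProjection, (x : Eu n))
    exact hg.continuous.comp (continuous_const.prodMk continuous_subtype_val)
  have hfi : Integrable fs := by
    obtain ⟨C₀, hC₀⟩ := hf.2 0 []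
    obtain ⟨C, hC⟩ := hf.2 (0 + 2 * (Module.finrank ℝ l.dirᗮ + 1)) []
    refine ((integrable_inv_one_add_norm_sq_pow l.dirᗮ).const_mul
      (1 * (2 ^ (0 + 2 * (Module.finrank ℝ l.dirᗮ + 1)) * (C₀ + C)))).mono'
      hfc.aestronglyMeasurable (Filter.Eventually.of_forall fun x => ?_)
    have h3 := pow_mul_le_of_decay (a := 1) (b := ‖fs x‖) (M := 0)
      (d := Module.finrank ℝ l.dirᗮ + 1) (norm_nonneg x) (norm_nonneg _) zero_le_one (by simp)
      (C := 2 ^ (0 + 2 * (Module.finrank ℝ l.dirᗮ + 1)) * (C₀ + C)) ?_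
    · rwa [mul_one] at h3
    · refine (mul_le_mul_of_nonneg_right (one_add_pow_le_two_pow_mul (norm_nonneg x) _)
        (norm_nonneg _)).trans ?_
      rw [mul_assoc, add_mul]
      exact mul_le_mul_of_nonneg_left
        (add_le_add (by simpa using hC₀ ⟨l.dir, l.finrank_dir, x, x.2⟩)
          (hC ⟨l.dir, l.finrank_dir, x, x.2⟩)) (by positivity)
  have hfour : ∀ ξ : l.dirᗮ, ξ ≠ 0 → ∫ x, fs x * Complex.exp (-Complex.I * ((⟪ξ, x⟫_ℝ : ℝ) : ℂ))
      = fiberFun H l.dir ξ := by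
    intro ξ hξ
    rw [fiberFun_eq hFH l.finrank_dir hξ]
    refine integral_congr_ae (Filter.Eventually.of_forall fun x => ?_)
    have h1 : (FlagMfd.toAffGr (FlagMfd.ofSphere l.dir l.finrank_dir ⟨‖ξ‖⁻¹ • ξ, by
        simpa using norm_normalize_eq_one hξ⟩, ‖ξ‖)).foot = (ξ : Eu n) := by
      show ‖ξ‖ • (‖ξ‖⁻¹ • (ξ : Eu n)) = _
      exact smul_inv_smul₀ (norm_ne_zero_iff.mpr hξ) _
    simp only [h1]
    rfl
  -- Fourier inversion on the fibre through the given plane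
  have h1 := eq_waveInt_of_fourier_eq hfc hfi (hF.integrable_fiberFun hpn hH.continuous hFH
    l.finrank_dir) hfour ⟨l.foot, l.foot_mem⟩
  rw [hF.waveInt_fiberFun_eq_zero hpn hR.le hH.continuous hFH l.finrank_dir
    (x := ⟨l.foot, l.foot_mem⟩) hl, mul_zero] at h1
  exact h1

end Fiber

end

theorem theorem6p1 (p n : ℕ) (hpn : p < n) (R : ℝ) (hR : 0 < R) :
    (polarFourier '' AffGr.testFunctions p n R =
      {F : FlagMfd p n × ℝ → ℂ | FlagMfd.IsSchwartz F ∧ PaleyWiener R F}) ∧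
    (∀ f : AffGr p n → ℂ, AffGr.IsSchwartz f →
      (f ∈ AffGr.testFunctions p n R ↔
        FlagMfd.IsSmooth (polarFourier f) ∧ PaleyWiener R (polarFourier f))) := by
  refine ⟨Set.Subset.antisymm ?_ ?_, fun f hf => ⟨fun h => ?_, fun h => ?_⟩⟩
  · rintro _ ⟨f, hf, rfl⟩
    exact polarFourier_testFunctions hR hf
  · rintro F ⟨hFS, hF⟩
    exact exists_testFunction_of_paleyWiener hpn hR hFS hF
  · obtain ⟨h1, h2⟩ := polarFourier_testFunctions hR h
    exact ⟨h1.1, h2⟩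
  · exact mem_testFunctions_of_paleyWiener hpn hR hf h.1 h.2
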